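/- **Notation.** $N=2^n$; vectors in $\mathbb{R}^N$ are indexed by $\mathbb{F}_2^n$, and $[D]$ has $D\ge 1$ elements. $H_k(x)$ agrees with $x$ on $k$ coordinates of largest absolute value and vanishes elsewhere. A function $h\colon \mathbb{F}_2^n\times[D]\to\mathbb{F}_2^r$ is a *$(\kappa,\epsilon)$-lossless condenser* if for every nonempty $S\subseteq\mathbb{F}_2^n$ with $|S|\le 2^\kappa$ and independent uniform $X\in S$, $Z\in[D]$, the distribution of $(Z,h(X,Z))$ is within statistical distance $\epsilon$ of a distribution with min-entropy at least $\log_2(D|S|)$. The adjacency matrix $M\in\{0,1\}^{D2^r\times N}$ of the bipartite graph associated with $h$ has entry $1$ in row $(b,t)\in\mathbb{F}_2^r\times[D]$ and column $a$ iff $h(a,t)=b$. The bit selection matrix $B\in\{0,1\}^{n\times N}$ has the $j$th bit of $i$ in row $j$ and column $i$. The row of $M\otimes B$ indexed by a pair of a row of $M$ and a row of $B$ is the coordinate-wise product of these two rows. **Theorem.** There are absolute constants $c>0$ and $\epsilon>0$ such that the following holds. Let $I$ be a set of pairs $(n,k)$ of positive integers with $k\le 2^n$, and for each $(n,k)\in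 I$ let $h=h_{n,k}\colon\mathbb{F}_2^n\times[D]\to\mathbb{F}_2^r$ (with $D=D_{n,k}$ and $r=r_{n,k}\le n$) be a $(\log_2(4k),\epsilon)$-lossless condenser. Suppose the family is explicit: one program computes $h_{n,k}(a,t)$ from $k,a,t$ in time $n^{O(1)}$ (time includes reading the input). Then, for each polynomial bound $\log_2 L\le n^{O(1)}$, there is a deterministic algorithm that, for every $(n,k)\in I$ and every $x\in\mathbb{R}^N$ whose entries are fixed-point binary numbers $m/2^p$ with integers $|m|\le L$ (and $p$ common to all entries), given $k$, the dimensions $n, r$, and the vectors $Mx$ and $(M\otimes B)x$ in fixed-point representation (but not $x$), outputs, as a list of positions and values, a $k$-sparse vector $\tilde x\in\mathbb{R}^N$ with $$\|\tilde x-x\|_1\le c\cdot\|x-H_k(x)\|_1,$$ and whose running time is $O(2^r D^2 n^{O(1)})$. The constants in the running time may depend on the family $h$ and on the polynomial bound on $\log_2 L$, but not on $n$, $k$, $L$, $p$ or $x$. Running time counts the steps of a program in the first-order functional language on binary trees (pure LISP with $\mathrm{cons}$, $\mathrm{hd}$, $\mathrm{tl}$, a test for $\mathrm{nil}$, composition and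 recursion, each at unit cost, numbers being lists of bits), plus the sizes of input and output; every such step is a bounded number of pointer operations. -/

import Mathlib

namespace SparseRecovery

/-! ### A machine model with a step count

Pure first-order functional programs on binary trees (pure LISP without atoms other than `nil`).
The model is polynomially equivalent to Turing machines, and every counted step is a bounded
number of pointer operations on a random access machine. There is no built-in arithmetic:
numbers are lists of bits. -/

/-- Binary trees, the only data of the machine model. -/
inductive SExp where
  | nil : SExp
  | cons : SExp → SExp → SExp

namespace SExp

/-- The number of nodes. -/
def size : SExp → ℕ
  | nil => 1
  | cons a b => a.size + b.size + 1

/-- First component (`nil` for `nil`). -/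
def hd : SExp → SExp
  | nil => nil
  | cons a _ => a

/-- Second component (`nil` for `nil`). -/
def tl : SExp → SExp
  | nil => nil
  | cons _ b => b

end SExp

/-- Programs. A program is the body of a function of one argument, which may call itself. -/
inductive Code where
  /-- the constant `nil` -/
  | nil : Code
  /-- the argument of the function -/
  | arg : Code
  /-- first component of the value of `e` -/
  | hd (e : Code) : Code
  /-- second component of the value of `e` -/
  | tl (e : Code) : Code
  /-- the pair of the values of `e` and `f` -/
  | cons (e f : Code) : Code
  /-- the value of `f` if the value of `e` is `nil`, and the value of `g` otherwise -/
  | ite (e f g : Code) : Code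
  /-- `f`, with the value of `e` as its argument -/
  | comp (f e : Code) : Code
  /-- recursive call of the enclosing function on the current argument -/
  | self : Code
  /-- call, on the current argument, of the recursive function whose body is `f` -/
  | fn (f : Code) : Code

/-- `Runs b e d v s`: inside the function with body `b`, the expression `e` evaluates on the
argument `d` to the value `v` in exactly `s` steps. -/
inductive Runs : Code → Code → SExp → SExp → ℕ → Prop where
  | nil (b : Code) (d : SExp) : Runs b Code.nil d SExp.nil 1
  | arg (b : Code) (d : SExp) : Runs b Code.arg d d 1
  | hd {b e : Code} {d v : SExp} {s : ℕ} : Runs b e d v s → Runs b (Code.hd e) d v.hd (s + 1)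
  | tl {b e : Code} {d v : SExp} {s : ℕ} : Runs b e d v s → Runs b (Code.tl e) d v.tl (s + 1)
  | cons {b e f : Code} {d v w : SExp} {s t : ℕ} : Runs b e d v s → Runs b f d w t →
      Runs b (Code.cons e f) d (SExp.cons v w) (s + t + 1)
  | iteNil {b e f g : Code} {d v : SExp} {s t : ℕ} : Runs b e d SExp.nil s → Runs b f d v t →
      Runs b (Code.ite e f g) d v (s + t + 1)
  | iteCons {b e f g : Code} {d p q v : SExp} {s t : ℕ} : Runs b e d (SExp.cons p q) s →
      Runs b g d v t → Runs b (Code.ite e f g) d v (s + t + 1)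
  | comp {b f e : Code} {d u v : SExp} {s t : ℕ} : Runs b e d u s → Runs b f u v t →
      Runs b (Code.comp f e) d v (s + t + 1)
  | self {b : Code} {d v : SExp} {s : ℕ} : Runs b b d v s → Runs b Code.self d v (s + 1)
  | fn {b f : Code} {d v : SExp} {s : ℕ} : Runs f f d v s → Runs b (Code.fn f) d v (s + 1)

/-- On the given input, the program halts with the given output within time `T`, where
reading the input and writing the output are charged with their sizes. -/
def ComputesIn (prog : Code) (input output : SExp) (T : ℕ) : Prop :=
  ∃ s : ℕ, Runs prog prog input output s ∧ input.size + s + output.size ≤ T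

/-! ### Encodings -/

/-- A list. -/
def encList : List SExp → SExp
  | [] => SExp.nil
  | a :: l => SExp.cons a (encList l)

/-- A bit. -/
def encBit (b : Bool) : SExp := if b then SExp.cons SExp.nil SExp.nil else SExp.nil

/-- A natural number in unary. -/
def encUnary (m : ℕ) : SExp := encList (List.replicate m SExp.nil)

/-- A natural number in binary, least significant bit first. -/
def encNat (m : ℕ) : SExp := encList (m.bits.map encBit)

/-- An integer: its sign bit and its absolute value in binary. -/
def encInt (z : ℤ) : SExp := SExp.cons (encBit (decide (z < 0))) (encNat z.natAbs)

/-- The fixed-point representation of a real number `v` with `p` binary digits after the point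
(exact if `2 ^ p * v` is an integer). -/
noncomputable def encFix (p : ℕ) (v : ℝ) : SExp := encInt ⌊2 ^ p * v⌋

/-- `𝔽₂ⁿ`. -/
abbrev F2 (n : ℕ) : Type := Fin n → ZMod 2

/-- An element of `𝔽₂ⁿ` as a list of `n` bits. -/
def encF2 {n : ℕ} (a : F2 n) : SExp := encList (List.ofFn fun j => encBit (decide (a j = 1)))

/-- An array indexed by `𝔽₂ʳ`, as the complete binary tree of depth `r` in which the path `b`
leads to the entry `f b`. -/
def encArray : (r : ℕ) → (F2 r → SExp) → SExp
  | 0, f => f ![]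
  | r + 1, f => SExp.cons (encArray r fun b => f (Matrix.vecCons 0 b))
      (encArray r fun b => f (Matrix.vecCons 1 b))

/-- `out` lists the support of `v` (possibly with some further positions), each position once
and together with the value of `v` there in fixed-point representation. -/
def IsSparseList {n : ℕ} (p : ℕ) (v : F2 n → ℝ) (out : SExp) : Prop :=
  ∃ l : List (F2 n × ℤ), (l.map Prod.fst).Nodup ∧
    (∀ q ∈ l, v q.1 = (q.2 : ℝ) / 2 ^ p) ∧
    (∀ i, i ∉ l.map Prod.fst → v i = 0) ∧
    out = encList (l.map fun q => SExp.cons (encF2 q.1) (encInt q.2))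

/-! ### Lossless condensers -/

/-- Statistical distance of two distributions on a finite set. -/
noncomputable def statDist {Ω : Type} [Fintype Ω] (P Q : PMF Ω) : ℝ :=
  1 / 2 * ∑ s, |(P s).toReal - (Q s).toReal|

/-- Min-entropy: the minimum of `-log₂ P(s)` over the support of `P`. -/
noncomputable def minEntropy {Ω : Type} (P : PMF Ω) : ℝ :=
  ⨅ s : P.support, -Real.logb 2 (P s).toReal

/-- `h : 𝔽₂ⁿ × [D] → 𝔽₂ʳ` is a `(κ, ε)`-lossless condenser: for all nonempty `S` of size at most
`2 ^ κ`, and independent uniform `X ∈ S` and `Z ∈ [D]`, the distribution of `(Z, h (X, Z))` is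
`ε`-close to a distribution of min-entropy at least `log₂ (D |S|)`. -/
def IsLosslessCondenser {n D r : ℕ} (κ ε : ℝ) (h : F2 n → Fin D → F2 r) : Prop :=
  ∃ _ : Nonempty (Fin D), ∀ (S : Finset (F2 n)) (hS : S.Nonempty), (S.card : ℝ) ≤ 2 ^ κ →
    ∃ Q : PMF (Fin D × F2 r), Real.logb 2 (D * S.card) ≤ minEntropy Q ∧
      statDist ((PMF.uniformOfFinset S hS).bind fun X =>
        (PMF.uniformOfFintype (Fin D)).map fun Z => (Z, h X Z)) Q ≤ ε

/-- The functions `h n k`, for `(n, k) ∈ I`, are explicit: one program computes `h n k a t`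
from `k`, `a` and `t` in time polynomial in `n`. -/
def IsExplicit (I : Set (ℕ × ℕ)) {D r : ℕ → ℕ → ℕ}
    (h : ∀ n k : ℕ, F2 n → Fin (D n k) → F2 (r n k)) : Prop :=
  ∃ (prog : Code) (C : ℕ), ∀ n k : ℕ, (n, k) ∈ I → ∀ (a : F2 n) (t : Fin (D n k)),
    ComputesIn prog (SExp.cons (encNat k) (SExp.cons (encF2 a) (encNat t)))
      (encF2 (h n k a t)) (C * n ^ C)

/-! ### Measurements -/

/-- The adjacency matrix of the bipartite graph associated with `h`, with left vertices `𝔽₂ⁿ`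
(columns), right vertices `[D] × 𝔽₂ʳ` (rows), and an edge between `a` and `(t, b)` iff
`h (a, t) = b`. -/
def adjMatrix {n D r : ℕ} (h : F2 n → Fin D → F2 r) : Matrix (Fin D × F2 r) (F2 n) ℝ :=
  Matrix.of fun q a => if h a q.1 = q.2 then 1 else 0

/-- The bit selection matrix: the entry in row `j` and column `i` is the `j`th bit of `i`. -/
def bitSelection (n : ℕ) : Matrix (Fin n) (F2 n) ℝ :=
  Matrix.of fun j i => if i j = 1 then 1 else 0

/-- The tensor product `A ⊗ A'` whose row `(i, i')` is the coordinate-wise product of row `i` of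
`A` and row `i'` of `A'`. -/
def rowTensor {m m' N : Type} (A : Matrix m N ℝ) (A' : Matrix m' N ℝ) : Matrix (m × m') N ℝ :=
  Matrix.of fun q a => A q.1 a * A' q.2 a

/-- The input of the recovery algorithm: the dimensions `n` and `r` (in unary), `k` (in binary),
and two vectors `y`, `y'` in fixed-point representation, namely for each `t ∈ [D]` the array of
the `y (t, b)`, and for each `t ∈ [D]` the array of the lists of the `y' ((t, b), j)`,
`j = 1, …, n`. -/
noncomputable def sketchInput {n D r : ℕ} (p k : ℕ) (y : Fin D × F2 r → ℝ)
    (y' : (Fin D × F2 r) × Fin n → ℝ) : SExp :=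
  SExp.cons (encUnary n) (SExp.cons (encUnary r) (SExp.cons (encNat k) (SExp.cons
    (encList (List.ofFn fun t => encArray r fun b => encFix p (y (t, b))))
    (encList (List.ofFn fun t => encArray r fun b =>
      encList (List.ofFn fun j => encFix p (y' ((t, b), j))))))))

/-! ### Sparse approximation -/

/-- The `ℓ₁` norm. -/
def l1norm {ι : Type} [Fintype ι] (v : ι → ℝ) : ℝ := ∑ i, |v i|

/-- `v` has at most `k` nonzero entries. -/
def IsSparse {ι : Type} (k : ℕ) (v : ι → ℝ) : Prop := (Function.support v).encard ≤ k

/-- `w` is an `H_k(x)`: it agrees with `x` on some set of `k` largest (in absolute value)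
entries of `x`, and vanishes elsewhere. -/
def IsHead {ι : Type} (k : ℕ) (x w : ι → ℝ) : Prop :=
  ∃ S : Finset ι, S.card = k ∧ (∀ i ∈ S, ∀ j ∉ S, |x j| ≤ |x i|) ∧
    (∀ i ∈ S, w i = x i) ∧ ∀ i ∉ S, w i = 0

end SparseRecovery

open SparseRecovery

/-!
The recovery algorithm keeps a sparse estimate `w` of the (scaled, hence integral) signal `x`, and
improves it in steps that bring the error `‖x - w‖₁` down by a factor of `4`, up to a multiple of
the error `τ` of the best `k`-sparse approximation.

*Expansion.* An output distribution close to one of min-entropy `log₂ (D |S|)` needs a support of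
nearly `D |S|` points, so the bipartite graph of a condenser expands all sets `S` of at most `4 k`
positions: `|Γ(S)| ≥ (63 / 64) D |S|` (`IsLosslessCondenser.isExpander`). Each seed `t` distributes
the positions into buckets `b`. Applied to the level sets of a vector `e`, expansion says that the
sum over all seeds and buckets of the largest entry from `S` is nearly `D ∑ a ∈ S, |e a|`
(`IsExpander.sum_le_sum_bucketMax`). In particular, the sketch nearly preserves the `ℓ₁` norm of
sparse vectors (`IsExpander.nrm_le_sketchNrm`).

*One step.* By linearity, the sketch of the residual `e = x - w` can be computed from the input. The
bit measurements of a bucket reveal the position of an entry that outweighs all the others in the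
bucket, and the sum of the bucket approximates its value. Subtracting this value at this position
leaves of every bucket at most four times what lies outside of its largest entry, whether or not
the position is correct (`nrm_sub_decode_le`). Summed over the seeds and combined with expansion, for the union of the head of `x` and the support of `w`, this shows that the
average seed yields a correction of `e` with an error of at most `(‖e‖ + 63 τ) / 16`. A good seed is
not known, so for every seed the corrected estimate is truncated to `k` entries, which costs a
constant factor, and the candidate whose residual has the smallest sketch is kept. As the sketch
nearly preserves norms of sparse vectors, this candidate is nearly as good as the best one
(`IsExpander.contraction`). Truncation sorts by bit length only, which loses a factor of `2`
(`nrm_sub_restrict_le`).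

*Termination.* The number of steps is the bit length of the norm of the sketch of `x`, which is
polynomial in `n`. As all norms are integers, what is left of the initial error then disappears
(`IsExpander.error_le`).

*Running time.* Programs are analysed with the relation `Ev`, which bounds the number of steps.
Lists of entries, arrays (complete binary trees) and tries (binary trees with missing branches) make
every access to a position cost `O(n)`. A number `W` polynomial in `n` bounds `n`, `r`, the time of
the condenser, and the bit lengths of all numbers that occur. A step tries `D` candidates with
`O(2 ^ r)` entries each, because `k ≤ 2 * 2 ^ r` (`IsExpander.le_two_pow`), and updates `D` sketches
for every candidate, in time `O(D² 2 ^ r W²)` (`ev_step`). With at most `W` steps, the whole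
iteration takes time `O(D² 2 ^ r W³)` (`ev_recover`).
-/

namespace SparseRecovery

/-! ### Timed evaluation of programs -/

/-- Inside the function with body `b`, the expression `e` evaluates on the argument `d` to `v`
in at most `T` steps. -/
def Ev (b e : Code) (d v : SExp) (T : ℕ) : Prop := ∃ s ≤ T, Runs b e d v s

namespace Ev

variable {b e f g : Code} {d u v w x y : SExp} {s t T : ℕ}

theorem cast (h : Ev b e d u s) (hv : u = v) (hT : s ≤ T) : Ev b e d v T := by
  obtain ⟨s', hs, hr⟩ := h
  exact ⟨s', hs.trans hT, hv ▸ hr⟩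

theorem mono (h : Ev b e d v s) (hT : s ≤ T) : Ev b e d v T := h.cast rfl hT

theorem arg : Ev b .arg d d 1 := ⟨1, le_rfl, .arg b d⟩

theorem nil : Ev b .nil d .nil 1 := ⟨1, le_rfl, .nil b d⟩

theorem hd (h : Ev b e d v s) : Ev b (.hd e) d v.hd (s + 1) := by
  obtain ⟨s', hs, hr⟩ := h
  exact ⟨_, by omega, hr.hd⟩

theorem tl (h : Ev b e d v s) : Ev b (.tl e) d v.tl (s + 1) := by
  obtain ⟨s', hs, hr⟩ := h
  exact ⟨_, by omega, hr.tl⟩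

theorem cons (h : Ev b e d v s) (h' : Ev b f d w t) :
    Ev b (.cons e f) d (.cons v w) (s + t + 1) := by
  obtain ⟨s', hs, hr⟩ := h
  obtain ⟨t', ht, hr'⟩ := h'
  exact ⟨_, by omega, hr.cons hr'⟩

theorem iteNil (h : Ev b e d .nil s) (h' : Ev b f d v t) : Ev b (.ite e f g) d v (s + t + 1) := by
  obtain ⟨s', hs, hr⟩ := h
  obtain ⟨t', ht, hr'⟩ := h'
  exact ⟨_, by omega, hr.iteNil hr'⟩

theorem iteCons (h : Ev b e d (.cons x y) s) (h' : Ev b g d v t) :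
    Ev b (.ite e f g) d v (s + t + 1) := by
  obtain ⟨s', hs, hr⟩ := h
  obtain ⟨t', ht, hr'⟩ := h'
  exact ⟨_, by omega, hr.iteCons hr'⟩

theorem iteNe (h : Ev b e d u s) (hu : u ≠ .nil) (h' : Ev b g d v t) :
    Ev b (.ite e f g) d v (s + t + 1) := by
  cases u with
  | nil => exact absurd rfl hu
  | cons p q => exact h.iteCons h'

theorem ite (h : Ev b e d u s) (h₁ : u = .nil → Ev b f d v t) (h₂ : u ≠ .nil → Ev b g d v t) :
    Ev b (.ite e f g) d v (s + t + 1) := by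
  by_cases hu : u = .nil
  · exact iteNil (hu ▸ h) (h₁ hu)
  · exact iteNe h hu (h₂ hu)

theorem iteBit {c : Bool} (h : Ev b e d (encBit c) s) (hf : Ev b f d v t) (hg : Ev b g d w t) :
    Ev b (.ite e f g) d (if c then w else v) (s + t + 1) := by
  cases c
  · exact iteNil h hf
  · exact iteCons h hg

end Ev

/-- A call of the function with body `f`, with the value of `e` as its argument. -/
def call (f e : Code) : Code := .comp (.fn f) e

/-- A recursive call of the enclosing function, with the value of `e` as its argument. -/
def recur (e : Code) : Code := .comp .self e

theorem Ev.call {b f e : Code} {d u v : SExp} {s t : ℕ} (h : Ev b e d u s) (h' : Ev f f u v t) :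
    Ev b (call f e) d v (s + t + 2) := by
  obtain ⟨s', hs, hr⟩ := h
  obtain ⟨t', ht, hr'⟩ := h'
  exact ⟨_, by omega, hr.comp hr'.fn⟩

theorem Ev.recur {b e : Code} {d u v : SExp} {s t : ℕ} (h : Ev b e d u s) (h' : Ev b b u v t) :
    Ev b (recur e) d v (s + t + 2) := by
  obtain ⟨s', hs, hr⟩ := h
  obtain ⟨t', ht, hr'⟩ := h'
  exact ⟨_, by omega, hr.comp hr'.self⟩

namespace Code

/-- The value of an expression without tests and calls (with a junk value for the others). -/
def val : Code → SExp → SExp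
  | .arg, d => d
  | .hd e, d => (e.val d).hd
  | .tl e, d => (e.val d).tl
  | .cons e f, d => .cons (e.val d) (f.val d)
  | _, _ => .nil

/-- The number of steps of an expression without tests and calls. -/
def cost : Code → ℕ
  | .hd e => e.cost + 1
  | .tl e => e.cost + 1
  | .cons e f => e.cost + f.cost + 1
  | _ => 1

/-- The expression contains neither tests nor calls. -/
def simple : Code → Bool
  | .nil => true
  | .arg => true
  | .hd e => e.simple
  | .tl e => e.simple
  | .cons e f => e.simple && f.simple
  | _ => false

end Code

/-- Expressions without tests and calls are evaluated by `Code.val`, which reduces definitionally;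
this carries out all the shuffling of arguments in the programs below. -/
theorem Ev.simple {b e : Code} {d : SExp} (h : e.simple = true) : Ev b e d (e.val d) e.cost := by
  induction e with
  | nil => exact .nil
  | arg => exact .arg
  | hd e ih => exact (ih h).hd
  | tl e ih => exact (ih h).tl
  | cons e f ihe ihf =>
    rw [Code.simple, Bool.and_eq_true] at h
    exact (ihe h.1).cons (ihf h.2)
  | _ => simp [Code.simple] at h

/-- First component of the argument. -/
abbrev x1 : Code := .hd .arg
/-- Second component of the argument and beyond. -/
abbrev r1 : Code := .tl .arg
/-- Second component of an argument with at least three components. -/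
abbrev x2 : Code := .hd (.tl .arg)
/-- Third component of the argument and beyond. -/
abbrev r2 : Code := .tl (.tl .arg)

/-! ### Arithmetic on binary numbers -/

/-- The constant `true` as a bit. -/
def oneC : Code := .cons .nil .nil

theorem encNat_zero : encNat 0 = .nil := by simp [encNat, encList]

theorem encNat_bit (c : Bool) (m : ℕ) (h : m = 0 → c = true) :
    encNat (Nat.bit c m) = .cons (encBit c) (encNat m) := by
  simp [encNat, Nat.bits_append_bit m c h, encList]

theorem bit_decide_mod_two (m : ℕ) : Nat.bit (decide (m % 2 = 1)) (m / 2) = m := by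
  rw [Nat.bit_val]
  by_cases h : m % 2 = 1
  · simp only [h, decide_true, Bool.toNat_true]; omega
  · simp only [h, decide_false, Bool.toNat_false]; omega

theorem encNat_of_ne_zero {m : ℕ} (h : m ≠ 0) :
    encNat m = .cons (encBit (decide (m % 2 = 1))) (encNat (m / 2)) := by
  conv_lhs => rw [← bit_decide_mod_two m]
  rw [encNat_bit]
  intro h'
  have : m = 1 := by omega
  simp [this]

theorem hd_encNat (m : ℕ) : (encNat m).hd = encBit (decide (m % 2 = 1)) := by
  by_cases h : m = 0
  · subst h; simp [encNat_zero, SExp.hd, encBit]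
  · rw [encNat_of_ne_zero h]; rfl

theorem tl_encNat (m : ℕ) : (encNat m).tl = encNat (m / 2) := by
  by_cases h : m = 0
  · subst h; simp [encNat_zero, SExp.tl]
  · rw [encNat_of_ne_zero h]; rfl

theorem encNat_eq_nil {m : ℕ} : encNat m = .nil ↔ m = 0 := by
  constructor
  · intro h
    by_contra hm
    rw [encNat_of_ne_zero hm] at h
    cases h
  · rintro rfl; exact encNat_zero

theorem encBit_eq_nil {c : Bool} : encBit c = .nil ↔ c = false := by
  cases c <;> simp [encBit]

/-- Prepends a bit to a binary number, keeping it free of leading zeros. -/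
def bconsC : Code := .ite x1 (.ite r1 .nil .arg) .arg

theorem ev_bcons (c : Bool) (m : ℕ) :
    Ev bconsC bconsC (.cons (encBit c) (encNat m)) (encNat (Nat.bit c m)) 10 := by
  cases c
  · refine (Ev.iteNil (t := 6) (.simple rfl) (.mono (.ite (u := encNat m) (.simple rfl) (t := 1)
      (fun h => ?_) (fun h => ?_)) (by decide))).cast rfl (by decide)
    · rw [encNat_eq_nil] at h; subst h
      exact Ev.nil.cast (by simp [encNat_zero]) le_rfl
    · exact Ev.arg.cast (encNat_bit _ _ fun h0 => absurd (encNat_eq_nil.2 h0) h).symm le_rfl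
  · refine (Ev.iteCons (.simple rfl) .arg).cast ?_ (by decide)
    rw [encNat_bit _ _ fun _ => rfl]

/-- Exclusive or of three bits. -/
def xor3C (c x y : Code) : Code :=
  .ite c (.ite x y (.ite y oneC .nil)) (.ite x (.ite y oneC .nil) y)

/-- Majority of three bits. -/
def maj3C (c x y : Code) : Code := .ite c (.ite x .nil y) (.ite x y oneC)

section
variable {b c x y : Code} {d : SExp} {p q r : Bool} {s : ℕ}

theorem ev_notC (hx : Ev b x d (encBit p) s) :
    Ev b (.ite x oneC .nil) d (encBit !p) (s + 4) :=
  (Ev.iteBit (t := 3) hx (.simple rfl) (Ev.nil.mono (by omega))).cast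
    (by cases p <;> rfl) (by omega)

theorem ev_xor3 (hc : Ev b c d (encBit p) s) (hx : Ev b x d (encBit q) s)
    (hy : Ev b y d (encBit r) s) :
    Ev b (xor3C c x y) d (encBit (p ^^ q ^^ r)) (3 * s + 6) :=
  (Ev.iteBit (t := 2 * s + 5) hc
    (.mono (.iteBit (t := s + 4) hx (hy.mono (by omega)) (ev_notC hy)) (by omega))
    (.mono (.iteBit (t := s + 4) hx (ev_notC hy) (hy.mono (by omega))) (by omega))).cast
    (by cases p <;> cases q <;> cases r <;> rfl) (by omega)

theorem ev_maj3 (hc : Ev b c d (encBit p) s) (hx : Ev b x d (encBit q) s)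
    (hy : Ev b y d (encBit r) s) :
    Ev b (maj3C c x y) d (encBit (if p then q || r else q && r)) (3 * s + 6) :=
  (Ev.iteBit (t := 2 * s + 5) hc
    (.mono (.iteBit (t := s + 4) hx (Ev.nil.mono (by omega)) (hy.mono (by omega))) (by omega))
    (.mono (.iteBit (t := s + 4) hx (hy.mono (by omega))
      ((Ev.simple (e := oneC) rfl).mono (by simp only [oneC, Code.cost]; omega))) (by omega))).cast
    (by cases p <;> cases q <;> cases r <;> rfl) (by omega)

end

/-- Sum `a + b + c` of two numbers and a carry, on the argument `(c, a, b)`. -/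
def natAddC : Code :=
  let rest := call bconsC (.cons (xor3C x1 (.hd x2) (.hd r2))
    (recur (.cons (maj3C x1 (.hd x2) (.hd r2)) (.cons (.tl x2) (.tl r2)))))
  .ite x2 (.ite r2 (.ite x1 .nil (.cons oneC .nil)) rest) rest

theorem ev_natAdd (W : ℕ) : ∀ (c : Bool) (a b : ℕ), a < 2 ^ W → b < 2 ^ W →
    Ev natAddC natAddC (.cons (encBit c) (.cons (encNat a) (encNat b)))
      (encNat (a + b + c.toNat)) (80 * W + 20) := by
  induction W with
  | zero =>
    intro c a b ha hb
    obtain rfl : a = 0 := by omega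
    obtain rfl : b = 0 := by omega
    simp only [encNat_zero]
    refine (Ev.iteNil (.simple rfl) (.iteNil (.simple rfl) (.iteBit (c := c) (t := 5) (.simple rfl)
      (Ev.nil.mono (by decide)) (.simple rfl)))).cast ?_ (by decide)
    cases c
    · simp [encNat_zero]
    · simp [encNat, encList, encBit]; rfl
  | succ W ih =>
    intro c a b ha hb
    have ha' : a / 2 < 2 ^ W := by rw [pow_succ] at ha; omega
    have hb' : b / 2 < 2 ^ W := by rw [pow_succ] at hb; omega
    have e1 : Ev natAddC (.hd x2) (.cons (encBit c) (.cons (encNat a) (encNat b))) _ 4 :=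
      (Ev.simple rfl).cast (hd_encNat a) (by decide)
    have e2 : Ev natAddC (.hd r2) (.cons (encBit c) (.cons (encNat a) (encNat b))) _ 4 :=
      (Ev.simple rfl).cast (hd_encNat b) (by decide)
    have e3 : Ev natAddC x1 (.cons (encBit c) (.cons (encNat a) (encNat b))) (encBit c) 4 :=
      (Ev.simple rfl).cast rfl (by decide)
    have e4 : Ev natAddC (.tl x2) (.cons (encBit c) (.cons (encNat a) (encNat b))) _ 4 :=
      (Ev.simple rfl).cast (tl_encNat a) (by decide)
    have e5 : Ev natAddC (.tl r2) (.cons (encBit c) (.cons (encNat a) (encNat b))) _ 4 :=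
      (Ev.simple rfl).cast (tl_encNat b) (by decide)
    have key := Ev.call (.cons (ev_xor3 e3 e1 e2)
      (.recur (.cons (ev_maj3 e3 e1 e2) (.cons e4 e5)) (ih _ _ _ ha' hb'))) (ev_bcons _ _)
    have key' := key.cast (T := 80 * W + 90) (v := encNat (a + b + c.toNat)) (by
      congr 1
      rw [Nat.bit_val]
      rcases Nat.mod_two_eq_zero_or_one a with h1 | h1 <;>
      rcases Nat.mod_two_eq_zero_or_one b with h2 | h2 <;>
      cases c <;> simp [h1, h2] <;> omega) (by omega)
    refine (Ev.ite (u := encNat a) (.simple rfl) (fun h => Ev.ite (u := encNat b) (t := 80 * W + 90)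
      (.simple rfl) (fun h' => ?_)
      fun _ => key') (fun _ => key'.mono (by simp only [Code.cost]; omega))).mono
        (by simp only [Code.cost]; omega)
    rw [encNat_eq_nil] at h h'
    subst h h'
    refine (Ev.iteBit (c := c) (t := 5) (.simple rfl)
      (Ev.nil.mono (by decide)) (.simple rfl)).cast ?_ (by simp only [Code.cost]; omega)
    cases c
    · simp [encNat_zero]
    · simp [encNat, encList, encBit, Code.val]; rfl

/-- Comparison `a < b ∨ a = b ∧ c`, on the argument `(c, a, b)`. -/
def natLtC : Code :=
  let rest := recur (.cons (.ite (.hd x2) (.ite (.hd r2) x1 oneC) (.ite (.hd r2) .nil x1))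
    (.cons (.tl x2) (.tl r2)))
  .ite x2 (.ite r2 x1 rest) rest

theorem ev_natLt_aux (W : ℕ) : ∀ (c : Bool) (a b : ℕ), a < 2 ^ W → b < 2 ^ W →
    Ev natLtC natLtC (.cons (encBit c) (.cons (encNat a) (encNat b)))
      (encBit (decide (a < b + c.toNat))) (40 * W + 20) := by
  induction W with
  | zero =>
    intro c a b ha hb
    obtain rfl : a = 0 := by omega
    obtain rfl : b = 0 := by omega
    simp only [encNat_zero]
    refine (Ev.iteNil (.simple rfl) (.iteNil (.simple rfl) (.simple rfl))).cast ?_ (by decide)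
    cases c <;> rfl
  | succ W ih =>
    intro c a b ha hb
    have ha' : a / 2 < 2 ^ W := by rw [pow_succ] at ha; omega
    have hb' : b / 2 < 2 ^ W := by rw [pow_succ] at hb; omega
    have e1 : Ev natLtC (.hd x2) (.cons (encBit c) (.cons (encNat a) (encNat b))) _ 4 :=
      (Ev.simple rfl).cast (hd_encNat a) (by decide)
    have e2 : Ev natLtC (.hd r2) (.cons (encBit c) (.cons (encNat a) (encNat b))) _ 4 :=
      (Ev.simple rfl).cast (hd_encNat b) (by decide)
    have e4 : Ev natLtC (.tl x2) (.cons (encBit c) (.cons (encNat a) (encNat b))) _ 4 :=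
      (Ev.simple rfl).cast (tl_encNat a) (by decide)
    have e5 : Ev natLtC (.tl r2) (.cons (encBit c) (.cons (encNat a) (encNat b))) _ 4 :=
      (Ev.simple rfl).cast (tl_encNat b) (by decide)
    have e6 := Ev.iteBit (t := 8) e1
      (.mono (.iteBit (t := 3) (f := x1) (v := encBit c) e2 ((Ev.simple rfl).mono (by decide))
        (.simple (e := oneC) rfl)) (by decide))
      (.mono (.iteBit (t := 3) (g := x1) (w := encBit c) e2 (Ev.nil.mono (by decide))
        ((Ev.simple rfl).mono (by decide))) (by decide))
    have e7 := e6.cast (T := 13) (v := encBit (if a % 2 = 1 then (decide (b % 2 = 1) && c)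
      else (decide (b % 2 = 1) || c))) (by
        rcases Nat.mod_two_eq_zero_or_one a with h1 | h1 <;>
        rcases Nat.mod_two_eq_zero_or_one b with h2 | h2 <;>
        simp [h1, h2] <;> rfl) (by omega)
    have key := Ev.recur (.cons e7 (.cons e4 e5)) (ih _ _ _ ha' hb')
    have key' := key.cast (T := 40 * W + 50) (v := encBit (decide (a < b + c.toNat))) (by
      congr 1
      rcases Nat.mod_two_eq_zero_or_one a with h1 | h1 <;>
      rcases Nat.mod_two_eq_zero_or_one b with h2 | h2 <;>
      cases c <;> simp [h1, h2] <;> omega) (by omega)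
    refine (Ev.ite (u := encNat a) (.simple rfl) (fun h => Ev.ite (u := encNat b) (t := 40 * W + 50)
      (.simple rfl) (fun h' => ?_)
      fun _ => key') (fun _ => key'.mono (by simp only [Code.cost]; omega))).mono
        (by simp only [Code.cost]; omega)
    rw [encNat_eq_nil] at h h'
    subst h h'
    exact (Ev.simple rfl).cast (by cases c <;> rfl) (by simp only [Code.cost]; omega)

theorem ev_natLt {W a b : ℕ} (ha : a < 2 ^ W) (hb : b < 2 ^ W) :
    Ev natLtC natLtC (.cons .nil (.cons (encNat a) (encNat b))) (encBit (decide (a < b)))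
      (40 * W + 20) := ev_natLt_aux W false a b ha hb

/-- Difference `a - b - c` of two numbers and a borrow, on the argument `(c, a, b)`, if it is
nonnegative. -/
def natSubC : Code :=
  let rest := call bconsC (.cons (xor3C x1 (.hd x2) (.hd r2))
    (recur (.cons (maj3C x1 (.ite (.hd x2) oneC .nil) (.hd r2)) (.cons (.tl x2) (.tl r2)))))
  .ite x2 .nil rest

theorem ev_natSub_aux (W : ℕ) : ∀ (c : Bool) (a b : ℕ), a < 2 ^ W → b + c.toNat ≤ a →
    Ev natSubC natSubC (.cons (encBit c) (.cons (encNat a) (encNat b)))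
      (encNat (a - b - c.toNat)) (100 * W + 20) := by
  induction W with
  | zero =>
    intro c a b ha hb
    obtain rfl : a = 0 := by omega
    simp only [encNat_zero]
    exact (Ev.iteNil (.simple rfl) .nil).cast (by simp [encNat_zero]) (by decide)
  | succ W ih =>
    intro c a b ha hb
    by_cases h0 : a = 0
    · subst h0
      simp only [encNat_zero]
      exact (Ev.iteNil (.simple rfl) .nil).cast (by simp [encNat_zero])
        (by simp only [Code.cost]; omega)
    have ha' : a / 2 < 2 ^ W := by rw [pow_succ] at ha; omega
    have e1 : Ev natSubC (.hd x2) (.cons (encBit c) (.cons (encNat a) (encNat b))) _ 4 :=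
      (Ev.simple rfl).cast (hd_encNat a) (by decide)
    have e2 : Ev natSubC (.hd r2) (.cons (encBit c) (.cons (encNat a) (encNat b))) _ 4 :=
      (Ev.simple rfl).cast (hd_encNat b) (by decide)
    have e3 : Ev natSubC x1 (.cons (encBit c) (.cons (encNat a) (encNat b))) (encBit c) 4 :=
      (Ev.simple rfl).cast rfl (by decide)
    have e4 : Ev natSubC (.tl x2) (.cons (encBit c) (.cons (encNat a) (encNat b))) _ 4 :=
      (Ev.simple rfl).cast (tl_encNat a) (by decide)
    have e5 : Ev natSubC (.tl r2) (.cons (encBit c) (.cons (encNat a) (encNat b))) _ 4 :=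
      (Ev.simple rfl).cast (tl_encNat b) (by decide)
    have hle : b / 2 + (if c then !decide (a % 2 = 1) || decide (b % 2 = 1) else
        !decide (a % 2 = 1) && decide (b % 2 = 1)).toNat ≤ a / 2 := by
      rcases Nat.mod_two_eq_zero_or_one a with h1 | h1 <;>
      rcases Nat.mod_two_eq_zero_or_one b with h2 | h2 <;>
      cases c <;> simp [h1, h2] at hb ⊢ <;> omega
    have key := Ev.call (.cons (ev_xor3 e3 e1 e2)
      (.recur (.cons (ev_maj3 (e3.mono (by decide)) (ev_notC e1) (e2.mono (by decide)))
        (.cons e4 e5)) (ih _ _ _ ha' hle))) (ev_bcons _ _)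
    have key' := key.cast (T := 100 * W + 110) (v := encNat (a - b - c.toNat)) (by
      congr 1
      rw [Nat.bit_val]
      rcases Nat.mod_two_eq_zero_or_one a with h1 | h1 <;>
      rcases Nat.mod_two_eq_zero_or_one b with h2 | h2 <;>
      cases c <;> simp [h1, h2] at hb ⊢ <;> omega) (by omega)
    exact (Ev.iteNe (u := encNat a) (.simple rfl) (by rwa [Ne, encNat_eq_nil]) key').mono
      (by simp only [Code.cost]; omega)

theorem ev_natSub {W a b : ℕ} (ha : a < 2 ^ W) (hb : b ≤ a) :
    Ev natSubC natSubC (.cons .nil (.cons (encNat a) (encNat b))) (encNat (a - b))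
      (100 * W + 20) := ev_natSub_aux W false a b ha hb

/-! ### Arithmetic on integers -/

/-- Makes an integer of a sign and an absolute value, avoiding a negative zero. -/
def mkIntC : Code := .ite r1 (.cons .nil .nil) .arg

theorem ev_mkInt (c : Bool) (m : ℕ) :
    Ev mkIntC mkIntC (.cons (encBit c) (encNat m)) (encInt (if c then -m else m)) 10 := by
  refine (Ev.ite (u := encNat m) (t := 3) (.simple rfl) (fun h => ?_) fun h => ?_).mono (by decide)
  · rw [encNat_eq_nil] at h
    subst h
    exact (Ev.simple rfl).cast (by simp [encInt, encNat_zero, encBit]; rfl) (by decide)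
  · rw [Ne, encNat_eq_nil] at h
    refine Ev.arg.cast ?_ (by decide)
    cases c
    · have : ¬(m : ℤ) < 0 := by omega
      simp [encInt, this]
    · have : 0 < m := Nat.pos_of_ne_zero h
      simp [encInt, this]

/-- Negation of an integer. -/
def intNegC : Code := call mkIntC (.cons (.ite x1 oneC .nil) r1)

theorem ev_intNeg (z : ℤ) : Ev intNegC intNegC (encInt z) (encInt (-z)) 30 := by
  refine (Ev.call (.cons (ev_notC (p := decide (z < 0)) (.simple rfl)) (.simple rfl))
    (ev_mkInt _ z.natAbs)).cast ?_ (by decide)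
  congr 1
  by_cases h : z < 0 <;> simp [h] <;> omega

/-- Sum of two integers, on the argument `(x, y)`. -/
def intAddC : Code :=
  let mags := .cons .nil (.cons (.tl x1) (.tl r1))
  let sgam := .cons .nil (.cons (.tl r1) (.tl x1))
  let same := .cons (.hd x1) (call natAddC mags)
  let diff := .ite (call natLtC mags) (call mkIntC (.cons (.hd x1) (call natSubC mags)))
    (.cons (.hd r1) (call natSubC sgam))
  .ite (.hd x1) (.ite (.hd r1) same diff) (.ite (.hd r1) diff same)

theorem ev_intAdd {W : ℕ} {x y : ℤ} (hx : x.natAbs < 2 ^ W) (hy : y.natAbs < 2 ^ W) :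
    Ev intAddC intAddC (.cons (encInt x) (encInt y)) (encInt (x + y)) (200 * W + 130) := by
  have e1 : Ev intAddC (.hd x1) (.cons (encInt x) (encInt y)) (encBit (decide (x < 0))) 3 :=
    .simple rfl
  have e2 : Ev intAddC (.hd r1) (.cons (encInt x) (encInt y)) (encBit (decide (y < 0))) 3 :=
    .simple rfl
  have lt := Ev.call (b := intAddC) (d := .cons (encInt x) (encInt y)) (.simple rfl)
    (e := .cons .nil (.cons (.tl x1) (.tl r1))) (ev_natLt hx hy)
  have add := Ev.call (b := intAddC) (d := .cons (encInt x) (encInt y)) (.simple rfl)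
    (e := .cons .nil (.cons (.tl x1) (.tl r1))) (ev_natAdd W false _ _ hx hy)
  have same : decide (x < 0) = decide (y < 0) →
      Ev intAddC (.cons (.hd x1) (call natAddC (.cons .nil (.cons (.tl x1) (.tl r1)))))
        (.cons (encInt x) (encInt y)) (encInt (x + y)) (200 * W + 110) := by
    intro h
    refine (e1.cons add).cast ?_ (by simp only [Code.cost]; omega)
    rw [encInt]
    by_cases h1 : x < 0 <;> by_cases h2 : y < 0 <;> simp [h1, h2] at h ⊢ <;>
      exact ⟨by congr 1; simp; omega, by congr 1; omega⟩
  have diff : decide (x < 0) ≠ decide (y < 0) →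
      Ev intAddC (.ite (call natLtC (.cons .nil (.cons (.tl x1) (.tl r1))))
        (call mkIntC (.cons (.hd x1) (call natSubC (.cons .nil (.cons (.tl x1) (.tl r1))))))
        (.cons (.hd r1) (call natSubC (.cons .nil (.cons (.tl r1) (.tl x1))))))
        (.cons (encInt x) (encInt y)) (encInt (x + y)) (200 * W + 110) := by
    intro h
    by_cases hlt : x.natAbs < y.natAbs
    · have sub := Ev.call (b := intAddC) (d := .cons (encInt x) (encInt y)) (.simple rfl)
        (e := .cons .nil (.cons (.tl r1) (.tl x1))) (ev_natSub hy hlt.le)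
      refine (Ev.iteNe lt (by simp [encBit_eq_nil, hlt]) (e2.cons sub)).cast ?_
        (by simp only [Code.cost]; omega)
      rw [encInt]
      by_cases h1 : x < 0 <;> by_cases h2 : y < 0 <;> simp [h1, h2] at h ⊢ <;>
        exact ⟨by congr 1; simp; omega, by congr 1; omega⟩
    · have sub := Ev.call (b := intAddC) (d := .cons (encInt x) (encInt y)) (.simple rfl)
        (e := .cons .nil (.cons (.tl x1) (.tl r1))) (ev_natSub hx (not_lt.1 hlt))
      simp only [hlt, decide_false] at lt
      refine (Ev.iteNil lt (.call (e1.cons sub) (ev_mkInt _ _))).cast ?_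
        (by simp only [Code.cost]; omega)
      congr 1
      by_cases h1 : x < 0 <;> by_cases h2 : y < 0 <;> simp [h1, h2] at h ⊢ <;> omega
  by_cases h1 : x < 0 <;> by_cases h2 : y < 0
  · exact (Ev.iteNe e1 (by simp [encBit_eq_nil, h1]) (.iteNe e2 (by simp [encBit_eq_nil, h2])
      (same (by simp [h1, h2])))).mono (by omega)
  · simp only [h2, decide_false] at e2
    exact (Ev.iteNe e1 (by simp [encBit_eq_nil, h1]) (.iteNil e2
      (diff (by simp [h1, h2])))).mono (by omega)
  · simp only [h1, decide_false] at e1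
    exact (Ev.iteNil e1 (.iteNe e2 (by simp [encBit_eq_nil, h2])
      (diff (by simp [h1, h2])))).mono (by omega)
  · simp only [h1, h2, decide_false] at e1 e2
    exact (Ev.iteNil e1 (.iteNil e2 (same (by simp [h1, h2])))).mono (by omega)

/-! ### Programs on lists -/

/-- `foldl` of the function `g (env, acc, a)`, on the argument `(env, acc, list)`. -/
def foldC (g : Code) : Code :=
  .ite r2 x2 (recur (.cons x1 (.cons (call g (.cons x1 (.cons x2 (.hd r2)))) (.tl r2))))

/-- A fold maintains an invariant `P` between the processed part of the list and the
accumulator. -/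
theorem ev_fold {α : Type*} {g : Code} {env : SExp} {encA : α → SExp} {τ : ℕ}
    (P : List α → SExp → Prop) {l : List α} {s : SExp} (h0 : P [] s)
    (hstep : ∀ l₁ a l₂, l = l₁ ++ a :: l₂ → ∀ s, P l₁ s →
      ∃ s', Ev g g (.cons env (.cons s (encA a))) s' τ ∧ P (l₁ ++ [a]) s') :
    ∃ s', Ev (foldC g) (foldC g) (.cons env (.cons s (encList (l.map encA)))) s'
      (l.length * (τ + 30) + 10) ∧ P l s' := by
  suffices H : ∀ l₂ l₁ s, l = l₁ ++ l₂ → P l₁ s →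
      ∃ s', Ev (foldC g) (foldC g) (.cons env (.cons s (encList (l₂.map encA)))) s'
        (l₂.length * (τ + 30) + 10) ∧ P l s' from H l [] s rfl h0
  intro l₂
  induction l₂ with
  | nil =>
    intro l₁ s hl hP
    rw [List.append_nil] at hl
    exact ⟨s, (Ev.iteNil (.simple rfl) (.simple rfl)).mono (by simp only [Code.cost]; omega),
      hl ▸ hP⟩
  | cons a l₂ ih =>
    intro l₁ s hl hP
    obtain ⟨s₁, h₁, hP₁⟩ := hstep l₁ a l₂ hl s hP
    obtain ⟨s₂, h₂, hP₂⟩ := ih (l₁ ++ [a]) s₁ (by simp [hl]) hP₁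
    refine ⟨s₂, (Ev.iteCons (.simple rfl) (.recur (.cons (.simple rfl)
      (.cons (.call (.simple rfl) h₁) (.simple rfl))) h₂)).mono ?_, hP₂⟩
    simp only [Code.cost, List.length_cons]
    ring_nf
    omega

/-- `map` of the function `g (env, a)`, on the argument `(env, list)`. -/
def mapC (g : Code) : Code :=
  .ite r1 .nil (.cons (call g (.cons x1 (.hd r1))) (recur (.cons x1 (.tl r1))))

theorem ev_map {α : Type*} {g : Code} {env : SExp} {encA G : α → SExp} {τ : ℕ} {l : List α}
    (h : ∀ a ∈ l, Ev g g (.cons env (encA a)) (G a) τ) :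
    Ev (mapC g) (mapC g) (.cons env (encList (l.map encA))) (encList (l.map G))
      (l.length * (τ + 30) + 10) := by
  induction l with
  | nil => exact (Ev.iteNil (.simple rfl) .nil).mono (by simp only [Code.cost]; omega)
  | cons a l ih =>
    refine (Ev.iteCons (.simple rfl) (.cons (.call (.simple rfl) (h a (by simp)))
      (.recur (.simple rfl) (ih fun b hb => h b (by simp [hb]))))).mono ?_
    simp only [Code.cost, List.length_cons]
    ring_nf
    omega

/-- The first entries of a list, as many as a unary number tells, on the argument
`(number, list)`. -/
def takeC : Code :=
  .ite x1 .nil (.ite r1 .nil (.cons (.hd r1) (recur (.cons (.tl x1) (.tl r1)))))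

theorem ev_take (k : ℕ) : ∀ l : List SExp, Ev takeC takeC (.cons (encUnary k) (encList l))
    (encList (l.take k)) (l.length * 30 + 20) := by
  induction k with
  | zero =>
    intro l
    exact (Ev.iteNil (.simple rfl) .nil).mono (by simp only [Code.cost]; omega)
  | succ k ih =>
    intro l
    cases l with
    | nil =>
      exact (Ev.iteCons (.simple rfl) (.iteNil (.simple rfl) .nil)).mono
        (by simp only [Code.cost]; omega)
    | cons a l =>
      refine (Ev.iteCons (.simple rfl) (.iteCons (.simple rfl) (.cons (.simple rfl)
        (.recur (.simple rfl) (ih l))))).mono ?_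
      simp only [Code.cost, List.length_cons]
      omega

/-- Doubles a unary number. -/
def doubleC : Code := .ite .arg .nil (.cons .nil (.cons .nil (recur r1)))

theorem ev_double (m : ℕ) :
    Ev doubleC doubleC (encUnary m) (encUnary (2 * m)) (m * 20 + 10) := by
  induction m with
  | zero => exact (Ev.iteNil .arg .nil).mono (by omega)
  | succ m ih =>
    refine (Ev.iteCons .arg (.cons .nil (.cons .nil (.recur (.simple rfl) ih)))).cast ?_
      (by simp only [Code.cost]; omega)
    rw [mul_add]; rfl

/-- Converts a number from binary to unary. -/
def unaryC : Code :=
  .ite .arg .nil (.ite x1 (call doubleC (recur r1)) (.cons .nil (call doubleC (recur r1))))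

theorem ev_unary (m : ℕ) : Ev unaryC unaryC (encNat m) (encUnary m) (m * 60 + 10) := by
  induction m using Nat.strong_induction_on with
  | _ m ih =>
    by_cases h : m = 0
    · subst h
      rw [encNat_zero]
      exact (Ev.iteNil .arg .nil).mono (by omega)
    · have hr := Ev.call (Ev.recur (b := unaryC) (e := r1) (d := encNat m)
        ((Ev.simple rfl).cast (tl_encNat m) le_rfl) (ih (m / 2) (by omega))) (ev_double _)
      refine (Ev.iteNe .arg (by rwa [Ne, encNat_eq_nil])
        (.iteBit (t := m * 60 + 2) ((Ev.simple (e := x1) (d := encNat m) rfl).cast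
          (hd_encNat m) le_rfl)
          (hr.mono ?_) ((Ev.nil.cons hr).mono ?_))).cast ?_ ?_
      any_goals (simp only [Code.cost]; omega)
      rcases Nat.mod_two_eq_zero_or_one m with h1 | h1
      · simp only [h1]
        exact congrArg encUnary (by omega)
      · simp only [h1]
        exact congrArg encUnary (show 2 * (m / 2) + 1 = m by omega)

/-! ### Bucket sort by bit length -/

/-- One pass of the sort, on the argument `(list, rest, done)`: entries whose key is exhausted go
to `done`, and the others, with one bit of the key removed, to `rest`. -/
def passC : Code :=
  .ite x1 r1 (.ite (.hd (.hd x1))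
    (recur (.cons (.tl x1) (.cons x2 (.cons (.tl (.hd x1)) r2))))
    (recur (.cons (.tl x1) (.cons (.cons (.cons (.tl (.hd (.hd x1))) (.tl (.hd x1))) x2) r2))))

/-- Sorts a list of pairs `(key, entry)` by decreasing bit length of the keys and prepends the
entries to `done`, on the argument `(list, done)`. -/
def sortC : Code := .ite x1 r1 (recur (call passC (.cons x1 (.cons .nil r1))))

section
variable {β : Type*} (encB : β → SExp)

/-- A pair of a key and an entry, after the removal of `j` bits from the key. -/
def encItem (j : ℕ) (q : ℕ × β) : SExp := .cons (encNat (q.1 / 2 ^ j)) (encB q.2)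

theorem ev_pass (j : ℕ) : ∀ l s f : List (ℕ × β), Ev passC passC
    (.cons (encList (l.map (encItem encB j))) (.cons (encList (s.map (encItem encB (j + 1))))
      (encList (f.map fun q : ℕ × β => encB q.2))))
    (.cons (encList (((l.filter fun q => q.1 / 2 ^ j ≠ 0).reverse ++ s).map
        (encItem encB (j + 1))))
      (encList (((l.filter fun q => q.1 / 2 ^ j = 0).reverse ++ f).map fun q : ℕ × β => encB q.2)))
    (l.length * 50 + 10) := by
  intro l
  induction l with
  | nil =>
    intro s f
    exact (Ev.iteNil (.simple rfl) (.simple rfl)).mono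
      (by simp only [Code.cost]; omega)
  | cons q l ih =>
    intro s f
    refine (Ev.iteCons (.simple rfl) (.ite (u := encNat (q.1 / 2 ^ j)) (.simple rfl)
      (t := l.length * 50 + 38) (fun h => ?_) (fun h => ?_))).mono
        (by simp only [Code.cost, List.length_cons]; omega)
    · rw [encNat_eq_nil] at h
      refine (Ev.recur (.simple rfl) (ih s (q :: f))).cast ?_ (by simp only [Code.cost]; omega)
      rw [List.filter_cons_of_neg (by simpa using h), List.filter_cons_of_pos (by simpa using h)]
      simp
    · rw [Ne, encNat_eq_nil] at h
      have : Ev passC (.cons (.tl x1) (.cons (.cons (.cons (.tl (.hd (.hd x1))) (.tl (.hd x1))) x2)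
          r2)) (.cons (encList ((q :: l).map (encItem encB j))) (.cons (encList (s.map
          (encItem encB (j + 1)))) (encList (f.map fun q : ℕ × β => encB q.2))))
          (.cons (encList (l.map (encItem encB j))) (.cons (encList ((q :: s).map
          (encItem encB (j + 1)))) (encList (f.map fun q : ℕ × β => encB q.2)))) 25 := by
        refine (Ev.simple rfl).cast ?_ (by decide)
        have e : encItem encB (j + 1) q = .cons (encNat (q.1 / 2 ^ j)).tl (encB q.2) := by
          rw [encItem, tl_encNat, Nat.div_div_eq_div_mul, ← pow_succ]
        rw [List.map_cons, List.map_cons, e]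
        rfl
      refine (Ev.recur this (ih (q :: s) f)).cast ?_ (by omega)
      rw [List.filter_cons_of_pos (by simpa using h), List.filter_cons_of_neg (by simpa using h)]
      simp

/-- The output of the sort is sorted by decreasing bit length: every power of `2` below a later
key is below the earlier ones. In the list `l`, the first `j` bits have been removed from the keys
by earlier passes, which left only keys with at least `j` bits, and `W` further passes suffice. -/
theorem ev_sort (W : ℕ) : ∀ (j : ℕ) (l f : List (ℕ × β)),
    (∀ q ∈ l, 2 * q.1 + 1 < 2 ^ (j + W)) → (∀ q ∈ l, ∀ i < j, 2 ^ i ≤ q.1) →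
    ∃ out : List (ℕ × β), Ev sortC sortC
      (.cons (encList (l.map (encItem encB j))) (encList (f.map fun q : ℕ × β => encB q.2)))
      (encList ((out ++ f).map fun q : ℕ × β => encB q.2)) (W * (l.length * 50 + 50) + 10) ∧
      out.Perm l ∧ out.Pairwise fun a b => ∀ i, 2 ^ i ≤ b.1 → 2 ^ i ≤ a.1 := by
  have base : ∀ (W j : ℕ) (f : List (ℕ × β)), Ev sortC sortC
      (.cons (encList (([] : List (ℕ × β)).map (encItem encB j)))
        (encList (f.map fun q : ℕ × β => encB q.2)))
      (encList (([] ++ f).map fun q : ℕ × β => encB q.2))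
      (W * (([] : List (ℕ × β)).length * 50 + 50) + 10) := fun W j f =>
    (Ev.iteNil (.simple rfl) (.simple rfl)).mono (by simp only [Code.cost]; omega)
  induction W with
  | zero =>
    intro j l f h1 h2
    obtain rfl : l = [] := by
      rw [List.eq_nil_iff_forall_not_mem]
      intro q hq
      have := h1 q hq
      rcases j with _ | j
      · simp at this
      · have := h2 q hq j (by omega)
        rw [add_zero, pow_succ] at *
        omega
    exact ⟨[], base 0 j f, .refl _, .nil⟩
  | succ W ih =>
    intro j l f h1 h2
    rcases eq_or_ne l [] with rfl | hl
    · exact ⟨[], base _ j f, .refl _, .nil⟩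
    have hdiv : ∀ q : ℕ × β, q.1 / 2 ^ j ≠ 0 ↔ 2 ^ j ≤ q.1 := fun q => by
      rw [Ne, Nat.div_eq_zero_iff]
      have := Nat.two_pow_pos j
      omega
    obtain ⟨out, ho, hperm, hsort⟩ := ih (j + 1)
      ((l.filter fun q => q.1 / 2 ^ j ≠ 0).reverse ++ [])
      ((l.filter fun q => q.1 / 2 ^ j = 0).reverse ++ f)
      (by
        intro q hq
        simp only [List.append_nil, List.mem_reverse, List.mem_filter] at hq
        have := h1 q hq.1
        rwa [show j + 1 + W = j + (W + 1) by omega])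
      (by
        intro q hq i hi
        simp only [List.append_nil, List.mem_reverse, List.mem_filter, decide_eq_true_eq] at hq
        exact (Nat.pow_le_pow_right (by norm_num) (by omega)).trans ((hdiv q).1 hq.2))
    refine ⟨out ++ (l.filter fun q : ℕ × β => q.1 / 2 ^ j = 0).reverse, ?_, ?_, ?_⟩
    · have hlen : ((l.filter fun q : ℕ × β => q.1 / 2 ^ j ≠ 0).reverse ++ []).length ≤
          l.length := by
        simpa using List.length_filter_le _ l
      have hne : encList (l.map (encItem encB j)) ≠ .nil := by
        cases l with
        | nil => exact absurd rfl hl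
        | cons => simp [encList]
      rw [List.append_assoc]
      refine (Ev.iteNe (u := encList (l.map (encItem encB j))) (.simple rfl) hne (.recur
        (.call (.simple rfl) (ev_pass encB j l [] f)) ho)).mono ?_
      have := Nat.mul_le_mul_left W (Nat.add_le_add_right (Nat.mul_le_mul_right 50 hlen) 50)
      simp only [Code.cost]
      rw [add_mul]
      omega
    · rw [List.append_nil] at hperm
      refine ((hperm.trans (List.reverse_perm _)).append (List.reverse_perm _)).trans ?_
      convert List.filter_append_perm (fun q : ℕ × β => decide (q.1 / 2 ^ j ≠ 0)) l using 4 with q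
      simp [← decide_not]
    · have hmem : ∀ q ∈ (l.filter fun q : ℕ × β => q.1 / 2 ^ j = 0).reverse,
          q ∈ l ∧ q.1 < 2 ^ j := by
        intro q hq
        simp only [List.mem_reverse, List.mem_filter, decide_eq_true_eq] at hq
        exact ⟨hq.1, by have := hdiv q; omega⟩
      have hlt : ∀ {i m : ℕ}, m < 2 ^ j → 2 ^ i ≤ m → i < j := fun h h' =>
        (Nat.pow_lt_pow_iff_right (by norm_num)).1 (h'.trans_lt h)
      refine List.pairwise_append.2 ⟨hsort, ?_, ?_⟩
      · refine List.pairwise_of_forall_mem_list ?_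
        intro a ha b hb i hi
        exact h2 a (hmem a ha).1 i (hlt (hmem b hb).2 hi)
      · intro a ha b hb i hi
        have ha' := hperm.mem_iff.1 ha
        simp only [List.append_nil, List.mem_reverse, List.mem_filter] at ha'
        exact h2 a ha'.1 i (hlt (hmem b hb).2 hi)

end

/-! ### Arrays and tries -/

/-- All positions, in lexicographic order. -/
def allF2 : (n : ℕ) → List (F2 n)
  | 0 => [![]]
  | n + 1 => (allF2 n).map (Matrix.vecCons 0) ++ (allF2 n).map (Matrix.vecCons 1)

theorem zmod_two_cases : ∀ c : ZMod 2, c = 0 ∨ c = 1 := by decide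

theorem F2.exists_cons {n : ℕ} (b : F2 (n + 1)) :
    ∃ b' : F2 n, b = Matrix.vecCons 0 b' ∨ b = Matrix.vecCons 1 b' := by
  refine ⟨Matrix.vecTail b, ?_⟩
  rcases zmod_two_cases (Matrix.vecHead b) with h | h
  · left; rw [← h, Matrix.cons_head_tail]
  · right; rw [← h, Matrix.cons_head_tail]

theorem vecCons_zero_ne_one {n : ℕ} (b b' : F2 n) :
    (Matrix.vecCons 0 b : F2 (n + 1)) ≠ Matrix.vecCons 1 b' := fun h => by
  have := congrFun h 0
  simp at this

theorem vecCons_inj {n : ℕ} (c : ZMod 2) :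
    Function.Injective (Matrix.vecCons c : F2 n → F2 (n + 1)) := fun b b' h => by
  have := congrArg Matrix.vecTail h
  simpa using this

theorem mem_allF2 {n : ℕ} (b : F2 n) : b ∈ allF2 n := by
  induction n with
  | zero => simp [allF2, Subsingleton.elim b ![]]
  | succ n ih =>
    obtain ⟨b', rfl | rfl⟩ := F2.exists_cons b <;> simp [allF2, ih]

theorem nodup_allF2 (n : ℕ) : (allF2 n).Nodup := by
  induction n with
  | zero => simp [allF2]
  | succ n ih =>
    refine List.Nodup.append (ih.map (vecCons_inj 0)) (ih.map (vecCons_inj 1)) ?_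
    intro b h h'
    simp only [List.mem_map] at h h'
    obtain ⟨b₀, -, rfl⟩ := h
    obtain ⟨b₁, -, h⟩ := h'
    exact vecCons_zero_ne_one _ _ h.symm

theorem length_allF2 (n : ℕ) : (allF2 n).length = 2 ^ n := by
  induction n with
  | zero => rfl
  | succ n ih => simp [allF2, ih, pow_succ, mul_two]

theorem toFinset_allF2 (n : ℕ) : (allF2 n).toFinset = Finset.univ := by
  ext b; simp [mem_allF2]

theorem sum_allF2 {M : Type*} [AddCommMonoid M] (n : ℕ) (f : F2 n → M) :
    ((allF2 n).map f).sum = ∑ b, f b := by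
  rw [← List.sum_toFinset f (nodup_allF2 n), toFinset_allF2]

open Classical in
/-- A partial function on `𝔽₂ⁿ` as a binary tree, in which the path `b` leads to the entry `f b`.
The value `nil` of `f` stands for a missing entry, and subtrees without entries are `nil`. -/
noncomputable def encTrie : (n : ℕ) → (F2 n → SExp) → SExp
  | 0, f => f ![]
  | n + 1, f => if ∀ b, f b = .nil then .nil else
      .cons (encTrie n fun b => f (Matrix.vecCons 0 b)) (encTrie n fun b => f (Matrix.vecCons 1 b))

theorem encTrie_nil (n : ℕ) : encTrie n (fun _ => .nil) = .nil := by
  cases n <;> simp [encTrie]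

theorem hd_encTrie {n : ℕ} (f : F2 (n + 1) → SExp) :
    (encTrie (n + 1) f).hd = encTrie n fun b => f (Matrix.vecCons 0 b) := by
  by_cases h : ∀ b, f b = .nil
  · simp [encTrie, h, SExp.hd, encTrie_nil]
  · simp [encTrie, h, SExp.hd]

theorem tl_encTrie {n : ℕ} (f : F2 (n + 1) → SExp) :
    (encTrie (n + 1) f).tl = encTrie n fun b => f (Matrix.vecCons 1 b) := by
  by_cases h : ∀ b, f b = .nil
  · simp [encTrie, h, SExp.tl, encTrie_nil]
  · simp [encTrie, h, SExp.tl]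

/-- Arrays are tries without missing entries, so programs for tries also work on arrays. -/
theorem encArray_eq_encTrie {r : ℕ} {f : F2 r → SExp} (h : ∀ b, f b ≠ .nil) :
    encArray r f = encTrie r f := by
  induction r with
  | zero => rfl
  | succ r ih =>
    have : ¬∀ b, f b = .nil := fun h' => h _ (h' 0)
    rw [encArray, encTrie, if_neg this, ih fun b => h _, ih fun b => h _]

theorem encF2_cons {n : ℕ} (c : ZMod 2) (b : F2 n) :
    encF2 (Matrix.vecCons c b : F2 (n + 1)) = .cons (encBit (decide (c = 1))) (encF2 b) := by
  simp [encF2, List.ofFn_succ, encList]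
  rfl

theorem encF2_zero (b : F2 0) : encF2 b = .nil := by simp [encF2, encList]

/-- Replaces the entry `a` of an array or trie at a position `b` by `g (v, a)`, on the argument
`(b, v, tree)`. -/
def updC (g : Code) : Code :=
  .ite x1 (call g r1) (.ite (.hd x1)
    (.cons (recur (.cons (.tl x1) (.cons x2 (.hd r2)))) (.tl r2))
    (.cons (.hd r2) (recur (.cons (.tl x1) (.cons x2 (.tl r2))))))

/-- As the new entry is not `nil`, all subtrees on the path to it are nonempty in the new trie. -/
theorem ev_upd {g : Code} {v w : SExp} {τ n : ℕ} {f : F2 n → SExp} {b : F2 n} (hw : w ≠ .nil)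
    (hg : Ev g g (.cons v (f b)) w τ) :
    Ev (updC g) (updC g) (.cons (encF2 b) (.cons v (encTrie n f)))
      (encTrie n (Function.update f b w)) (n * 40 + τ + 10) := by
  induction n with
  | zero =>
    obtain rfl : b = ![] := Subsingleton.elim _ _
    rw [encF2_zero]
    refine (Ev.iteNil (.simple rfl) (.call (.simple rfl) hg)).cast ?_
      (by simp only [Code.cost]; omega)
    simp [encTrie]
  | succ n ih =>
    have hne : ¬∀ b', Function.update f b w b' = .nil := fun h => hw (by simpa using h b)
    conv => enter [4]; rw [encTrie, if_neg hne]
    have e1 (p c) : Ev (updC g) (.hd r2) (.cons p (.cons c (encTrie (n + 1) f))) _ 4 :=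
      (Ev.simple rfl).cast (hd_encTrie f) (by decide)
    have e2 (p c) : Ev (updC g) (.tl r2) (.cons p (.cons c (encTrie (n + 1) f))) _ 4 :=
      (Ev.simple rfl).cast (tl_encTrie f) (by decide)
    obtain ⟨b', rfl | rfl⟩ := F2.exists_cons b
    · have h0 : (fun a => Function.update f (Matrix.vecCons 0 b') w (Matrix.vecCons 0 a)) =
          Function.update (fun a => f (Matrix.vecCons 0 a)) b' w :=
        Function.update_comp_eq_of_injective f (vecCons_inj 0) b' w
      have h1 : (fun a => Function.update f (Matrix.vecCons 0 b') w (Matrix.vecCons 1 a)) =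
          fun a => f (Matrix.vecCons 1 a) :=
        funext fun a => Function.update_of_ne (vecCons_zero_ne_one _ _).symm _ _
      rw [h0, h1, encF2_cons]
      refine Ev.mono (.iteCons (.simple rfl) (.iteNil (.simple rfl)
        (.cons (.recur (.cons (.simple rfl) (.cons (.simple rfl) (e1 _ _)))
          (ih hg))
          (e2 _ _)))) (by simp only [Code.cost]; omega)
    · have h0 : (fun a => Function.update f (Matrix.vecCons 1 b') w (Matrix.vecCons 1 a)) =
          Function.update (fun a => f (Matrix.vecCons 1 a)) b' w :=
        Function.update_comp_eq_of_injective f (vecCons_inj 1) b' w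
      have h1 : (fun a => Function.update f (Matrix.vecCons 1 b') w (Matrix.vecCons 0 a)) =
          fun a => f (Matrix.vecCons 0 a) :=
        funext fun a => Function.update_of_ne (vecCons_zero_ne_one _ _) _ _
      rw [h0, h1, encF2_cons]
      refine Ev.mono (.iteCons (.simple rfl) (.iteCons (.simple rfl)
        (.cons (e1 _ _) (.recur (.cons (.simple rfl) (.cons (.simple rfl) (e2 _ _)))
          (ih hg))))) (by simp only [Code.cost]; omega)

open Classical in
/-- The entries of a partial function on `𝔽₂ⁿ`, in lexicographic order of their positions. -/
noncomputable def leaves (n : ℕ) (f : F2 n → SExp) : List SExp :=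
  ((allF2 n).map f).filter (· ≠ .nil)

theorem leaves_zero (f : F2 0 → SExp) (h : f ![] ≠ .nil) : leaves 0 f = [f ![]] := by
  simp [leaves, allF2, h]

theorem leaves_succ {n : ℕ} (f : F2 (n + 1) → SExp) : leaves (n + 1) f =
    leaves n (fun b => f (Matrix.vecCons 0 b)) ++ leaves n (fun b => f (Matrix.vecCons 1 b)) := by
  simp [leaves, allF2, Function.comp_def]

theorem leaves_eq_nil {n : ℕ} {f : F2 n → SExp} : leaves n f = [] ↔ ∀ b, f b = .nil := by
  simp [leaves, List.filter_eq_nil_iff, mem_allF2]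

/-- The entries of an array or trie of a given depth, prepended to a list, on the argument
`(depth, tree, list)`. -/
def flattenC : Code :=
  .ite x2 r2 (.ite x1 (.cons x2 r2) (recur (.cons (.tl x1) (.cons (.hd x2)
    (recur (.cons (.tl x1) (.cons (.tl x2) r2)))))))

theorem ev_flatten {n : ℕ} (f : F2 n → SExp) (acc : List SExp) : Ev flattenC flattenC
    (.cons (encUnary n) (.cons (encTrie n f) (encList acc))) (encList (leaves n f ++ acc))
    (60 * (2 * n * (leaves n f).length + (leaves n f).length + 1)) := by
  induction n generalizing acc with
  | zero =>
    by_cases h : f ![] = .nil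
    · have h' : leaves 0 f = [] := leaves_eq_nil.2 fun b => Subsingleton.elim b ![] ▸ h
      rw [encTrie, h, h']
      exact (Ev.iteNil (.simple rfl) (.simple rfl)).mono (by simp only [Code.cost]; omega)
    · rw [leaves_zero f h, encTrie]
      exact (Ev.iteNe (u := f ![]) (.simple rfl) h (.iteNil (.simple rfl) (.simple rfl))).mono
        (by simp only [Code.cost]; omega)
  | succ n ih =>
    by_cases h : ∀ b, f b = .nil
    · rw [encTrie, if_pos h, leaves_eq_nil.2 h]
      exact (Ev.iteNil (.simple rfl) (.simple rfl)).mono (by simp only [Code.cost]; omega)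
    · have hpos : 0 < (leaves (n + 1) f).length :=
        List.length_pos_iff.2 fun h' => h (leaves_eq_nil.1 h')
      rw [encTrie, if_neg h]
      have i1 := ih (fun b => f (Matrix.vecCons 1 b)) acc
      have i0 := ih (fun b => f (Matrix.vecCons 0 b))
        (leaves n (fun b => f (Matrix.vecCons 1 b)) ++ acc)
      refine (Ev.iteCons (.simple rfl) (.iteCons (.simple rfl) (.recur (.cons (.simple rfl)
        (.cons (.simple rfl) (.recur (.simple rfl) i1))) i0))).cast ?_ ?_
      · rw [leaves_succ, List.append_assoc]
      · rw [leaves_succ, List.length_append] at hpos ⊢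
        simp only [Code.cost]
        ring_nf at hpos ⊢
        omega

/-- Combines the corresponding entries of two arrays to pairs, on the argument
`(depth, array, array)`. -/
def zipC : Code :=
  .ite x1 r1 (.cons (recur (.cons (.tl x1) (.cons (.hd x2) (.hd r2))))
    (recur (.cons (.tl x1) (.cons (.tl x2) (.tl r2)))))

theorem ev_zip {r : ℕ} (f g : F2 r → SExp) : Ev zipC zipC
    (.cons (encUnary r) (.cons (encArray r f) (encArray r g)))
    (encArray r fun b => .cons (f b) (g b)) (2 ^ r * 80 - 60) := by
  induction r with
  | zero => exact (Ev.iteNil (.simple rfl) (.simple rfl)).mono (by decide)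
  | succ r ih =>
    refine (Ev.iteCons (.simple rfl) (.cons (.recur (.simple rfl) (ih _ _))
      (.recur (.simple rfl) (ih _ _)))).mono ?_
    have := Nat.one_le_two_pow (n := r)
    simp only [Code.cost]
    omega

/-- Combines the corresponding arrays of two lists of arrays, on the argument
`(depth, list, list)`. -/
def zipListC : Code :=
  .ite x2 .nil (.cons (call zipC (.cons x1 (.cons (.hd x2) (.hd r2))))
    (recur (.cons x1 (.cons (.tl x2) (.tl r2)))))

theorem ev_zipList {ι : Type*} {r : ℕ} (f g : ι → F2 r → SExp) (l : List ι) :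
    Ev zipListC zipListC (.cons (encUnary r) (.cons (encList (l.map fun t => encArray r (f t)))
      (encList (l.map fun t => encArray r (g t)))))
      (encList (l.map fun t => encArray r fun b => .cons (f t b) (g t b)))
      (l.length * (2 ^ r * 80) + 10) := by
  induction l with
  | nil => exact (Ev.iteNil (.simple rfl) .nil).mono (by simp only [Code.cost]; omega)
  | cons t l ih =>
    refine (Ev.iteCons (.simple rfl) (.cons (.call (.simple rfl) (ev_zip (f t) (g t)))
      (.recur (.simple rfl) ih))).mono ?_
    have := Nat.one_le_two_pow (n := r)
    simp only [Code.cost, List.length_cons, Nat.add_mul]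
    omega

theorem size_encList_le {l : List SExp} {B : ℕ} (h : ∀ a ∈ l, a.size ≤ B) :
    (encList l).size ≤ l.length * (B + 1) + 1 := by
  induction l with
  | nil => simp [encList, SExp.size]
  | cons a l ih =>
    have h1 := h a (by simp)
    have h2 := ih fun b hb => h b (by simp [hb])
    simp only [encList, SExp.size, List.length_cons, Nat.add_mul]
    omega

theorem size_encArray_le {r B : ℕ} {f : F2 r → SExp} (h : ∀ b, (f b).size ≤ B) :
    (encArray r f).size + 1 ≤ 2 ^ r * (B + 1) := by
  induction r with
  | zero => simpa [encArray] using h _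
  | succ r ih =>
    have h0 := ih fun b => h (Matrix.vecCons 0 b)
    have h1 := ih fun b => h (Matrix.vecCons 1 b)
    simp only [encArray, SExp.size, pow_succ]
    linarith

theorem size_encBit_le (c : Bool) : (encBit c).size ≤ 3 := by cases c <;> simp [encBit, SExp.size]

theorem size_encNat_le {m W : ℕ} (h : m < 2 ^ W) : (encNat m).size ≤ W * 4 + 1 := by
  have h1 : (encNat m).size ≤ (m.bits.map encBit).length * (3 + 1) + 1 :=
    size_encList_le fun a ha => by
      obtain ⟨c, -, rfl⟩ := List.mem_map.1 ha
      exact size_encBit_le c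
  rw [List.length_map, Nat.size_eq_bits_len] at h1
  have := Nat.size_le.2 h
  omega

theorem size_encInt_le {z : ℤ} {W : ℕ} (h : z.natAbs < 2 ^ W) : (encInt z).size ≤ W * 4 + 5 := by
  have := size_encNat_le h
  have := size_encBit_le (decide (z < 0))
  simp only [encInt, SExp.size]
  omega

theorem size_encUnary (m : ℕ) : (encUnary m).size = 2 * m + 1 := by
  induction m with
  | zero => rfl
  | succ m ih =>
    have : encUnary (m + 1) = .cons .nil (encUnary m) := rfl
    rw [this, SExp.size, ih, SExp.size]
    ring

theorem size_encF2_le {n : ℕ} (a : F2 n) : (encF2 a).size ≤ n * 4 + 1 := by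
  refine (size_encList_le (B := 3) fun b hb => ?_).trans (by simp)
  obtain ⟨j, rfl⟩ := (List.mem_ofFn' _ _).1 hb
  exact size_encBit_le _

/-! ### Condensers are expanders -/

section Expander

variable {n D r : ℕ}

/-- The neighbors of a set of left vertices in the bipartite graph of `h`. -/
def nbrs (h : F2 n → Fin D → F2 r) (S : Finset (F2 n)) : Finset (Fin D × F2 r) :=
  Finset.univ.filter fun q => ∃ a ∈ S, h a q.1 = q.2

/-- Every set of size at most `K` has nearly the largest possible number of neighbors: the
proportion is `1 - ε` for `ε = 1 / 64`. -/
def IsExpander (h : F2 n → Fin D → F2 r) (K : ℕ) : Prop :=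
  ∀ S : Finset (F2 n), S.card ≤ K → 63 * (D * S.card) ≤ 64 * (nbrs h S).card

theorem sum_toReal_pmf {Ω : Type} [Fintype Ω] (P : PMF Ω) : ∑ s, (P s).toReal = 1 := by
  rw [← ENNReal.toReal_sum fun s _ => P.apply_ne_top s, ← tsum_fintype (L := .unconditional Ω),
    P.tsum_coe, ENNReal.toReal_one]

/-- The statistical distance bounds the difference of the probabilities of an event. -/
theorem sum_sub_sum_le_statDist {Ω : Type} [Fintype Ω] [DecidableEq Ω] (P Q : PMF Ω)
    (A : Finset Ω) : ∑ s ∈ A, (P s).toReal - ∑ s ∈ A, (Q s).toReal ≤ statDist P Q := by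
  have h1 := sum_toReal_pmf P
  have h2 := sum_toReal_pmf Q
  rw [← Finset.sum_add_sum_compl A] at h1 h2
  have h3 : ∑ s ∈ A, ((P s).toReal - (Q s).toReal) ≤ ∑ s ∈ A, |(P s).toReal - (Q s).toReal| :=
    Finset.sum_le_sum fun s _ => le_abs_self _
  have h4 : ∑ s ∈ Aᶜ, ((Q s).toReal - (P s).toReal) ≤ ∑ s ∈ Aᶜ, |(P s).toReal - (Q s).toReal| :=
    Finset.sum_le_sum fun s _ => by rw [abs_sub_comm]; exact le_abs_self _
  rw [Finset.sum_sub_distrib] at h3 h4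
  rw [statDist, ← Finset.sum_add_sum_compl A]
  linarith

theorem toReal_le_of_le_minEntropy {Ω : Type} [Fintype Ω] {Q : PMF Ω} {B : ℝ} (hB : 0 < B)
    (h : Real.logb 2 B ≤ minEntropy Q) (s : Ω) : (Q s).toReal ≤ 1 / B := by
  by_cases hs : s ∈ Q.support
  · have hpos : 0 < (Q s).toReal :=
      ENNReal.toReal_pos ((Q.mem_support_iff s).1 hs) (Q.apply_ne_top s)
    have h1 : minEntropy Q ≤ -Real.logb 2 (Q s).toReal :=
      ciInf_le (Set.finite_range _).bddBelow (⟨s, hs⟩ : Q.support)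
    have h2 : Real.logb 2 (Q s).toReal ≤ Real.logb 2 (1 / B) := by
      rw [one_div, Real.logb_inv]; linarith
    exact (Real.logb_le_logb (by norm_num) hpos (by positivity)).1 h2
  · have : Q s = 0 := by rwa [Q.mem_support_iff, not_not] at hs
    rw [this, ENNReal.toReal_zero]
    positivity

/-- The output distribution is supported on the neighbors of `S`, and a distribution of min-entropy
`log₂ (D |S|)` gives them a probability of at most their number divided by `D |S|`. -/
theorem IsLosslessCondenser.isExpander {k : ℕ} (hk : 0 < k) {h : F2 n → Fin D → F2 r}
    (hh : IsLosslessCondenser (Real.logb 2 (4 * k)) (1 / 64) h) :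
    0 < D ∧ IsExpander h (4 * k) := by
  classical
  obtain ⟨hD, H⟩ := hh
  have hD0 : 0 < D := Fin.pos_iff_nonempty.2 hD
  refine ⟨hD0, fun S hS => ?_⟩
  rcases S.eq_empty_or_nonempty with rfl | hne
  · simp
  have hk' : (0 : ℝ) < 4 * k := by positivity
  obtain ⟨Q, hQ, hd⟩ := H S hne (by
    rw [Real.rpow_logb (by norm_num) (by norm_num) hk']
    exact_mod_cast hS)
  have hS0 : (0 : ℝ) < D * S.card := by
    have := hne.card_pos
    positivity
  set P := (PMF.uniformOfFinset S hne).bind fun X =>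
    (PMF.uniformOfFintype (Fin D)).map fun Z => (Z, h X Z) with hP
  have h0 : ∀ q ∉ nbrs h S, (P q).toReal = 0 := by
    intro q hq
    have : q ∉ P.support := by
      rw [hP, PMF.mem_support_bind_iff]
      rintro ⟨a, ha, hq'⟩
      rw [PMF.mem_support_map_iff] at hq'
      obtain ⟨Z, -, rfl⟩ := hq'
      rw [PMF.mem_support_uniformOfFinset_iff] at ha
      exact hq (by simpa [nbrs] using ⟨a, ha, rfl⟩)
    rw [P.mem_support_iff, not_not] at this
    rw [this, ENNReal.toReal_zero]
  have h1 : ∑ s ∈ nbrs h S, (P s).toReal = 1 := by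
    rw [← sum_toReal_pmf P]
    exact Finset.sum_subset (Finset.subset_univ _) fun q _ hq => h0 q hq
  have h2 : ∑ s ∈ nbrs h S, (Q s).toReal ≤ (nbrs h S).card * (1 / (D * S.card)) := by
    rw [← nsmul_eq_mul]
    exact Finset.sum_le_card_nsmul _ _ _ fun s _ => toReal_le_of_le_minEntropy hS0 hQ s
  have h3 := sum_sub_sum_le_statDist P Q (nbrs h S)
  have h4 : (63 : ℝ) / 64 ≤ (nbrs h S).card * (1 / (D * S.card)) := by linarith
  rw [mul_one_div, le_div_iff₀ hS0] at h4
  have : (63 * (D * S.card) : ℝ) ≤ 64 * (nbrs h S).card := by linarith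
  exact_mod_cast this

/-- A bipartite graph with `D * 2 ^ r` right vertices cannot expand many more than `2 ^ r` left
vertices, so the time bound leaves room for handling `k` entries. -/
theorem IsExpander.le_two_pow {k : ℕ} {h : F2 n → Fin D → F2 r} (hh : IsExpander h (4 * k))
    (hD : 0 < D) (hk : k ≤ 2 ^ n) : k ≤ 2 * 2 ^ r := by
  have hc : Fintype.card (F2 n) = 2 ^ n := by simp [F2, ZMod.card]
  obtain ⟨S, -, hS⟩ := Finset.exists_subset_card_eq (s := (Finset.univ : Finset (F2 n)))
    (n := k) (by rwa [Finset.card_univ, hc])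
  have h1 := hh S (by omega)
  have h2 : (nbrs h S).card ≤ D * 2 ^ r := by
    refine (Finset.card_le_univ _).trans ?_
    simp [F2, ZMod.card]
  rw [hS] at h1
  have h3 : D * (63 * k) ≤ D * (64 * 2 ^ r) := by linarith
  have := Nat.le_of_mul_le_mul_left h3 hD
  omega

end Expander

/-! ### Sketches of integer vectors -/

section Sketch

variable {n D r : ℕ}

/-- The `ℓ₁` norm of an integer vector. -/
def nrm {ι : Type*} [Fintype ι] (e : ι → ℤ) : ℤ := ∑ a, |e a|

/-- The part of a vector in the bucket `b` of the seed `t`. -/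
def bucket (h : F2 n → Fin D → F2 r) (t : Fin D) (b : F2 r) (e : F2 n → ℤ) : F2 n → ℤ :=
  fun a => if h a t = b then e a else 0

/-- The `ℓ₁` norm of the sketch of a vector. -/
def sketchNrm (h : F2 n → Fin D → F2 r) (e : F2 n → ℤ) : ℤ :=
  ∑ t, ∑ b, |∑ a, bucket h t b e a|

/-- The position read off from the bit measurements of a vector, correct if one entry outweighs
all the others. -/
def decodePos (g : F2 n → ℤ) : F2 n := fun j =>
  if |(∑ a, if a j = 1 then g a else 0) - ∑ a, g a| < |∑ a, if a j = 1 then g a else 0| then 1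
  else 0

/-- The correction found with the seed `t`: the sum of each bucket, at the position decoded from
the bucket. -/
def correction (h : F2 n → Fin D → F2 r) (t : Fin D) (e : F2 n → ℤ) : F2 n → ℤ :=
  ∑ b, Pi.single (decodePos (bucket h t b e)) (∑ a, bucket h t b e a)

/-- The largest absolute value of an entry from `S` in the bucket `q`. -/
def bucketMax (h : F2 n → Fin D → F2 r) (S : Finset (F2 n)) (e : F2 n → ℤ) (q : Fin D × F2 r) :
    ℕ :=
  (S.filter fun a => h a q.1 = q.2).sup fun a => (e a).natAbs

theorem nrm_nonneg {ι : Type*} [Fintype ι] (e : ι → ℤ) : 0 ≤ nrm e :=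
  Finset.sum_nonneg fun _ _ => abs_nonneg _

theorem nrm_add_le {ι : Type*} [Fintype ι] (e f : ι → ℤ) : nrm (e + f) ≤ nrm e + nrm f := by
  rw [nrm, nrm, nrm, ← Finset.sum_add_distrib]
  exact Finset.sum_le_sum fun a _ => abs_add_le _ _

theorem nrm_neg {ι : Type*} [Fintype ι] (e : ι → ℤ) : nrm (-e) = nrm e := by
  simp [nrm]

theorem nrm_sub_comm {ι : Type*} [Fintype ι] (e f : ι → ℤ) : nrm (e - f) = nrm (f - e) := by
  rw [← nrm_neg, neg_sub]

theorem nrm_sub_le {ι : Type*} [Fintype ι] (e f g : ι → ℤ) :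
    nrm (e - g) ≤ nrm (e - f) + nrm (f - g) := by
  rw [← sub_add_sub_cancel e f g]; exact nrm_add_le _ _

theorem nrm_single {ι : Type*} [Fintype ι] [DecidableEq ι] (i : ι) (v : ℤ) :
    nrm (Pi.single i v) = |v| := by
  rw [nrm, Finset.sum_eq_single i] <;> simp +contextual

theorem nrm_zero {ι : Type*} [Fintype ι] : nrm (0 : ι → ℤ) = 0 := by simp [nrm]

theorem nrm_sum_le {ι κ : Type*} [Fintype ι] (s : Finset κ) (f : κ → ι → ℤ) :
    nrm (∑ i ∈ s, f i) ≤ ∑ i ∈ s, nrm (f i) :=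
  Finset.le_sum_of_subadditive nrm nrm_zero.le nrm_add_le s f

theorem abs_sum_le_nrm {ι : Type*} [Fintype ι] (e : ι → ℤ) : |∑ a, e a| ≤ nrm e :=
  Finset.abs_sum_le_sum_abs _ _

theorem abs_le_nrm {ι : Type*} [Fintype ι] (e : ι → ℤ) (i : ι) : |e i| ≤ nrm e :=
  Finset.single_le_sum (f := fun a => |e a|) (fun _ _ => abs_nonneg _) (Finset.mem_univ i)

theorem nrm_eq_add_erase {ι : Type*} [Fintype ι] [DecidableEq ι] (e : ι → ℤ) (i : ι) :
    nrm e = |e i| + nrm (e - Pi.single i (e i)) := by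
  have h : ∀ a, |(e - (Pi.single i (e i) : ι → ℤ)) a| = if a = i then 0 else |e a| := fun a => by
    by_cases ha : a = i
    · subst ha; simp
    · simp [ha]
  rw [nrm, nrm, Finset.sum_congr rfl fun a _ => h a, ← Finset.add_sum_erase _ _ (Finset.mem_univ i),
    ← Finset.add_sum_erase _ (fun a => if a = i then 0 else |e a|) (Finset.mem_univ i), if_pos rfl,
    zero_add]
  congr 1
  exact Finset.sum_congr rfl fun a ha => by rw [if_neg (Finset.ne_of_mem_erase ha)]

/-- A bucket in which one entry outweighs the others is decoded correctly. -/
theorem decodePos_eq {g : F2 n → ℤ} {i : F2 n} (h : nrm (g - Pi.single i (g i)) < |g i|) :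
    decodePos g = i := by
  funext j
  set f := g - Pi.single i (g i) with hf
  have hg : ∀ a, g a = f a + (Pi.single i (g i) : F2 n → ℤ) a := fun a => by simp [hf]
  set o₁ := ∑ a, if a j = 1 then f a else 0
  set o₀ := ∑ a, if a j = 1 then 0 else f a
  have ho : |o₁| + |o₀| ≤ nrm f := by
    refine (add_le_add (Finset.abs_sum_le_sum_abs _ _) (Finset.abs_sum_le_sum_abs _ _)).trans ?_
    rw [← Finset.sum_add_distrib]
    refine Finset.sum_le_sum fun a _ => ?_
    by_cases ha : a j = 1 <;> simp [ha]
  have h1 : (∑ a, if a j = 1 then g a else 0) = o₁ + if i j = 1 then g i else 0 := by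
    have : ∀ a, (if a j = 1 then g a else 0) = (if a j = 1 then f a else 0) +
        if a = i then (if i j = 1 then g i else 0) else 0 := fun a => by
      rw [hg a]
      by_cases ha : a = i
      · subst ha; by_cases hj : a j = 1 <;> simp [hj]
      · by_cases hj : a j = 1 <;> simp [hj, ha]
    rw [Finset.sum_congr rfl fun a _ => this a, Finset.sum_add_distrib, Finset.sum_ite_eq']
    simp [o₁]
  have h2 : ∑ a, g a = o₁ + o₀ + g i := by
    rw [Finset.sum_congr rfl fun a _ => hg a, Finset.sum_add_distrib, Finset.sum_pi_single',
      if_pos (Finset.mem_univ i), ← Finset.sum_add_distrib]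
    congr 1
    exact Finset.sum_congr rfl fun a _ => by by_cases ha : a j = 1 <;> simp [ha]
  rcases zmod_two_cases (i j) with hj | hj
  · rw [hj, if_neg zero_ne_one, add_zero] at h1
    rw [decodePos, h1, h2, hj, if_neg]
    rw [not_lt]
    rcases abs_cases (o₁ - (o₁ + o₀ + g i)) with ⟨h3, _⟩ | ⟨h3, _⟩ <;>
    rcases abs_cases (g i) with ⟨h4, _⟩ | ⟨h4, _⟩ <;>
    rcases abs_cases o₀ with ⟨h5, _⟩ | ⟨h5, _⟩ <;>
    rw [h3] <;> linarith
  · rw [hj, if_pos rfl] at h1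
    rw [decodePos, h1, h2, hj, if_pos]
    rcases abs_cases (o₁ + g i - (o₁ + o₀ + g i)) with ⟨h3, _⟩ | ⟨h3, _⟩ <;>
    rcases abs_cases (g i) with ⟨h4, _⟩ | ⟨h4, _⟩ <;>
    rcases abs_cases o₁ with ⟨h5, _⟩ | ⟨h5, _⟩ <;>
    rcases abs_cases o₀ with ⟨h6, _⟩ | ⟨h6, _⟩ <;>
    rcases abs_cases (o₁ + g i) with ⟨h7, _⟩ | ⟨h7, _⟩ <;>
    rw [h3, h7] <;> linarith

/-- Subtracting from a bucket its sum at the decoded position leaves little more than what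
lies outside of any single position. -/
theorem nrm_sub_decode_le (g : F2 n → ℤ) (i : F2 n) :
    nrm (g - Pi.single (decodePos g) (∑ a, g a)) + 4 * |g i| ≤ 4 * nrm g := by
  have h1 := nrm_eq_add_erase g i
  by_cases h : nrm (g - Pi.single i (g i)) < |g i|
  · rw [decodePos_eq h]
    have h2 := nrm_sub_le g (Pi.single i (g i)) (Pi.single i (∑ a, g a))
    rw [← Pi.single_sub, nrm_single] at h2
    have h3 := abs_sum_le_nrm (g - Pi.single i (g i))
    simp only [Pi.sub_apply, Finset.sum_sub_distrib, Finset.sum_pi_single', Finset.mem_univ,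
      if_true] at h3
    rw [abs_sub_comm] at h3
    linarith [nrm_nonneg (g - Pi.single i (g i))]
  · have h2 := nrm_sub_le g 0 (Pi.single (decodePos g) (∑ a, g a))
    rw [sub_zero, zero_sub, nrm_neg, nrm_single] at h2
    have h3 := abs_sum_le_nrm g
    linarith

variable (h : F2 n → Fin D → F2 r)

theorem sum_bucket (t : Fin D) (e : F2 n → ℤ) : ∑ b, bucket h t b e = e := by
  funext a
  simp [bucket, Finset.sum_apply]

theorem sum_nrm_bucket (t : Fin D) (e : F2 n → ℤ) : ∑ b, nrm (bucket h t b e) = nrm e := by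
  simp only [nrm]
  rw [Finset.sum_comm]
  refine Finset.sum_congr rfl fun a _ => ?_
  rw [Finset.sum_eq_single (h a t)]
  · simp [bucket]
  · intro b _ hb
    simp [bucket, hb.symm]
  · simp

theorem sum_sum_nrm_bucket (e : F2 n → ℤ) :
    ∑ q : Fin D × F2 r, nrm (bucket h q.1 q.2 e) = D * nrm e := by
  rw [Fintype.sum_prod_type]
  simp [sum_nrm_bucket]

/-- Summing over the seeds, the corrections miss only what is not the largest entry of a
bucket. -/
theorem sum_nrm_sub_correction_le (S : Finset (F2 n)) (e : F2 n → ℤ) :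
    ∑ t, nrm (e - correction h t e) + 4 * ∑ q, (bucketMax h S e q : ℤ) ≤ 4 * (D * nrm e) := by
  rw [← sum_sum_nrm_bucket h, Finset.mul_sum, Finset.mul_sum]
  have h1 : ∀ t, nrm (e - correction h t e) ≤ ∑ b, nrm (bucket h t b e -
      Pi.single (decodePos (bucket h t b e)) (∑ a, bucket h t b e a)) := fun t => by
    refine le_of_eq_of_le ?_ (nrm_sum_le _ _)
    rw [Finset.sum_sub_distrib, sum_bucket, correction]
  refine (add_le_add_left (Finset.sum_le_sum fun t _ => h1 t) _).trans ?_
  refine le_of_eq_of_le (congrArg (· + _) (Fintype.sum_prod_type' _).symm) ?_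
  rw [← Finset.sum_add_distrib]
  refine Finset.sum_le_sum fun q _ => ?_
  set g := bucket h q.1 q.2 e with hg
  have h2 : bucketMax h S e q ≤
      ((4 * nrm g - nrm (g - Pi.single (decodePos g) (∑ a, g a))) / 4).toNat := by
    refine Finset.sup_le fun a ha => ?_
    have h3 := nrm_sub_decode_le g a
    have h4 : g a = e a := by simp [hg, bucket, (Finset.mem_filter.1 ha).2]
    rw [h4] at h3
    rcases abs_cases (e a) with h6 | h6 <;> omega
  have h5 := nrm_sub_decode_le g 0
  have := abs_nonneg (g 0)
  omega

variable {h}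

/-- Layer cake: expansion of the level sets bounds the sum of the maxima of the buckets. -/
theorem IsExpander.sum_le_sum_bucketMax {K : ℕ} (hh : IsExpander h K) {S : Finset (F2 n)}
    (hS : S.card ≤ K) (e : F2 n → ℤ) :
    63 * (D * ∑ a ∈ S, |e a|) ≤ 64 * ∑ q, (bucketMax h S e q : ℤ) := by
  set Θ := S.sup fun a => (e a).natAbs
  have layer : ∀ m ≤ Θ, m = ∑ θ ∈ Finset.range Θ, if θ < m then 1 else 0 := fun m hm => by
    rw [← Finset.sum_filter, Finset.sum_const, smul_eq_mul, mul_one]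
    conv_lhs => rw [← Finset.card_range m]
    congr 1
    ext θ
    simp only [Finset.mem_range, Finset.mem_filter]
    omega
  have h1 : ∑ a ∈ S, (e a).natAbs =
      ∑ θ ∈ Finset.range Θ, (S.filter fun a => θ < (e a).natAbs).card := by
    rw [Finset.sum_congr rfl fun a ha => layer _ (Finset.le_sup (f := fun a => (e a).natAbs) ha),
      Finset.sum_comm]
    exact Finset.sum_congr rfl fun θ _ => by rw [← Finset.sum_filter, Finset.card_eq_sum_ones]
  have h2 : ∑ q, bucketMax h S e q =
      ∑ θ ∈ Finset.range Θ, (nbrs h (S.filter fun a => θ < (e a).natAbs)).card := by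
    rw [Finset.sum_congr rfl fun q _ => layer (bucketMax h S e q)
      (Finset.sup_mono (Finset.filter_subset _ _)), Finset.sum_comm]
    refine Finset.sum_congr rfl fun θ _ => ?_
    rw [← Finset.sum_filter, ← Finset.card_eq_sum_ones]
    congr 1
    ext q
    simp only [bucketMax, nbrs, Finset.lt_sup_iff, Finset.mem_filter, Finset.mem_univ, true_and]
    constructor
    · rintro ⟨a, ⟨h1, h2⟩, h3⟩; exact ⟨a, ⟨h1, h3⟩, h2⟩
    · rintro ⟨a, ⟨h1, h2⟩, h3⟩; exact ⟨a, ⟨h1, h3⟩, h2⟩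
  have h3 : 63 * (D * ∑ a ∈ S, (e a).natAbs) ≤ 64 * ∑ q, bucketMax h S e q := by
    rw [h1, h2, Finset.mul_sum, Finset.mul_sum, Finset.mul_sum]
    exact Finset.sum_le_sum fun θ _ => hh _ ((Finset.card_filter_le _ _).trans hS)
  have h4 : ∑ a ∈ S, |e a| = ((∑ a ∈ S, (e a).natAbs : ℕ) : ℤ) := by
    push_cast
    exact Finset.sum_congr rfl fun a _ => by simp
  rw [h4]
  exact_mod_cast h3

/-- The sketch is almost an isometry in the `ℓ₁` norm on sparse vectors. -/
theorem IsExpander.nrm_le_sketchNrm {K : ℕ} (hh : IsExpander h K) {S : Finset (F2 n)}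
    (hS : S.card ≤ K) {v : F2 n → ℤ} (hv : ∀ a ∉ S, v a = 0) :
    31 * (D * nrm v) ≤ 32 * sketchNrm h v := by
  have h1 := hh.sum_le_sum_bucketMax hS v
  have h2 : ∑ a ∈ S, |v a| = nrm v :=
    Finset.sum_subset (Finset.subset_univ _) fun a _ ha => by simp [hv a ha]
  have h3 : ∑ q, 2 * (bucketMax h S v q : ℤ) ≤
      ∑ q : Fin D × F2 r, (|∑ a, bucket h q.1 q.2 v a| + nrm (bucket h q.1 q.2 v)) := by
    refine Finset.sum_le_sum fun q _ => ?_
    set g := bucket h q.1 q.2 v with hg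
    have h4 : bucketMax h S v q ≤ ((|∑ a, g a| + nrm g) / 2).toNat := by
      refine Finset.sup_le fun a ha => ?_
      have h5 : g a = v a := by simp [hg, bucket, (Finset.mem_filter.1 ha).2]
      have h6 := nrm_eq_add_erase g a
      have h7 := abs_sum_le_nrm (g - Pi.single a (g a))
      simp only [Pi.sub_apply, Finset.sum_sub_distrib, Finset.sum_pi_single', Finset.mem_univ,
        if_true] at h7
      rw [h5] at h6 h7
      rcases abs_cases (v a) with h8 | h8 <;>
      rcases abs_cases (∑ a, g a) with h9 | h9 <;>
      rcases abs_cases (∑ a, g a - v a) with h10 | h10 <;> omega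
    have := nrm_nonneg g
    have := abs_nonneg (∑ a, g a)
    omega
  rw [Finset.sum_add_distrib, sum_sum_nrm_bucket, ← Finset.mul_sum, Fintype.sum_prod_type,
    Fintype.sum_prod_type] at h3
  rw [h2, Fintype.sum_prod_type] at h1
  rw [sketchNrm]
  linarith

theorem bucket_add (t : Fin D) (b : F2 r) (e f : F2 n → ℤ) :
    bucket h t b (e + f) = bucket h t b e + bucket h t b f := by
  funext a
  by_cases ha : h a t = b <;> simp [bucket, ha]

theorem sketchNrm_add_le (e f : F2 n → ℤ) :
    sketchNrm h (e + f) ≤ sketchNrm h e + sketchNrm h f := by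
  simp only [sketchNrm, ← Finset.sum_add_distrib]
  refine Finset.sum_le_sum fun t _ => Finset.sum_le_sum fun b _ => ?_
  rw [bucket_add]
  simp only [Pi.add_apply, Finset.sum_add_distrib]
  exact abs_add_le _ _

theorem sketchNrm_neg (e : F2 n → ℤ) : sketchNrm h (-e) = sketchNrm h e := by
  have : ∀ t b a, bucket h t b (-e) a = -bucket h t b e a := fun t b a => by
    by_cases ha : h a t = b <;> simp [bucket, ha]
  simp [sketchNrm, this]

theorem sketchNrm_le (e : F2 n → ℤ) : sketchNrm h e ≤ D * nrm e := by
  rw [← sum_sum_nrm_bucket h, Fintype.sum_prod_type]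
  exact Finset.sum_le_sum fun t _ => Finset.sum_le_sum fun b _ => abs_sum_le_nrm _

end Sketch

/-! ### Convergence of the iteration -/

section Convergence

variable {n D r k : ℕ} {h : F2 n → Fin D → F2 r}

/-- Entries outside of `S` set to zero. -/
def restrict (S : Finset (F2 n)) (x : F2 n → ℤ) : F2 n → ℤ := fun a => if a ∈ S then x a else 0

/-- A vector that explains the sketch well is close to the signal. -/
theorem IsExpander.nrm_sub_le_of_sketch (hh : IsExpander h (4 * k)) {x v : F2 n → ℤ}
    {S T : Finset (F2 n)} (hS : S.card ≤ k) (hT : T.card ≤ k) (hv : ∀ a ∉ T, v a = 0) :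
    31 * (D * nrm (x - v)) ≤ 32 * sketchNrm h (x - v) + 63 * (D * nrm (x - restrict S x)) := by
  classical
  have h1 := hh.nrm_le_sketchNrm (S := S ∪ T) (v := restrict S x - v)
    ((Finset.card_union_le _ _).trans (by omega)) fun a ha => by
      rw [Finset.mem_union, not_or] at ha
      simp [restrict, ha.1, hv a ha.2]
  have h2 := sketchNrm_add_le (h := h) (x - v) (-(x - restrict S x))
  rw [sketchNrm_neg, show x - v + -(x - restrict S x) = restrict S x - v by abel] at h2
  have h3 := sketchNrm_le (h := h) (x - restrict S x)
  have h4 := mul_le_mul_of_nonneg_left (nrm_sub_le x (restrict S x) v) (Int.natCast_nonneg D)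
  rw [mul_add] at h4
  linarith

/-- One step of the iteration reduces the error by the factor `1 / 4`, up to a multiple of the
error of the best sparse approximation. -/
theorem IsExpander.contraction (hh : IsExpander h (4 * k)) (hD : 0 < D) {x w w' : F2 n → ℤ}
    {cand : Fin D → F2 n → ℤ} {S T T' : Finset (F2 n)} (hS : S.card ≤ k)
    (hT : T.card ≤ k) (hw : ∀ a ∉ T, w a = 0) (hT' : T'.card ≤ k) (hw' : ∀ a ∉ T', w' a = 0)
    (hcand : ∀ t, nrm (w + correction h t (x - w) - cand t) ≤
      2 * nrm (w + correction h t (x - w) - restrict S (w + correction h t (x - w))))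
    (hsel : ∀ t, sketchNrm h (x - w') ≤ sketchNrm h (x - cand t)) :
    4 * nrm (x - w') ≤ nrm (x - w) + 68 * nrm (x - restrict S x) := by
  classical
  set e := x - w with he
  set τ := nrm (x - restrict S x) with hτ
  -- The part of the error outside of the head of `x` and the support of `w` is at most `τ`.
  have h1 : nrm e ≤ ∑ a ∈ S ∪ T, |e a| + τ := by
    rw [nrm, ← Finset.sum_add_sum_compl (S ∪ T), hτ, nrm]
    refine add_le_add le_rfl ((Finset.sum_le_sum fun a ha => ?_).trans
      (Finset.sum_le_univ_sum_of_nonneg fun a => abs_nonneg _))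
    rw [Finset.mem_compl, Finset.mem_union, not_or] at ha
    simp [he, restrict, ha.1, hw a ha.2]
  have h2 := hh.sum_le_sum_bucketMax (S := S ∪ T) ((Finset.card_union_le _ _).trans (by omega)) e
  have h3 := sum_nrm_sub_correction_le h (S ∪ T) e
  -- Some seed is at least as good as the average.
  obtain ⟨t, ht⟩ : ∃ t, 16 * nrm (e - correction h t e) ≤ nrm e + 63 * τ := by
    by_contra! hcon
    have h4 : ∑ t : Fin D, (nrm e + 63 * τ) < ∑ t, 16 * nrm (e - correction h t e) :=
      Finset.sum_lt_sum_of_nonempty ⟨⟨0, hD⟩, Finset.mem_univ _⟩ fun t _ => hcon t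
    rw [Finset.sum_const, Finset.card_univ, Fintype.card_fin, nsmul_eq_mul, ← Finset.mul_sum] at h4
    have h5 := mul_le_mul_of_nonneg_left h1 (Int.natCast_nonneg D)
    rw [mul_add] at h4 h5
    linarith
  set z := w + correction h t e with hz
  have hxz : x - z = e - correction h t e := by rw [hz, he]; abel
  have h4 : nrm (z - restrict S z) ≤ nrm (x - z) + τ := by
    rw [nrm_sub_comm x z, hτ]
    simp only [nrm, ← Finset.sum_add_distrib]
    refine Finset.sum_le_sum fun a _ => ?_
    by_cases ha : a ∈ S
    · simp [restrict, ha]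
    · simp only [restrict, ha, if_false, Pi.sub_apply, sub_zero]
      have := abs_add_le (z a - x a) (x a)
      rwa [sub_add_cancel] at this
  have h5 := nrm_sub_le x z (cand t)
  have h6 := hcand t
  have h7 := hh.nrm_sub_le_of_sketch (x := x) hS hT' hw'
  rw [← hτ] at h7
  have h8 := (hsel t).trans (sketchNrm_le (h := h) (x - cand t))
  have hD' : (0 : ℤ) < D := by exact_mod_cast hD
  have h9 : D * (31 * nrm (x - w')) ≤ D * (32 * nrm (x - cand t) + 63 * τ) := by linarith
  have h10 := le_of_mul_le_mul_left h9 hD'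
  rw [hxz] at h4 h5
  have := nrm_nonneg (x - restrict S x)
  have := nrm_nonneg e
  linarith

/-- After as many steps as the norm of the sketch has bits, the error is at most a multiple of
the error of the best sparse approximation. -/
theorem IsExpander.error_le (hh : IsExpander h (4 * k)) (hD : 0 < D) {x v : F2 n → ℤ}
    {S : Finset (F2 n)} (hS : S.card ≤ k) {s : ℕ} (hs : sketchNrm h x < 2 ^ s)
    (hfin : 4 ^ s * nrm (x - v) ≤ nrm x + 4 ^ s * (23 * nrm (x - restrict S x))) :
    nrm (x - v) ≤ 30 * nrm (x - restrict S x) := by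
  set τ := nrm (x - restrict S x) with hτ
  have hτ0 : 0 ≤ τ := nrm_nonneg _
  have hD' : (0 : ℤ) < D := by exact_mod_cast hD
  have hx : nrm x ≤ 2 * sketchNrm h x + 3 * τ := by
    have h1 := hh.nrm_sub_le_of_sketch (x := x) (v := 0) (T := ∅) hS (by simp) (by simp)
    rw [sub_zero, ← hτ] at h1
    have h2 : 0 ≤ sketchNrm h x :=
      Finset.sum_nonneg fun _ _ => Finset.sum_nonneg fun _ _ => abs_nonneg _
    have h3 : sketchNrm h x ≤ D * sketchNrm h x := le_mul_of_one_le_left h2 (by omega)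
    have h4 : D * (31 * nrm x) ≤ D * (32 * sketchNrm h x + 63 * τ) := by linarith
    have h5 := le_of_mul_le_mul_left h4 hD'
    linarith
  set E := nrm (x - v)
  have hE : 0 ≤ E := nrm_nonneg _
  have hp : (1 : ℤ) ≤ 2 ^ s := one_le_pow₀ (by norm_num)
  have h4 : (4 : ℤ) ^ s = 2 ^ s * 2 ^ s := by rw [← mul_pow]; norm_num
  rw [h4] at hfin
  have h5 : 2 ^ s * 2 ^ s * E ≤ 2 * sketchNrm h x + 2 ^ s * 2 ^ s * (26 * τ) := by
    have : 3 * τ ≤ 2 ^ s * 2 ^ s * (3 * τ) := le_mul_of_one_le_left (by linarith) (by nlinarith)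
    linarith
  -- All norms are integers, so an error below `1` vanishes.
  by_contra! hcon
  have h6 : 26 * τ + 1 ≤ E := by omega
  have h7 : 2 ^ s * 2 ^ s * (26 * τ + 1) ≤ 2 ^ s * 2 ^ s * E :=
    mul_le_mul_of_nonneg_left h6 (by positivity)
  rcases s with _ | s
  · simp only [pow_zero] at hs h5 h7 hp
    linarith
  · have h8 : (2 : ℤ) ≤ 2 ^ (s + 1) := by
      rw [pow_succ]
      linarith [one_le_pow₀ (M₀ := ℤ) (a := 2) (n := s) (by norm_num)]
    have h9 : 2 * (2 : ℤ) ^ (s + 1) ≤ 2 ^ (s + 1) * 2 ^ (s + 1) :=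
      mul_le_mul_of_nonneg_right h8 (by positivity)
    linarith

/-! ### Approximately largest entries -/

/-- The part of a vector on a set `A` of entries is, up to a factor of `2`, at least as good
as any other approximation by as many entries, if no other entry exceeds one from `A` by more
than a factor of `2`. -/
theorem nrm_sub_restrict_le {z : F2 n → ℤ} {A S : Finset (F2 n)}
    (hA : ∀ i ∈ A, ∀ j ∉ A, |z j| ≤ 2 * |z i|) (hAS : S.card ≤ A.card) :
    nrm (z - restrict A z) ≤ 2 * nrm (z - restrict S z) := by
  classical
  have hr : ∀ T : Finset (F2 n), nrm (z - restrict T z) = ∑ a ∈ Tᶜ, |z a| := fun T => by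
    rw [nrm, ← Finset.sum_add_sum_compl T]
    rw [Finset.sum_eq_zero fun a ha => by simp [restrict, ha], zero_add]
    exact Finset.sum_congr rfl fun a ha => by
      simp [restrict, Finset.mem_compl.1 ha]
  rw [hr, hr]
  have hd : ∀ T U : Finset (F2 n), ∑ a ∈ Tᶜ, |z a| =
      ∑ a ∈ (T ∪ U)ᶜ, |z a| + ∑ a ∈ U \ T, |z a| := fun T U => by
    rw [← Finset.sum_union]
    · congr 1
      ext a; simp only [Finset.mem_compl, Finset.mem_union, Finset.mem_sdiff]; tauto
    · rw [Finset.disjoint_left]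
      intro a; simp only [Finset.mem_compl, Finset.mem_union, Finset.mem_sdiff]; tauto
  rw [hd A S, hd S A, Finset.union_comm S A]
  have h1 : ∑ a ∈ S \ A, |z a| ≤ 2 * ∑ a ∈ A \ S, |z a| := by
    have hc : (S \ A).card ≤ (A \ S).card := by
      have := Finset.card_sdiff_add_card_inter S A
      have := Finset.card_sdiff_add_card_inter A S
      rw [Finset.inter_comm] at this
      omega
    obtain ⟨B, hB, hBc⟩ := Finset.exists_subset_card_eq hc
    let φ := Finset.equivOfCardEq hBc.symm
    have h2 : ∑ a ∈ S \ A, |z a| ≤ ∑ a ∈ B, 2 * |z a| := by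
      rw [← Finset.sum_coe_sort, ← Finset.sum_coe_sort B, ← Equiv.sum_comp φ]
      refine Finset.sum_le_sum fun a _ => hA _ ?_ _ ?_
      · exact (Finset.mem_sdiff.1 (hB (φ a).2)).1
      · exact (Finset.mem_sdiff.1 a.2).2
    refine h2.trans ?_
    rw [← Finset.mul_sum]
    exact mul_le_mul_of_nonneg_left
      (Finset.sum_le_sum_of_subset_of_nonneg hB fun _ _ _ => abs_nonneg _) (by norm_num)
  have : 0 ≤ ∑ a ∈ (A ∪ S)ᶜ, |z a| := Finset.sum_nonneg fun _ _ => abs_nonneg _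
  linarith

end Convergence

/-! ### Programs for sketches -/

section SketchPrograms

variable {n D r : ℕ}

/-- A list of integers. -/
def encInts (l : List ℤ) : SExp := encList (l.map encInt)

/-- The sum of a vector, followed by its bit measurements. -/
def measure (g : F2 n → ℤ) : List ℤ :=
  (∑ a, g a) :: List.ofFn fun j => ∑ a, if a j = 1 then g a else 0

/-- The sketch of `e` for the seed `t`, as an array of the measurements of the buckets. -/
def sketchArray (h : F2 n → Fin D → F2 r) (t : Fin D) (e : F2 n → ℤ) : SExp :=
  encArray r fun b => encInts (measure (bucket h t b e))

theorem encInts_measure_ne_nil (g : F2 n → ℤ) : encInts (measure g) ≠ .nil := by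
  simp [encInts, measure, encList]

/-- An entry of a sparse vector: the pair of its position and its value. -/
def encEntry (q : F2 n × ℤ) : SExp := .cons (encF2 q.1) (encInt q.2)

/-- The vector with the given entries, where values at the same position are added. -/
def entryVec (l : List (F2 n × ℤ)) : F2 n → ℤ := (l.map fun q => Pi.single q.1 q.2).sum

/-- The sum of the absolute values of the entries of a list. -/
def weight (l : List (F2 n × ℤ)) : ℤ := (l.map fun q => |q.2|).sum

theorem entryVec_append (l l' : List (F2 n × ℤ)) :
    entryVec (l ++ l') = entryVec l + entryVec l' := by simp [entryVec]

theorem weight_append (l l' : List (F2 n × ℤ)) : weight (l ++ l') = weight l + weight l' := by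
  simp [weight]

theorem entryVec_singleton (q : F2 n × ℤ) : entryVec [q] = Pi.single q.1 q.2 := by simp [entryVec]

theorem weight_singleton (q : F2 n × ℤ) : weight [q] = |q.2| := by simp [weight]

theorem weight_nonneg (l : List (F2 n × ℤ)) : 0 ≤ weight l :=
  List.sum_nonneg fun a ha => by
    obtain ⟨q, -, rfl⟩ := List.mem_map.1 ha
    exact abs_nonneg _

theorem nrm_entryVec_le (l : List (F2 n × ℤ)) : nrm (entryVec l) ≤ weight l := by
  induction l with
  | nil => simp [entryVec, weight, nrm_zero]
  | cons q l ih =>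
    have h1 : entryVec (q :: l) = entryVec [q] + entryVec l := entryVec_append [q] l
    have h2 : weight (q :: l) = weight [q] + weight l := weight_append [q] l
    rw [h1, h2, entryVec_singleton, weight_singleton]
    refine (nrm_add_le _ _).trans ?_
    rw [nrm_single]
    linarith

theorem entryVec_apply_of_notMem {w : List (F2 n × ℤ)} {a : F2 n} (ha : a ∉ w.map Prod.fst) :
    entryVec w a = 0 := by
  induction w with
  | nil => simp [entryVec]
  | cons q w ih =>
    have h1 : entryVec (q :: w) = entryVec [q] + entryVec w := entryVec_append [q] w
    simp only [List.map_cons, List.mem_cons, not_or] at ha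
    rw [h1, entryVec_singleton, Pi.add_apply, ih ha.2, Pi.single_eq_of_ne ha.1, add_zero]

/-- Adds `v` to the entries of a list that are selected by a list of bits, on the argument
`((v, bits), list)`. -/
def vecAddC : Code :=
  .ite (.tl x1) .nil (.cons (.ite (.hd (.tl x1)) (.hd r1) (call intAddC (.cons (.hd r1) (.hd x1))))
    (recur (.cons (.cons (.hd x1) (.tl (.tl x1))) (.tl r1))))

theorem ev_vecAdd {W : ℕ} {v : ℤ} (hv : v.natAbs < 2 ^ W) : ∀ l : List (Bool × ℤ),
    (∀ q ∈ l, q.2.natAbs < 2 ^ W) → Ev vecAddC vecAddC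
      (.cons (.cons (encInt v) (encList (l.map fun q => encBit q.1))) (encInts (l.map Prod.snd)))
      (encInts (l.map fun q => if q.1 then q.2 + v else q.2))
      (l.length * (200 * W + 190) + 10) := by
  intro l
  induction l with
  | nil => intro _; exact (Ev.iteNil (.simple rfl) .nil).mono (by simp only [Code.cost]; omega)
  | cons q l ih =>
    intro hl
    have h1 := ih fun a ha => hl a (by simp [ha])
    have h2 : Ev vecAddC (call intAddC (.cons (.hd r1) (.hd x1)))
        (.cons (.cons (encInt v) (encList ((q :: l).map fun q => encBit q.1)))
        (encInts ((q :: l).map Prod.snd))) (encInt (q.2 + v)) (200 * W + 140) :=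
      Ev.mono (.call (.simple rfl) (ev_intAdd (hl q (by simp)) hv))
        (by simp only [Code.cost]; omega)
    refine Ev.cast (.iteCons (.simple rfl) (.cons (.iteBit (c := q.1) (v := encInt q.2)
      (.simple rfl) ((Ev.simple rfl).mono (by simp only [Code.cost]; omega)) h2)
      (.recur (.simple rfl) h1))) ?_ ?_
    · simp only [encInts, List.map_cons, encList]
      congr 1
      cases q.1 <;> rfl
    · simp only [Code.cost, List.length_cons, Nat.add_mul]
      omega

theorem natAbs_lt_two_pow {v : ℤ} {W : ℕ} (h : |v| < 2 ^ W) : v.natAbs < 2 ^ W := by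
  zify
  exact h

theorem abs_bit_le_nrm (g : F2 n → ℤ) (j : Fin n) :
    |∑ a, if a j = 1 then g a else 0| ≤ nrm g := by
  refine (Finset.abs_sum_le_sum_abs _ _).trans (Finset.sum_le_sum fun a _ => ?_)
  by_cases ha : a j = 1 <;> simp [ha]

theorem nrm_bucket_le (h : F2 n → Fin D → F2 r) (t : Fin D) (b : F2 r) (e : F2 n → ℤ) :
    nrm (bucket h t b e) ≤ nrm e :=
  Finset.sum_le_sum fun a _ => by by_cases ha : h a t = b <;> simp [bucket, ha]

theorem measure_sub_single (g : F2 n → ℤ) (u : F2 n) (v : ℤ) :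
    measure (g - Pi.single u v) = ((true, ∑ a, g a) :: List.ofFn fun j =>
      (decide (u j = 1), ∑ a, if a j = 1 then g a else 0)).map fun q =>
        if q.1 then q.2 + -v else q.2 := by
  have h : ∀ j, (∑ a : F2 n, if a j = 1 then (g - Pi.single u v : F2 n → ℤ) a else 0) =
      (∑ a, if a j = 1 then g a else 0) - if u j = 1 then v else 0 := fun j => by
    have : ∀ a : F2 n, (if a j = 1 then (g - Pi.single u v : F2 n → ℤ) a else 0) =
        (if a j = 1 then g a else 0) - if a = u then (if u j = 1 then v else 0) else 0 :=
      fun a => by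
        by_cases ha : a = u
        · subst ha; by_cases hj : a j = 1 <;> simp [hj]
        · by_cases hj : a j = 1 <;> simp [hj, ha]
    rw [Finset.sum_congr rfl fun a _ => this a, Finset.sum_sub_distrib, Finset.sum_ite_eq',
      if_pos (Finset.mem_univ u)]
  simp only [measure, h, List.map_cons, List.map_ofFn]
  congr 1
  · simp [Finset.sum_sub_distrib, ← sub_eq_add_neg]
  · congr 1
    funext j
    by_cases hj : u j = 1 <;> simp [hj, sub_eq_add_neg]

/-- Subtracts an entry `(u, v)` from the sketch for the seed `t`, on the argument
`((k, t), sketch, (u, v))`. -/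
def residEntryC (prog : Code) : Code :=
  call (updC vecAddC) (.cons (call prog (.cons (.hd x1) (.cons (.hd r2) (.tl x1))))
    (.cons (.cons (call intNegC (.tl r2)) (.cons oneC (.hd r2))) x2))

variable {h : F2 n → Fin D → F2 r} {prog : Code} {k H W : ℕ}

theorem bucket_sub_single (t : Fin D) (b : F2 r) (e : F2 n → ℤ) (u : F2 n) (v : ℤ) :
    bucket h t b (e - Pi.single u v) =
      if b = h u t then bucket h t b e - Pi.single u v else bucket h t b e := by
  funext a
  by_cases hu : a = u
  · subst hu
    by_cases hb : b = h a t
    · simp [bucket, hb]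
    · simp [bucket, hb, Ne.symm hb]
  · by_cases hb : b = h u t <;> by_cases hb' : h a t = b <;> simp [bucket, hb, hb', hu]

/-- In each seed, changing a vector at one position affects the measurements of only one bucket, so
the update costs little more than one evaluation of the condenser. -/
theorem ev_residEntry (hn : n ≤ W) (hr : r ≤ W) (hH : H ≤ W) (hW : 0 < W) {t : Fin D}
    {q : F2 n × ℤ} (hprog : Ev prog prog (.cons (encNat k) (.cons (encF2 q.1) (encNat t)))
      (encF2 (h q.1 t)) H) {e : F2 n → ℤ} (he : nrm e + |q.2| < 2 ^ W) :
    Ev (residEntryC prog) (residEntryC prog)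
      (.cons (.cons (encNat k) (encNat t)) (.cons (sketchArray h t e) (encEntry q)))
      (sketchArray h t (e - Pi.single q.1 q.2)) (1000 * W ^ 2) := by
  have h0 := abs_nonneg q.2
  have h1 := nrm_nonneg e
  have hv : (-q.2).natAbs < 2 ^ W := natAbs_lt_two_pow (by rw [abs_neg]; linarith)
  have hg : ∀ b, nrm (bucket h t b e) < 2 ^ W := fun b =>
    (nrm_bucket_le h t b e).trans_lt (by linarith)
  have hadd := ev_vecAdd hv ((true, ∑ a, bucket h t (h q.1 t) e a) :: List.ofFn fun j =>
      (decide (q.1 j = 1), ∑ a, if a j = 1 then bucket h t (h q.1 t) e a else 0)) (by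
    intro p hp
    rw [List.mem_cons, List.mem_ofFn'] at hp
    rcases hp with rfl | ⟨j, rfl⟩
    · exact natAbs_lt_two_pow ((abs_sum_le_nrm _).trans_lt (hg _))
    · exact natAbs_lt_two_pow ((abs_bit_le_nrm _ j).trans_lt (hg _)))
  rw [← measure_sub_single] at hadd
  have hadd' : Ev vecAddC vecAddC
      (.cons (.cons (encInt (-q.2)) (.cons (encBit true) (encF2 q.1)))
        (encInts (measure (bucket h t (h q.1 t) e))))
      (encInts (measure (bucket h t (h q.1 t) e - Pi.single q.1 q.2)))
      ((n + 1) * (200 * W + 190) + 10) := by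
    convert hadd using 1
    · simp only [List.map_cons, List.map_ofFn, measure, encF2, encList]
      rfl
    · simp
  have hupd := ev_upd (f := fun b => encInts (measure (bucket h t b e))) (b := h q.1 t)
    (encInts_measure_ne_nil _) hadd'
  have hfun : Function.update (fun b => encInts (measure (bucket h t b e))) (h q.1 t)
      (encInts (measure (bucket h t (h q.1 t) e - Pi.single q.1 q.2))) =
      fun b => encInts (measure (bucket h t b (e - Pi.single q.1 q.2))) := by
    funext b
    rw [bucket_sub_single]
    by_cases hb : b = h q.1 t
    · subst hb; simp
    · simp [hb]
  rw [hfun, ← encArray_eq_encTrie fun b => encInts_measure_ne_nil _,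
    ← encArray_eq_encTrie fun b => encInts_measure_ne_nil _] at hupd
  refine Ev.mono (.call (.cons (.call (.simple rfl) hprog) (.cons (.cons
    (.call (.simple rfl) (ev_intNeg q.2)) (.simple rfl)) (.simple rfl))) hupd) ?_
  have h2 : (n + 1) * (200 * W + 190) ≤ (2 * W) * (390 * W) :=
    Nat.mul_le_mul (by omega) (by omega)
  have h3 : W ≤ W ^ 2 := Nat.le_self_pow (by norm_num) W
  have h4 : 2 * W * (390 * W) = 780 * W ^ 2 := by ring
  simp only [oneC, Code.cost]
  omega

/-- Subtracts a sparse vector `w` from the sketches for the seeds from `t` on, on the argument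
`((k, w), t, sketches)`. -/
def residC (prog : Code) : Code :=
  .ite r2 .nil (.cons (call (foldC (residEntryC prog))
      (.cons (.cons (.hd x1) x2) (.cons (.hd r2) (.tl x1))))
    (recur (.cons x1 (.cons (call natAddC (.cons oneC (.cons x2 .nil))) (.tl r2)))))

/-- All intermediate residuals, and the entries subtracted from them, are bounded by the norms of
the signal and the estimate. -/
theorem entryVec_prefix_bound {x : F2 n → ℤ} {w l₁ l₂ : List (F2 n × ℤ)} {q : F2 n × ℤ}
    (hw : w = l₁ ++ q :: l₂) : nrm (x - entryVec l₁) + |q.2| ≤ nrm x + weight w := by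
  have h1 := nrm_sub_le x 0 (entryVec l₁)
  rw [sub_zero, zero_sub, nrm_neg] at h1
  have h2 := nrm_entryVec_le l₁
  have h3 : weight w = weight l₁ + (|q.2| + weight l₂) := by
    rw [hw, ← weight_singleton, ← weight_append, ← weight_append]; rfl
  linarith [weight_nonneg l₂]

/-- The program `prog` computes `h` from `k`, a position and a seed in at most `H` steps. -/
def ComputesHash (prog : Code) (k H : ℕ) (h : F2 n → Fin D → F2 r) : Prop :=
  ∀ (a : F2 n) (t : Fin D), Ev prog prog (.cons (encNat k) (.cons (encF2 a) (encNat t)))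
    (encF2 (h a t)) H

theorem ev_resid_aux (hn : n ≤ W) (hr : r ≤ W) (hH : H ≤ W) (hW : 0 < W) (hD : D ≤ 2 ^ W)
    (hprog : ComputesHash prog k H h) {x : F2 n → ℤ}
    {w : List (F2 n × ℤ)} (hw : nrm x + weight w < 2 ^ W) : ∀ (l : List (Fin D)) (t₀ : ℕ),
    l.map Fin.val = List.range' t₀ l.length →
    Ev (residC prog) (residC prog) (.cons (.cons (encNat k) (encList (w.map encEntry)))
      (.cons (encNat t₀) (encList (l.map fun t => sketchArray h t x))))
      (encList (l.map fun t => sketchArray h t (x - entryVec w)))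
      (l.length * (w.length * (1030 * W ^ 2) + 80 * W + 100) + 10) := by
  intro l
  induction l with
  | nil => intro t₀ _; exact (Ev.iteNil (.simple rfl) .nil).mono (by simp only [Code.cost]; omega)
  | cons t l ih =>
    intro t₀ hl
    rw [List.length_cons, List.range'_succ, List.map_cons, List.cons_eq_cons] at hl
    obtain ⟨rfl, hl⟩ := hl
    -- The entries of `w` are subtracted one by one.
    obtain ⟨s, hs, rfl⟩ := ev_fold (g := residEntryC prog) (env := .cons (encNat k) (encNat t))
      (encA := encEntry) (τ := 1000 * W ^ 2) (l := w) (s := sketchArray h t x)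
      (fun l₁ s => s = sketchArray h t (x - entryVec l₁)) (by simp [entryVec]) (by
        rintro l₁ q l₂ hq _ rfl
        refine ⟨_, ev_residEntry hn hr hH hW (hprog q.1 t)
          ((entryVec_prefix_bound hq).trans_lt hw), ?_⟩
        rw [entryVec_append, entryVec_singleton, sub_sub])
    have hinc := ev_natAdd W true t 0 (t.2.trans_le hD) (by positivity)
    rw [encNat_zero] at hinc
    refine Ev.mono (.iteCons (.simple rfl) (.cons (.call (.simple rfl) hs) (.recur (.cons
      (.simple rfl) (.cons (.call (.simple rfl) hinc) (.simple rfl))) (ih _ hl)))) ?_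
    have : w.length * (1000 * W ^ 2 + 30) ≤ w.length * (1030 * W ^ 2) :=
      Nat.mul_le_mul_left _ (by nlinarith)
    simp only [oneC, Code.cost, List.length_cons]
    linarith

/-- The sketches for all seeds. -/
def sketchArrays (h : F2 n → Fin D → F2 r) (e : F2 n → ℤ) : SExp :=
  encList ((List.finRange D).map fun t => sketchArray h t e)

theorem ev_resid (hn : n ≤ W) (hr : r ≤ W) (hH : H ≤ W) (hW : 0 < W) (hD : D ≤ 2 ^ W)
    (hprog : ComputesHash prog k H h) {x : F2 n → ℤ}
    {w : List (F2 n × ℤ)} (hw : nrm x + weight w < 2 ^ W) :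
    Ev (residC prog) (residC prog) (.cons (.cons (encNat k) (encList (w.map encEntry)))
      (.cons .nil (sketchArrays h x))) (sketchArrays h (x - entryVec w))
      (D * (w.length * (1030 * W ^ 2) + 80 * W + 100) + 10) := by
  have := ev_resid_aux hn hr hH hW hD hprog hw (List.finRange D) 0 (by
    rw [List.length_finRange, ← List.range_eq_range', List.map_coe_finRange_eq_range])
  rwa [encNat_zero, List.length_finRange] at this

/-! ### The norm of a sketch -/

/-- Adds the absolute value of the first measurement, on the argument `(_, sum, measurements)`. -/
def normLeafC : Code := call natAddC (.cons .nil (.cons x2 (.tl (.hd r2))))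

/-- Adds the norm of a sketch, on the argument `(depth, sum, sketch)`. -/
def normArrayC : Code :=
  call (foldC normLeafC) (.cons .nil (.cons x2 (call flattenC (.cons x1 (.cons r2 .nil)))))

theorem leaves_measure (e : F2 n → ℤ) (t : Fin D) :
    leaves r (fun b => encInts (measure (bucket h t b e))) =
      (allF2 r).map fun b => encInts (measure (bucket h t b e)) := by
  rw [leaves, List.filter_eq_self]
  intro a ha
  obtain ⟨b, -, rfl⟩ := List.mem_map.1 ha
  simpa using encInts_measure_ne_nil _

theorem ev_flatten_sketchArray (hr : r ≤ W) (hW : 0 < W) (e : F2 n → ℤ) (t : Fin D) :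
    Ev flattenC flattenC (.cons (encUnary r) (.cons (sketchArray h t e) .nil))
      (encList ((allF2 r).map fun b => encInts (measure (bucket h t b e)))) (240 * 2 ^ r * W) := by
  have := ev_flatten (fun b => encInts (measure (bucket h t b e))) []
  rw [List.append_nil, leaves_measure, ← encArray_eq_encTrie fun b => encInts_measure_ne_nil _,
    List.length_map, length_allF2] at this
  refine this.mono ?_
  have h1 := Nat.one_le_two_pow (n := r)
  have h2 : r * 2 ^ r ≤ W * 2 ^ r := Nat.mul_le_mul_right _ hr
  have h3 : 2 ^ r ≤ W * 2 ^ r := Nat.le_mul_of_pos_left _ hW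
  nlinarith

theorem sum_append_le {α : Type*} {l l₁ l₂ : List α} {a : α} (f : α → ℕ) (h : l = l₁ ++ a :: l₂) :
    (l₁.map f).sum + f a ≤ (l.map f).sum := by
  rw [h]; simp [← add_assoc]

theorem ev_normArray (hr : r ≤ W) (hW : 0 < W) (e : F2 n → ℤ) (t : Fin D) (m : ℕ)
    (hm : m + ∑ b, (∑ a, bucket h t b e a).natAbs < 2 ^ W) : Ev normArrayC normArrayC
      (.cons (encUnary r) (.cons (encNat m) (sketchArray h t e)))
      (encNat (m + ∑ b, (∑ a, bucket h t b e a).natAbs)) (450 * 2 ^ r * W) := by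
  rw [← sum_allF2] at hm ⊢
  obtain ⟨s, hs, rfl⟩ := ev_fold (g := normLeafC) (env := .nil)
    (encA := fun b => encInts (measure (bucket h t b e))) (τ := 80 * W + 50) (l := allF2 r)
    (s := encNat m) (fun l₁ s => s = encNat (m + (l₁.map fun b =>
      (∑ a, bucket h t b e a).natAbs).sum)) (by simp) (by
        rintro l₁ b l₂ hb _ rfl
        have h1 := sum_append_le (fun b => (∑ a, bucket h t b e a).natAbs) hb
        refine ⟨_, Ev.mono (.call (.simple rfl) (ev_natAdd W false
          (m + (l₁.map fun b => (∑ a, bucket h t b e a).natAbs).sum)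
          (∑ a, bucket h t b e a).natAbs (by omega) (by omega)))
          (by simp only [Code.cost]; omega), ?_⟩
        congr 1
        simp [add_assoc])
  refine Ev.mono (.call (.cons (.simple rfl) (.cons (.simple rfl) (.call (.simple rfl)
    (ev_flatten_sketchArray hr hW e t)))) hs) ?_
  rw [length_allF2]
  have h1 := Nat.one_le_two_pow (n := r)
  have h3 : 2 ^ r ≤ 2 ^ r * W := Nat.le_mul_of_pos_right _ hW
  have h4 : 2 ^ r * (80 * W + 50 + 30) ≤ 2 ^ r * (160 * W) := Nat.mul_le_mul_left _ (by omega)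
  simp only [Code.cost]
  nlinarith

/-- The norm of the sketches, on the argument `(depth, nil, sketches)`. -/
def normC : Code := foldC normArrayC

theorem natAbs_sketchNrm (e : F2 n → ℤ) :
    (sketchNrm h e).natAbs = ∑ t, ∑ b, (∑ a, bucket h t b e a).natAbs := by
  zify
  rw [abs_of_nonneg]
  · rfl
  · exact Finset.sum_nonneg fun _ _ => Finset.sum_nonneg fun _ _ => abs_nonneg _

theorem ev_norm (hr : r ≤ W) (hW : 0 < W) {e : F2 n → ℤ} (he : (sketchNrm h e).natAbs < 2 ^ W) :
    Ev normC normC (.cons (encUnary r) (.cons .nil (sketchArrays h e)))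
      (encNat (sketchNrm h e).natAbs) (500 * D * 2 ^ r * W + 10) := by
  have hsum : (sketchNrm h e).natAbs = ((List.finRange D).map fun t =>
      ∑ b, (∑ a, bucket h t b e a).natAbs).sum := by
    rw [natAbs_sketchNrm, ← List.sum_toFinset _ (List.nodup_finRange D), List.toFinset_finRange]
  rw [hsum] at he ⊢
  obtain ⟨s, hs, rfl⟩ := ev_fold (g := normArrayC) (env := encUnary r)
    (encA := fun t => sketchArray h t e) (τ := 450 * 2 ^ r * W) (l := List.finRange D)
    (s := .nil) (fun l₁ s => s = encNat ((l₁.map fun t =>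
      ∑ b, (∑ a, bucket h t b e a).natAbs).sum)) (by simp [encNat_zero]) (by
        rintro l₁ t l₂ ht _ rfl
        have h1 := sum_append_le (fun t => ∑ b, (∑ a, bucket h t b e a).natAbs) ht
        refine ⟨_, ev_normArray hr hW e t _ (h1.trans_lt he), ?_⟩
        simp)
  refine hs.mono ?_
  rw [List.length_finRange]
  have h1 := Nat.one_le_two_pow (n := r)
  have h3 : 1 ≤ 2 ^ r * W := Nat.mul_pos h1 hW
  have := Nat.mul_le_mul_left D (show 450 * 2 ^ r * W + 30 ≤ 500 * (2 ^ r * W) by linarith)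
  linarith

end SketchPrograms

/-! ### Programs for the correction of an estimate -/

section Candidate

variable {n D r : ℕ} {W : ℕ}

/-- A bit of the decoded position, on the argument `(-y, y')` for the sum `y` of a bucket and a
bit measurement `y'`. -/
def decodeBitC : Code :=
  call natLtC (.cons .nil (.cons (.tl (call intAddC (.cons r1 x1))) (.tl r1)))

/-- Reads an entry off from the measurements of a bucket, on the argument `(y, y')`, where `y` is
the sum of the bucket and `y'` the list of its bit measurements. -/
def decodeC : Code :=
  .cons (call (mapC decodeBitC) (.cons (call intNegC x1) r1)) x1

theorem ev_decode (hn : n ≤ W) (hW : 0 < W) {g : F2 n → ℤ} (hg : 2 * nrm g < 2 ^ W) :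
    Ev decodeC decodeC (encInts (measure g)) (encEntry (decodePos g, ∑ a, g a))
      (600 * W ^ 2) := by
  set y := ∑ a, g a
  have h0 := nrm_nonneg g
  have hy : |y| ≤ nrm g := abs_sum_le_nrm g
  have hbit : ∀ j ∈ List.finRange n, Ev decodeBitC decodeBitC
      (.cons (encInt (-y)) (encInt (∑ a, if a j = 1 then g a else 0)))
      (encBit (decide (decodePos g j = 1))) (240 * W + 170) := by
    intro j _
    set yj := ∑ a, if a j = 1 then g a else 0
    have hyj : |yj| ≤ nrm g := abs_bit_le_nrm g j
    have hs : |yj + -y| ≤ 2 * nrm g := (abs_add_le _ _).trans (by rw [abs_neg]; linarith)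
    have e1 := ev_intAdd (x := yj) (y := -y) (W := W) (natAbs_lt_two_pow (by linarith))
      (natAbs_lt_two_pow (by rw [abs_neg]; linarith))
    have e2 := ev_natLt (a := (yj + -y).natAbs) (b := yj.natAbs) (W := W)
      (natAbs_lt_two_pow (by linarith)) (natAbs_lt_two_pow (by linarith))
    refine Ev.cast (.call (.cons .nil (.cons (.tl (.call (.simple rfl) e1)) (.simple rfl))) e2) ?_
      (by simp only [Code.cost]; omega)
    have hiff : (yj + -y).natAbs < yj.natAbs ↔ decodePos g j = 1 := by
      rw [decodePos]
      zify
      rw [← sub_eq_add_neg]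
      by_cases h : |yj - y| < |yj|
      · simp [yj, y, h]
      · simp [yj, y, h]
    simp only [hiff]
  have hmap := ev_map hbit
  rw [List.length_finRange] at hmap
  have e1 : Ev decodeC r1 (encInts (measure g))
      (encList ((List.finRange n).map fun j => encInt (∑ a, if a j = 1 then g a else 0))) 2 := by
    refine Ev.cast (.simple rfl) ?_ le_rfl
    rw [← List.ofFn_eq_map]
    simp only [encInts, measure, List.map_cons, List.map_ofFn, encList]
    rfl
  have e2 : Ev decodeC x1 (encInts (measure g)) (encInt y) 2 := .simple rfl
  have e3 := Ev.cons (.call (.cons (.call e2 (ev_intNeg y)) e1) hmap) e2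
  refine e3.cast ?_ ?_
  · rw [← List.ofFn_eq_map]
    rfl
  · have h2 : n * (240 * W + 170 + 30) ≤ W * (440 * W) := Nat.mul_le_mul hn (by omega)
    have h3 : W ≤ W ^ 2 := Nat.le_self_pow (by norm_num) W
    have h4 : W * (440 * W) = 440 * W ^ 2 := by ring
    omega

/-- Adds an entry to an entry or an empty leaf of a trie, on the argument `(entry, leaf)`. -/
def addLeafC : Code := .ite r1 x1 (.cons (.hd x1) (call intAddC (.cons (.tl x1) (.tl r1))))

/-- Adds an entry to a sparse vector in the form of a trie, on the argument
`(_, trie, entry)`. -/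
def insertC : Code := call (updC addLeafC) (.cons (.hd r2) (.cons r2 x2))

/-- Adds the entry decoded from the measurements of a bucket to a sparse vector, on the
argument `(_, trie, measurements)`. -/
def insertDecodedC : Code := call insertC (.cons .nil (.cons x2 (call decodeC r2)))

/-- The leaves of the trie of a vector `z` that vanishes outside of `K`. -/
def trieLeaf (K : Finset (F2 n)) (z : F2 n → ℤ) (b : F2 n) : SExp :=
  if b ∈ K then encEntry (b, z b) else .nil

theorem encEntry_ne_nil (q : F2 n × ℤ) : encEntry q ≠ .nil := by simp [encEntry]

theorem ev_insert (hn : n ≤ W) (hW : 0 < W) {K : Finset (F2 n)} {z : F2 n → ℤ}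
    (hz : ∀ b ∉ K, z b = 0) {q : F2 n × ℤ} (hb : nrm z + |q.2| < 2 ^ W) (env : SExp) :
    Ev insertC insertC (.cons env (.cons (encTrie n (trieLeaf K z)) (encEntry q)))
      (encTrie n (trieLeaf (insert q.1 K) (z + Pi.single q.1 q.2))) (500 * W) := by
  have h0 := nrm_nonneg z
  have h1 := abs_le_nrm z q.1
  have h2 := abs_nonneg q.2
  have hleaf : Ev addLeafC addLeafC (.cons (encEntry q) (trieLeaf K z q.1))
      (encEntry (q.1, (z + Pi.single q.1 q.2 : F2 n → ℤ) q.1)) (200 * W + 160) := by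
    rw [Pi.add_apply, Pi.single_eq_same]
    by_cases hK : q.1 ∈ K
    · rw [trieLeaf, if_pos hK, add_comm]
      exact Ev.mono (.iteCons (.simple rfl) (.cons (.simple rfl) (.call (.simple rfl)
        (ev_intAdd (W := W) (natAbs_lt_two_pow (by linarith)) (natAbs_lt_two_pow (by linarith))))))
        (by simp only [Code.cost]; omega)
    · rw [trieLeaf, if_neg hK, hz _ hK, zero_add]
      exact Ev.mono (.iteNil (.simple rfl) (.simple rfl)) (by simp only [Code.cost]; omega)
  have hupd := ev_upd (f := trieLeaf K z) (b := q.1) (encEntry_ne_nil _) hleaf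
  have hfun : Function.update (trieLeaf K z) q.1 (encEntry
      (q.1, (z + Pi.single q.1 q.2 : F2 n → ℤ) q.1)) =
      trieLeaf (insert q.1 K) (z + Pi.single q.1 q.2) := by
    funext b
    by_cases hb : b = q.1
    · subst hb; simp [trieLeaf]
    · simp [trieLeaf, hb]
  rw [hfun] at hupd
  exact Ev.mono (.call (.simple rfl) hupd) (by simp only [Code.cost]; omega)

/-- The invariant of the insertion of entries into a trie. -/
def IsTrieOf (l : List (F2 n × ℤ)) (s : SExp) : Prop :=
  ∃ K : Finset (F2 n), s = encTrie n (trieLeaf K (entryVec l)) ∧ (∀ b ∉ K, entryVec l b = 0) ∧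
    K.card ≤ l.length

theorem isTrieOf_nil : IsTrieOf ([] : List (F2 n × ℤ)) .nil := by
  refine ⟨∅, ?_, by simp [entryVec], by simp⟩
  have : trieLeaf (∅ : Finset (F2 n)) (entryVec []) = fun _ => .nil := by
    funext b; simp [trieLeaf]
  rw [this, encTrie_nil]

theorem IsTrieOf.ev_insert (hn : n ≤ W) (hW : 0 < W) {l : List (F2 n × ℤ)} {s : SExp}
    (hs : IsTrieOf l s) {q : F2 n × ℤ} (hb : weight (l ++ [q]) < 2 ^ W) (env : SExp) :
    ∃ s', Ev insertC insertC (.cons env (.cons s (encEntry q))) s' (500 * W) ∧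
      IsTrieOf (l ++ [q]) s' := by
  obtain ⟨K, rfl, hK, hc⟩ := hs
  rw [weight_append, weight_singleton] at hb
  have h1 := nrm_entryVec_le l
  refine ⟨_, SparseRecovery.ev_insert hn hW hK (by linarith) env, insert q.1 K, ?_, ?_, ?_⟩
  · rw [entryVec_append, entryVec_singleton]
  · intro b hb
    rw [Finset.mem_insert, not_or] at hb
    rw [entryVec_append, entryVec_singleton]
    simp [hK b hb.2, hb.1]
  · refine (Finset.card_insert_le _ _).trans ?_
    simpa using hc

/-- The entries of a trie. -/
def trieEntries (K : Finset (F2 n)) (z : F2 n → ℤ) : List (F2 n × ℤ) :=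
  ((allF2 n).filter (· ∈ K)).map fun b => (b, z b)

theorem leaves_trieLeaf (K : Finset (F2 n)) (z : F2 n → ℤ) :
    leaves n (trieLeaf K z) = (trieEntries K z).map encEntry := by
  rw [leaves, trieEntries, List.filter_map, List.map_map]
  have h1 : ∀ b, b ∈ K ↔ trieLeaf K z b ≠ .nil := fun b => by
    by_cases hb : b ∈ K <;> simp [trieLeaf, hb, encEntry]
  rw [List.filter_congr (q := fun b => decide (b ∈ K)) (fun b _ => ?_)]
  · refine List.map_congr_left fun b hb => ?_
    have : b ∈ K := by simpa using (List.mem_filter.1 hb).2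
    simp [trieLeaf, this]
  · simp only [Function.comp_apply, decide_eq_decide]
    exact (h1 b).symm

theorem length_trieEntries (K : Finset (F2 n)) (z : F2 n → ℤ) :
    (trieEntries K z).length = K.card := by
  rw [trieEntries, List.length_map, ← List.toFinset_card_of_nodup ((nodup_allF2 n).filter _)]
  congr 1
  ext b
  simp [mem_allF2]

/-- The list `w` holds at most `k` entries of `z`, and approximates `z` within a factor of `2` as
well as any restriction of `z` to `k` positions. -/
structure IsTop (k : ℕ) (z : F2 n → ℤ) (w : List (F2 n × ℤ)) : Prop where
  nodup : (w.map Prod.fst).Nodup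
  eq : ∀ q ∈ w, q.2 = z q.1
  length_le : w.length ≤ k
  nrm_le : ∀ S : Finset (F2 n), S.card ≤ k →
    nrm (z - entryVec w) ≤ 2 * nrm (z - restrict S z)

theorem entryVec_eq_restrict {z : F2 n → ℤ} {w : List (F2 n × ℤ)} (h : (w.map Prod.fst).Nodup)
    (hz : ∀ q ∈ w, q.2 = z q.1) : entryVec w = restrict (w.map Prod.fst).toFinset z := by
  induction w with
  | nil => funext a; simp [entryVec, restrict]
  | cons q w ih =>
    rw [List.map_cons, List.nodup_cons] at h
    have h1 : entryVec (q :: w) = entryVec [q] + entryVec w := entryVec_append [q] w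
    rw [h1, entryVec_singleton, ih h.2 fun p hp => hz p (by simp [hp]), hz q (by simp)]
    funext a
    by_cases ha : a = q.1
    · subst ha
      have h2 : q.1 ∉ (w.map Prod.fst).toFinset := by simpa using h.1
      simp only [Pi.add_apply, Pi.single_eq_same, restrict, if_neg h2, add_zero]
      simp
    · simp only [Pi.add_apply, Pi.single_eq_of_ne ha, zero_add, restrict, List.mem_toFinset,
        List.map_cons, List.mem_cons, ha, false_or]

theorem weight_le_nrm {z : F2 n → ℤ} {w : List (F2 n × ℤ)} (h : (w.map Prod.fst).Nodup)
    (hz : ∀ q ∈ w, q.2 = z q.1) : weight w ≤ nrm z := by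
  have h1 : weight w = ((w.map Prod.fst).map fun a => |z a|).sum := by
    rw [weight, List.map_map]
    congr 1
    exact List.map_congr_left fun q hq => by simp [hz q hq]
  rw [h1, ← List.sum_toFinset _ h]
  exact Finset.sum_le_univ_sum_of_nonneg fun a => abs_nonneg _

/-- The first `k` entries in an order by decreasing bit length are largest up to a factor of `2`. -/
theorem isTop_take {k : ℕ} {K : Finset (F2 n)} {z : F2 n → ℤ} (hz : ∀ b ∉ K, z b = 0)
    {out : List (ℕ × (F2 n × ℤ))}
    (hperm : out.Perm ((trieEntries K z).map fun q => (q.2.natAbs, q)))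
    (hsort : out.Pairwise fun a b => ∀ i, 2 ^ i ≤ b.1 → 2 ^ i ≤ a.1) :
    IsTop k z ((out.map Prod.snd).take k) := by
  have hmem : ∀ p ∈ out, p = ((z p.2.1).natAbs, (p.2.1, z p.2.1)) := by
    intro p hp
    have := hperm.mem_iff.1 hp
    simp only [trieEntries, List.mem_map] at this
    obtain ⟨_, ⟨b, -, rfl⟩, rfl⟩ := this
    rfl
  have hkeys : ((out.map Prod.snd).map Prod.fst).Nodup := by
    have h1 := (hperm.map Prod.snd).map Prod.fst
    rw [h1.nodup_iff]
    simp only [trieEntries, List.map_map, Function.comp_def, List.map_id']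
    exact (nodup_allF2 n).filter _
  have hkeys' : ((((out.map Prod.snd).take k)).map Prod.fst).Nodup := by
    rw [List.map_take]
    exact hkeys.sublist (List.take_sublist _ _)
  have heq : ∀ q ∈ (out.map Prod.snd).take k, q.2 = z q.1 := by
    intro q hq
    obtain ⟨p, hp, rfl⟩ := List.mem_map.1 (List.mem_of_mem_take hq)
    rw [hmem p hp]
  have hK : ∀ b ∈ K, ∃ p ∈ out, p.2.1 = b := by
    intro b hb
    refine ⟨((z b).natAbs, (b, z b)), hperm.mem_iff.2 ?_, rfl⟩
    simp [trieEntries, mem_allF2, hb]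
  refine ⟨hkeys', heq, List.length_take_le _ _, fun S hS => ?_⟩
  rw [entryVec_eq_restrict hkeys' heq]
  set A := (((out.map Prod.snd).take k).map Prod.fst).toFinset with hA
  by_cases hk : k ≤ out.length
  · refine nrm_sub_restrict_le ?_ ?_
    -- Numbers of the same bit length differ by at most a factor of `2`.
    · intro i hi j hj
      by_cases hjK : j ∈ K
      · obtain ⟨p, hp, rfl⟩ := hK j hjK
        obtain ⟨q, hq, rfl⟩ : ∃ q ∈ out.take k, q.2.1 = i := by
          rw [hA, List.mem_toFinset, ← List.map_take, List.map_map] at hi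
          exact List.mem_map.1 hi
        have hpd : p ∈ out.drop k := by
          rw [← List.take_append_drop k out, List.mem_append] at hp
          refine hp.resolve_left fun h => hj ?_
          rw [hA, List.mem_toFinset, ← List.map_take, List.map_map]
          exact List.mem_map.2 ⟨p, h, rfl⟩
        rw [← List.take_append_drop k out, List.pairwise_append] at hsort
        have h1 := hsort.2.2 q hq p hpd
        rw [hmem p hp, hmem q (List.mem_of_mem_take hq)] at h1
        simp only at h1
        by_cases h0 : z p.2.1 = 0
        · rw [h0, abs_zero]; positivity
        · have h2 := h1 _ (Nat.pow_log_le_self 2 (Int.natAbs_ne_zero.2 h0))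
          have h3 := Nat.lt_pow_succ_log_self (b := 2) (by norm_num) (z p.2.1).natAbs
          rw [pow_succ] at h3
          have h4 : (z p.2.1).natAbs ≤ 2 * (z q.2.1).natAbs := by omega
          zify at h4
          exact h4
      · rw [hz j hjK, abs_zero]; positivity
    · rw [hA, List.toFinset_card_of_nodup hkeys']
      simpa [hk] using hS
  -- With fewer than `k` entries in the trie, nothing is cut off.
  · have h1 : z - restrict A z = 0 := by
      funext a
      by_cases ha : a ∈ A
      · simp [restrict, ha]
      · have haK : a ∉ K := fun haK => ha <| by
          obtain ⟨p, hp, rfl⟩ := hK a haK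
          rw [hA, List.take_of_length_le (by rw [List.length_map]; omega), List.mem_toFinset]
          simp only [List.map_map, List.mem_map]
          exact ⟨p, hp, rfl⟩
        simp [restrict, ha, hz a haK]
    rw [h1, nrm_zero]
    linarith [nrm_nonneg (z - restrict S z)]

/-- Attaches the absolute value of an entry as a key, on the argument `(_, entry)`. -/
def attachC : Code := .cons (.tl (.tl r1)) r1

/-- The entry decoded from the bucket `b` of the seed `t`: the sum of the bucket, at the decoded
position. -/
def decoded (h : F2 n → Fin D → F2 r) (t : Fin D) (e : F2 n → ℤ) (b : F2 r) : F2 n × ℤ :=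
  (decodePos (bucket h t b e), ∑ a, bucket h t b e a)

theorem entryVec_decoded (h : F2 n → Fin D → F2 r) (t : Fin D) (e : F2 n → ℤ) :
    entryVec ((allF2 r).map (decoded h t e)) = correction h t e := by
  rw [entryVec, List.map_map, correction, ← sum_allF2]
  rfl

theorem weight_decoded_le (h : F2 n → Fin D → F2 r) (t : Fin D) (e : F2 n → ℤ) :
    weight ((allF2 r).map (decoded h t e)) ≤ nrm e := by
  rw [weight, List.map_map, sum_allF2, ← sum_nrm_bucket h t]
  exact Finset.sum_le_sum fun b _ => abs_sum_le_nrm _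

/-- The corrected and truncated estimate for one seed, on the argument
`((n, r, k), estimate, sketch)`, where the numbers are in unary. -/
def candidateC : Code :=
  let old := call (foldC insertC) (.cons .nil (.cons .nil x2))
  let new := call (foldC insertDecodedC) (.cons .nil (.cons old
    (call flattenC (.cons (.hd (.tl x1)) (.cons r2 .nil)))))
  let entries := call flattenC (.cons (.hd x1) (.cons new .nil))
  call takeC (.cons (.tl (.tl x1))
    (call sortC (.cons (call (mapC attachC) (.cons .nil entries)) .nil)))

theorem ev_candidate {h : F2 n → Fin D → F2 r} (hn : n ≤ W) (hr : r ≤ W) (hW : 0 < W)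
    (t : Fin D) {e : F2 n → ℤ} {w : List (F2 n × ℤ)} (k : ℕ) (hw : w.length ≤ 2 * 2 ^ r)
    (hb : weight w + 2 * nrm e < 2 ^ W) :
    ∃ w' : List (F2 n × ℤ), Ev candidateC candidateC
      (.cons (.cons (encUnary n) (.cons (encUnary r) (encUnary k)))
        (.cons (encList (w.map encEntry)) (sketchArray h t e)))
      (encList (w'.map encEntry)) (5000 * (2 ^ r * W ^ 2)) ∧
      IsTop k (entryVec w + correction h t e) w' ∧ weight w' ≤ weight w + nrm e := by
  have he0 := nrm_nonneg e
  have hd0 := weight_decoded_le h t e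
  -- A trie with the entries of the old estimate.
  obtain ⟨s₁, hs₁, hT₁⟩ := ev_fold (g := insertC) (env := .nil) (encA := encEntry)
    (τ := 500 * W) (l := w) (s := .nil) IsTrieOf isTrieOf_nil (by
      intro l₁ q l₂ hl s hs
      refine hs.ev_insert hn hW ?_ _
      have : weight w = weight (l₁ ++ [q]) + weight l₂ := by
        rw [← weight_append, hl]; simp
      linarith [weight_nonneg l₂])
  -- The entries decoded from the buckets are added to those at the same positions.
  obtain ⟨s₂, hs₂, hT₂⟩ := ev_fold (g := insertDecodedC) (env := .nil)
    (encA := fun b => encInts (measure (bucket h t b e)))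
    (τ := 1200 * W ^ 2) (l := allF2 r) (s := s₁)
    (fun l₁ s => IsTrieOf (w ++ l₁.map (decoded h t e)) s) (by simpa using hT₁) (by
      intro l₁ b l₂ hl s hs
      have h1 : weight (w ++ l₁.map (decoded h t e) ++ [decoded h t e b]) < 2 ^ W := by
        have : weight ((allF2 r).map (decoded h t e)) = weight (l₁.map (decoded h t e)) +
            weight [decoded h t e b] + weight (l₂.map (decoded h t e)) := by
          rw [← weight_append, ← weight_append, hl]; simp
        rw [weight_append, weight_append]
        linarith [weight_nonneg (l₂.map (decoded h t e))]
      obtain ⟨s', hs', hT'⟩ := hs.ev_insert hn hW h1 .nil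
      have h2 := nrm_bucket_le h t b e
      refine ⟨s', Ev.mono (.call (.cons (.simple rfl) (.cons (.simple rfl) (.call (.simple rfl)
        (ev_decode hn hW (g := bucket h t b e) (by linarith [weight_nonneg w]))))) hs') ?_,
        by simpa using hT'⟩
      have h3 : W ≤ W ^ 2 := Nat.le_self_pow (by norm_num) W
      simp only [Code.cost]
      omega)
  obtain ⟨K, rfl, hK, hc⟩ := hT₂
  rw [entryVec_append, entryVec_decoded] at hs₂ hK
  set z := entryVec w + correction h t e with hz
  have hzn : nrm z ≤ weight w + nrm e := by
    have h1 := nrm_entryVec_le ((allF2 r).map (decoded h t e))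
    rw [entryVec_decoded] at h1
    exact (nrm_add_le _ _).trans (add_le_add (nrm_entryVec_le w) (h1.trans hd0))
  have hc' : K.card ≤ 3 * 2 ^ r := by
    rw [List.length_append, List.length_map, length_allF2] at hc
    omega
  -- The entries are listed, sorted by the bit lengths of their values, and truncated.
  have hfl := ev_flatten (trieLeaf K z) []
  rw [List.append_nil, leaves_trieLeaf, List.length_map, length_trieEntries] at hfl
  have hat := ev_map (g := attachC) (env := .nil) (encA := encEntry) (τ := 10)
    (G := fun q => encItem encEntry 0 (q.2.natAbs, q)) (l := trieEntries K z)
    (fun q _ => (Ev.simple rfl).cast (by simp [encItem, encEntry]; rfl) (by decide))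
  have hcomp : (trieEntries K z).map (fun q => encItem encEntry 0 (q.2.natAbs, q)) =
      ((trieEntries K z).map fun q => (q.2.natAbs, q)).map (encItem encEntry 0) := by
    simp
  rw [hcomp, length_trieEntries] at hat
  obtain ⟨out, hout, hperm, hsort⟩ := ev_sort encEntry (W + 1) 0
    ((trieEntries K z).map fun q => (q.2.natAbs, q)) [] (by
      intro p hp
      simp only [trieEntries, List.map_map, List.mem_map] at hp
      obtain ⟨b, -, rfl⟩ := hp
      have h1 : (z b).natAbs < 2 ^ W :=
        natAbs_lt_two_pow ((abs_le_nrm z b).trans_lt (by linarith))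
      rw [zero_add, pow_succ]
      simp only [Function.comp_apply]
      omega) (by simp)
  rw [List.append_nil, List.length_map, length_trieEntries] at hout
  have htop : IsTop k z ((out.map Prod.snd).take k) := isTop_take hK hperm hsort
  refine ⟨_, ?_, htop, (weight_le_nrm htop.nodup htop.eq).trans hzn⟩
  have hlen : out.length = K.card := by
    rw [hperm.length_eq, List.length_map, length_trieEntries]
  refine Ev.cast (.call (.cons (.simple rfl) (.call (.cons (.call (.cons .nil (.call (.cons
    (.simple rfl) (.cons (.call (.cons .nil (.cons (.call (.simple rfl) hs₁) (.call (.simple rfl)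
    (ev_flatten_sketchArray hr hW e t)))) hs₂) .nil)) hfl)) hat) .nil) hout)) (ev_take k _)) ?_ ?_
  · rw [List.map_take, List.map_map]
    rfl
  · have h1 := Nat.one_le_two_pow (n := r)
    rw [length_allF2, List.length_map, hlen]
    set Q := 2 ^ r
    have hW2 : W ≤ W ^ 2 := Nat.le_self_pow (by norm_num) W
    have b1 : w.length * (500 * W + 30) ≤ 2 * Q * (530 * W ^ 2) := Nat.mul_le_mul hw (by omega)
    have b2 : Q * (1200 * W ^ 2 + 30) ≤ Q * (1230 * W ^ 2) := Nat.mul_le_mul_left _ (by omega)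
    have b3 : 240 * Q * W ≤ 240 * Q * W ^ 2 := Nat.mul_le_mul_left _ hW2
    have b4 : 2 * n * K.card ≤ 2 * W ^ 2 * (3 * Q) := Nat.mul_le_mul (by omega) hc'
    have b5 : (W + 1) * (K.card * 50 + 50) ≤ 2 * W ^ 2 * (200 * Q) :=
      Nat.mul_le_mul (by omega) (by omega)
    have b6 : Q ≤ Q * W ^ 2 := Nat.le_mul_of_pos_right _ (by omega)
    simp only [Code.cost]
    linarith

end Candidate

/-! ### The recovery program -/

section Recovery

variable {n D r k H W : ℕ} {h : F2 n → Fin D → F2 r} {prog : Code}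

/-- The better one of two estimates that come with the norms of their residual sketches, on the
argument `(best, new)`, where `best` may be `nil`. -/
def betterC : Code :=
  .ite x1 r1 (.ite (call natLtC (.cons .nil (.cons (.hd r1) (.hd x1)))) x1 r1)

/-- Compares a new estimate with the best one so far, on the argument `(env, best, new)`. -/
def compareC (prog : Code) : Code :=
  call betterC (.cons x2 (.cons (call normC (.cons (.hd (.tl x1)) (.cons .nil
    (call (residC prog) (.cons (.cons (.hd (.tl (.tl (.tl x1)))) r2)
      (.cons .nil (.tl (.tl (.tl (.tl x1)))))))))) r2))

/-- Tries the seed that belongs to a sketch, on the argument `((env, estimate), best, sketch)`. -/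
def trySeedC (prog : Code) : Code :=
  call (compareC prog) (.cons (.hd x1) (.cons x2 (call candidateC
    (.cons (.cons (.hd (.hd x1)) (.cons (.hd (.tl (.hd x1))) (.hd (.tl (.tl (.hd x1))))))
      (.cons (.tl x1) r2)))))

/-- One step of the iteration, on the argument `(env, estimate)`. -/
def stepC (prog : Code) : Code :=
  .tl (call (foldC (trySeedC prog)) (.cons .arg (.cons .nil (call (residC prog)
    (.cons (.cons (.hd (.tl (.tl (.tl x1)))) r1) (.cons .nil (.tl (.tl (.tl (.tl x1))))))))))

/-- The data used by all steps: the dimensions and `k` in unary, `k` in binary, and the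
sketches. -/
def encEnv (k : ℕ) (h : F2 n → Fin D → F2 r) (x : F2 n → ℤ) : SExp :=
  .cons (encUnary n) (.cons (encUnary r) (.cons (encUnary k) (.cons (encNat k)
    (sketchArrays h x))))

theorem ev_resid_le (hn : n ≤ W) (hr : r ≤ W) (hH : H ≤ W) (hW : 0 < W) (hD : 0 < D)
    (hD' : D ≤ 2 ^ W) (hprog : ComputesHash prog k H h) {x : F2 n → ℤ}
    {w : List (F2 n × ℤ)} (hw : nrm x + weight w < 2 ^ W) (hl : w.length ≤ 2 * 2 ^ r) :
    Ev (residC prog) (residC prog) (.cons (.cons (encNat k) (encList (w.map encEntry)))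
      (.cons .nil (sketchArrays h x))) (sketchArrays h (x - entryVec w))
      (2300 * (D * 2 ^ r * W ^ 2)) := by
  refine (ev_resid hn hr hH hW hD' hprog hw).mono ?_
  have h1 := Nat.one_le_two_pow (n := r)
  set Q := 2 ^ r
  have h2 : W ≤ W ^ 2 := Nat.le_self_pow (by norm_num) W
  have h3 : w.length * (1030 * W ^ 2) ≤ 2 * Q * (1030 * W ^ 2) := Nat.mul_le_mul_right _ hl
  have h4 : W ^ 2 ≤ Q * W ^ 2 := Nat.le_mul_of_pos_left _ (by omega)
  have h5 : D * (w.length * (1030 * W ^ 2) + 80 * W + 100) ≤ D * (2240 * (Q * W ^ 2)) :=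
    Nat.mul_le_mul_left _ (by linarith)
  have h6 : 1 ≤ D * (Q * W ^ 2) := Nat.mul_pos hD (by omega)
  linarith

theorem ev_norm_le (hr : r ≤ W) (hW : 0 < W) (hD : 0 < D) {e : F2 n → ℤ}
    (he : (sketchNrm h e).natAbs < 2 ^ W) :
    Ev normC normC (.cons (encUnary r) (.cons .nil (sketchArrays h e)))
      (encNat (sketchNrm h e).natAbs) (510 * (D * 2 ^ r * W ^ 2)) := by
  refine (ev_norm hr hW he).mono ?_
  have h1 := Nat.one_le_two_pow (n := r)
  have h2 : W ≤ W ^ 2 := Nat.le_self_pow (by norm_num) W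
  have h3 : D * 2 ^ r * W ≤ D * 2 ^ r * W ^ 2 := Nat.mul_le_mul_left _ h2
  have h4 : 1 ≤ D * 2 ^ r * W ^ 2 := Nat.mul_pos (Nat.mul_pos hD (by omega)) (by omega)
  linarith

/-- The encoding of an estimate together with the norm of its residual sketch. -/
def encScored (h : F2 n → Fin D → F2 r) (x : F2 n → ℤ) (w : List (F2 n × ℤ)) : SExp :=
  .cons (encNat (sketchNrm h (x - entryVec w)).natAbs) (encList (w.map encEntry))

theorem natAbs_sketchNrm_sub_lt (hD : 0 < D) {x : F2 n → ℤ} {w : List (F2 n × ℤ)}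
    (hb : D * (nrm x + weight w) < 2 ^ W) :
    (sketchNrm h (x - entryVec w)).natAbs < 2 ^ W ∧ nrm x + weight w < 2 ^ W := by
  have h0 := nrm_nonneg x
  have h1 := weight_nonneg w
  have hD' : (1 : ℤ) ≤ D := by exact_mod_cast hD
  constructor
  · refine natAbs_lt_two_pow (lt_of_le_of_lt ?_ hb)
    rw [abs_of_nonneg (Finset.sum_nonneg fun _ _ => Finset.sum_nonneg fun _ _ => abs_nonneg _)]
    refine (sketchNrm_le _).trans (mul_le_mul_of_nonneg_left ?_ (by positivity))
    have h2 := nrm_sub_le x 0 (entryVec w)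
    rw [sub_zero, zero_sub, nrm_neg] at h2
    linarith [nrm_entryVec_le w]
  · exact lt_of_le_of_lt (le_mul_of_one_le_left (by linarith) hD') hb

theorem ev_compare (hn : n ≤ W) (hr : r ≤ W) (hH : H ≤ W) (hW : 0 < W) (hD : 0 < D)
    (hD' : D ≤ 2 ^ W) (hprog : ComputesHash prog k H h) {x : F2 n → ℤ}
    {w : List (F2 n × ℤ)} (hw : D * (nrm x + weight w) < 2 ^ W) (hl : w.length ≤ 2 * 2 ^ r)
    {best v : SExp} (hv : Ev betterC betterC (.cons best (encScored h x w)) v (40 * W + 50)) :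
    Ev (compareC prog) (compareC prog) (.cons (encEnv k h x) (.cons best
      (encList (w.map encEntry)))) v (2950 * (D * 2 ^ r * W ^ 2)) := by
  obtain ⟨h1, h2⟩ := natAbs_sketchNrm_sub_lt (h := h) hD hw
  refine Ev.mono (.call (.cons (.simple rfl) (.cons (.call (.cons (.simple rfl) (.cons .nil
    (.call (.simple rfl) (ev_resid_le hn hr hH hW hD hD' hprog h2 hl))))
    (ev_norm_le hr hW hD h1)) (.simple rfl))) hv) ?_
  have h3 : W ≤ W ^ 2 := Nat.le_self_pow (by norm_num) W
  have h4 : W ^ 2 ≤ D * 2 ^ r * W ^ 2 := Nat.le_mul_of_pos_left _ (Nat.mul_pos hD (by positivity))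
  simp only [Code.cost]
  omega

/-- The outcome of a step: the best one, judged by the sketch, of the candidates for the
different seeds. The bound for its weight keeps the numbers short for as many steps as
needed. -/
def IsStep (k : ℕ) (h : F2 n → Fin D → F2 r) (x : F2 n → ℤ) (w w' : List (F2 n × ℤ)) : Prop :=
  ∃ cand : Fin D → List (F2 n × ℤ),
    (∀ t, IsTop k (entryVec w + correction h t (x - entryVec w)) (cand t)) ∧
    (∃ t, w' = cand t) ∧
    (∀ t, sketchNrm h (x - entryVec w') ≤ sketchNrm h (x - entryVec (cand t))) ∧
    weight w' ≤ 2 * weight w + nrm x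

theorem ev_step (hn : n ≤ W) (hr : r ≤ W) (hH : H ≤ W) (hW : 0 < W) (hD : 0 < D)
    (hD' : D ≤ 2 ^ W) (hk : k ≤ 2 * 2 ^ r) (hprog : ComputesHash prog k H h) {x : F2 n → ℤ}
    {w : List (F2 n × ℤ)} (hb : D * (3 * weight w + 2 * nrm x) < 2 ^ W) (hl : w.length ≤ k) :
    ∃ w', Ev (stepC prog) (stepC prog) (.cons (encEnv k h x) (encList (w.map encEntry)))
      (encList (w'.map encEntry)) (11000 * (D * (D * 2 ^ r * W ^ 2))) ∧ IsStep k h x w w' := by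
  have h0 := nrm_nonneg x
  have h1 := weight_nonneg w
  have hD1 : (1 : ℤ) ≤ D := by exact_mod_cast hD
  have hb1 : 3 * weight w + 2 * nrm x < 2 ^ W :=
    lt_of_le_of_lt (le_mul_of_one_le_left (by linarith) hD1) hb
  have he : nrm (x - entryVec w) ≤ nrm x + weight w := by
    have h2 := nrm_sub_le x 0 (entryVec w)
    rw [sub_zero, zero_sub, nrm_neg] at h2
    linarith [nrm_entryVec_le w]
  choose cand hcand htop hweight using fun t => ev_candidate hn hr hW t (h := h)
    (e := x - entryVec w) (w := w) k (hl.trans hk) (by linarith)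
  have hwc : ∀ t, weight (cand t) ≤ 2 * weight w + nrm x := fun t => by linarith [hweight t]
  have hbc : ∀ t, D * (nrm x + weight (cand t)) < 2 ^ W := fun t =>
    lt_of_le_of_lt (mul_le_mul_of_nonneg_left (by linarith [hwc t]) (by positivity)) hb
  set score : Fin D → ℕ := fun t => (sketchNrm h (x - entryVec (cand t))).natAbs with hscore
  have hR : W ^ 2 ≤ D * 2 ^ r * W ^ 2 :=
    Nat.le_mul_of_pos_left _ (Nat.mul_pos hD (by positivity))
  have hR1 : W ≤ W ^ 2 := Nat.le_self_pow (by norm_num) W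
  have htry : ∀ (t : Fin D) (best v : SExp),
      Ev betterC betterC (.cons best (encScored h x (cand t))) v (40 * W + 50) →
      Ev (trySeedC prog) (trySeedC prog) (.cons (.cons (encEnv k h x) (encList (w.map encEntry)))
        (.cons best (sketchArray h t (x - entryVec w)))) v (8000 * (D * 2 ^ r * W ^ 2)) := by
    intro t best v hv
    refine Ev.mono (.call (.cons (.simple rfl) (.cons (.simple rfl) (.call (.simple rfl)
      (hcand t)))) (ev_compare hn hr hH hW hD hD' hprog (hbc t)
      ((htop t).length_le.trans hk) hv)) ?_
    have : 2 ^ r * W ^ 2 ≤ D * (2 ^ r * W ^ 2) := Nat.le_mul_of_pos_left _ hD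
    rw [← mul_assoc] at this
    simp only [Code.cost]
    omega
  -- The accumulator is the best candidate for the seeds so far, and `nil` before the first one.
  obtain ⟨s, hs, hP⟩ := ev_fold (g := trySeedC prog)
    (env := .cons (encEnv k h x) (encList (w.map encEntry)))
    (encA := fun t => sketchArray h t (x - entryVec w)) (τ := 8000 * (D * 2 ^ r * W ^ 2))
    (l := List.finRange D) (s := .nil)
    (fun l₁ s => (l₁ = [] ∧ s = .nil) ∨ ∃ t ∈ l₁, s = encScored h x (cand t) ∧
      ∀ t' ∈ l₁, score t ≤ score t') (Or.inl ⟨rfl, rfl⟩) (by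
      rintro l₁ t l₂ - s (⟨rfl, rfl⟩ | ⟨t', ht', rfl, hmin⟩)
      · refine ⟨encScored h x (cand t), htry t _ _ ((Ev.iteNil (.simple rfl) (.simple rfl)).mono
          (by simp only [Code.cost]; omega)), Or.inr ⟨t, by simp, rfl, by simp⟩⟩
      · have hlt := ev_natLt (natAbs_sketchNrm_sub_lt (h := h) hD (hbc t)).1
          (natAbs_sketchNrm_sub_lt (h := h) hD (hbc t')).1
        by_cases hc : score t < score t'
        · rw [show decide _ = true from decide_eq_true hc] at hlt
          refine ⟨encScored h x (cand t), htry t _ _ (Ev.mono (.iteCons (.simple rfl)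
            (.iteCons (.call (.simple rfl) hlt) (.simple rfl)))
            (by simp only [Code.cost]; omega)), Or.inr ⟨t, by simp, rfl, ?_⟩⟩
          intro t'' ht''
          rcases List.mem_append.1 ht'' with h | h
          · exact hc.le.trans (hmin t'' h)
          · rw [List.mem_singleton.1 h]
        · rw [show decide _ = false from decide_eq_false hc] at hlt
          refine ⟨encScored h x (cand t'), htry t _ _ (Ev.mono (.iteCons (.simple rfl)
            (.iteNil (.call (.simple rfl) hlt) (.simple rfl)))
            (by simp only [Code.cost]; omega)), Or.inr ⟨t', by simp [ht'], rfl, ?_⟩⟩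
          intro t'' ht''
          rcases List.mem_append.1 ht'' with h | h
          · exact hmin t'' h
          · rw [List.mem_singleton.1 h]
            exact not_lt.1 hc)
  obtain ⟨t, -, rfl, hmin⟩ : ∃ t ∈ List.finRange D, s = encScored h x (cand t) ∧
      ∀ t' ∈ List.finRange D, score t ≤ score t' := by
    rcases hP with ⟨hnil, -⟩ | hP
    · have := congrArg List.length hnil
      rw [List.length_finRange, List.length_nil] at this
      omega
    · exact hP
  refine ⟨cand t, ?_, cand, htop, ⟨t, rfl⟩, fun t' => ?_, hwc t⟩
  · have hres := ev_resid_le hn hr hH hW hD hD' hprog (x := x) (w := w) (by linarith)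
      (hl.trans hk)
    refine Ev.mono (.tl (.call (.cons .arg (.cons .nil (.call (.simple rfl) hres))) hs)) ?_
    have h5 : D * 2 ^ r * W ^ 2 ≤ D * (D * 2 ^ r * W ^ 2) := Nat.le_mul_of_pos_left _ hD
    have h6 : D * (8000 * (D * 2 ^ r * W ^ 2) + 30) ≤ D * (8030 * (D * 2 ^ r * W ^ 2)) :=
      Nat.mul_le_mul_left _ (by omega)
    have h7 : D * (8030 * (D * 2 ^ r * W ^ 2)) = 8030 * (D * (D * 2 ^ r * W ^ 2)) := by ring
    rw [List.length_finRange]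
    simp only [Code.cost]
    omega
  · have h2 := hmin t' (List.mem_finRange t')
    have h3 : ∀ e, 0 ≤ sketchNrm h e := fun e =>
      Finset.sum_nonneg fun _ _ => Finset.sum_nonneg fun _ _ => abs_nonneg _
    simp only [hscore] at h2
    have h4 := h3 (x - entryVec (cand t))
    have h5 := h3 (x - entryVec (cand t'))
    omega

theorem IsStep.contraction (hh : IsExpander h (4 * k)) (hD : 0 < D) {x : F2 n → ℤ}
    {w w' : List (F2 n × ℤ)} (hl : w.length ≤ k) (hw : IsStep k h x w w')
    {S : Finset (F2 n)} (hS : S.card ≤ k) :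
    4 * nrm (x - entryVec w') ≤ nrm (x - entryVec w) + 68 * nrm (x - restrict S x) := by
  obtain ⟨cand, htop, ⟨t, rfl⟩, hsel, -⟩ := hw
  have hsupp : ∀ w : List (F2 n × ℤ), ∀ a ∉ (w.map Prod.fst).toFinset, entryVec w a = 0 := by
    intro w a ha
    exact entryVec_apply_of_notMem (by simpa using ha)
  have hcard : ∀ w : List (F2 n × ℤ), w.length ≤ k → (w.map Prod.fst).toFinset.card ≤ k :=
    fun w hw => (List.toFinset_card_le _).trans (by rwa [List.length_map])
  exact hh.contraction hD (cand := fun t => entryVec (cand t)) hS (hcard w hl) (hsupp w)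
    (hcard _ (htop t).length_le) (hsupp (cand t)) (fun t => (htop t).nrm_le S hS) hsel

/-- The iteration, on the argument `env`. The digits of the norm of the sketch serve as a counter
for the steps. -/
def iterateC (prog : Code) : Code :=
  call (foldC (call (stepC prog) (.cons x1 x2))) (.cons .arg (.cons .nil
    (call normC (.cons x2 (.cons .nil (.tl (.tl (.tl (.tl .arg)))))))))

theorem ev_iterate (hn : n ≤ W) (hr : r ≤ W) (hH : H ≤ W) (hW : 0 < W) (hD : 0 < D)
    (hD' : D ≤ 2 ^ W) (hk : k ≤ 2 * 2 ^ r) (hprog : ComputesHash prog k H h)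
    (hh : IsExpander h (4 * k)) {x : F2 n → ℤ}
    (hb : 5 * D * 4 ^ (sketchNrm h x).natAbs.size * nrm x < 2 ^ W)
    (hs : (sketchNrm h x).natAbs.size ≤ W) :
    ∃ w, Ev (iterateC prog) (iterateC prog) (encEnv k h x) (encList (w.map encEntry))
        (12000 * (D * (D * 2 ^ r * W ^ 3))) ∧
      (w.map Prod.fst).Nodup ∧ w.length ≤ k ∧ weight w < 2 ^ W ∧
      ∀ S : Finset (F2 n), S.card ≤ k →
        nrm (x - entryVec w) ≤ 30 * nrm (x - restrict S x) := by
  have h0 := nrm_nonneg x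
  have hD1 : (1 : ℤ) ≤ D := by exact_mod_cast hD
  set m := (sketchNrm h x).natAbs with hm
  have hlen : (m.bits).length = m.size := Nat.size_eq_bits_len m
  have hpow : ∀ i ≤ m.size, (4 : ℤ) ^ i * nrm x ≤ 4 ^ m.size * nrm x := fun i hi =>
    mul_le_mul_of_nonneg_right (pow_le_pow_right₀ (by norm_num) hi) h0
  have hx0 : nrm x ≤ 4 ^ m.size * nrm x :=
    le_mul_of_one_le_left h0 (one_le_pow₀ (by norm_num))
  -- With `τ` the error of the best sparse approximation, `4 E' ≤ E + 68 τ` gives by induction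
  -- `E ≤ ‖x‖ / 4 ^ i + 23 τ` after `i` steps, and weights are multiplied by at most `4`.
  obtain ⟨s, hfold, w, rfl, hnd, hl, hwt, herr⟩ := ev_fold
    (g := call (stepC prog) (.cons x1 x2)) (env := encEnv k h x) (encA := encBit)
    (τ := 11010 * (D * (D * 2 ^ r * W ^ 2))) (l := m.bits) (s := .nil)
    (fun l₁ s => ∃ w : List (F2 n × ℤ), s = encList (w.map encEntry) ∧ (w.map Prod.fst).Nodup ∧
      w.length ≤ k ∧ weight w ≤ 4 ^ l₁.length * nrm x ∧
      ∀ S : Finset (F2 n), S.card ≤ k → 4 ^ l₁.length * nrm (x - entryVec w) ≤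
        nrm x + 4 ^ l₁.length * (23 * nrm (x - restrict S x)))
    ⟨[], rfl, by simp, by simp, by simpa [weight] using h0, fun S _ => by
      have := nrm_nonneg (x - restrict S x)
      simpa [entryVec] using this⟩ (by
      rintro l₁ c l₂ hl₁ _ ⟨w, rfl, -, hl, hwt, herr⟩
      have hlt : l₁.length + 1 ≤ m.size := by
        rw [← hlen, hl₁]; simp
      have h1 := hpow l₁.length (by omega)
      obtain ⟨w', hw', hstep⟩ := ev_step hn hr hH hW hD hD' hk hprog (x := x) (w := w)
        (lt_of_le_of_lt (by
          rw [mul_comm 5, mul_assoc, mul_assoc]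
          refine mul_le_mul_of_nonneg_left ?_ (by positivity)
          linarith) hb) hl
      have hcon := fun S hS => IsStep.contraction hh hD hl hstep (S := S) hS
      obtain ⟨cand, htop, ⟨t, rfl⟩, -, hw2⟩ := hstep
      have hR : 0 < D * (D * 2 ^ r * W ^ 2) := by positivity
      refine ⟨_, Ev.mono (.call (.simple rfl) hw') (by simp only [Code.cost]; omega), cand t, rfl,
        (htop t).nodup, (htop t).length_le, ?_, fun S hS => ?_⟩
      · have h2 : nrm x ≤ 4 ^ l₁.length * nrm x :=
          le_mul_of_one_le_left h0 (one_le_pow₀ (by norm_num))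
        rw [List.length_append, List.length_singleton, pow_succ]
        linarith
      · have h2 := mul_le_mul_of_nonneg_left (hcon S hS)
          (show (0 : ℤ) ≤ 4 ^ l₁.length by positivity)
        have h3 := herr S hS
        have h4 : (0 : ℤ) ≤ 4 ^ l₁.length * nrm (x - restrict S x) :=
          mul_nonneg (by positivity) (nrm_nonneg _)
        rw [List.length_append, List.length_singleton, pow_succ]
        linarith)
  rw [hlen] at hfold hwt herr
  refine ⟨w, ?_, hnd, hl, ?_, fun S hS => ?_⟩
  · have hmW : m < 2 ^ W := Nat.size_le.1 hs
    refine Ev.mono (.call (.cons .arg (.cons .nil (.call (.simple rfl)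
      (ev_norm_le hr hW hD hmW)))) hfold) ?_
    have h5 : D * 2 ^ r * W ^ 2 ≤ D * (D * 2 ^ r * W ^ 2) := Nat.le_mul_of_pos_left _ hD
    have h6 : D * (D * 2 ^ r * W ^ 2) ≤ D * (D * 2 ^ r * W ^ 2) * W :=
      Nat.le_mul_of_pos_right _ hW
    have h7 : 0 < D * (D * 2 ^ r * W ^ 2) := by positivity
    have h8 : m.size * (11010 * (D * (D * 2 ^ r * W ^ 2)) + 30) ≤
        W * (11040 * (D * (D * 2 ^ r * W ^ 2))) := Nat.mul_le_mul hs (by omega)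
    have h9 : D * (D * 2 ^ r * W ^ 3) = D * (D * 2 ^ r * W ^ 2) * W := by ring
    rw [h9]
    simp only [Code.cost]
    linarith
  · refine lt_of_le_of_lt hwt (lt_of_le_of_lt ?_ hb)
    rw [mul_assoc]
    exact le_mul_of_one_le_left (mul_nonneg (by positivity) h0) (by linarith)
  · refine hh.error_le hD hS ?_ (herr S hS)
    have h1 : m < 2 ^ m.size := Nat.lt_size_self m
    zify at h1
    refine lt_of_le_of_lt (le_abs_self _) ?_
    rwa [hm, Int.natCast_natAbs] at h1

/-- The recovery program, on the argument `(n, r, k, y, y')`. -/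
def recoverC (prog : Code) : Code :=
  call (iterateC prog) (.cons x1 (.cons x2 (.cons (call unaryC (.hd r2)) (.cons (.hd r2)
    (call zipListC (.cons x2 (.tl r2)))))))

/-- The input of the recovery program, for integer vectors. -/
def encInput (k : ℕ) (h : F2 n → Fin D → F2 r) (x : F2 n → ℤ) : SExp :=
  .cons (encUnary n) (.cons (encUnary r) (.cons (encNat k) (.cons
    (encList ((List.finRange D).map fun t => encArray r fun b =>
      encInt (∑ a, bucket h t b x a)))
    (encList ((List.finRange D).map fun t => encArray r fun b => encInts (List.ofFn fun j =>
      ∑ a, if a j = 1 then bucket h t b x a else 0))))))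

theorem ev_recover (hn : n ≤ W) (hr : r ≤ W) (hH : H ≤ W) (hW : 0 < W) (hD : 0 < D)
    (hD' : D ≤ 2 ^ W) (hk : k ≤ 2 * 2 ^ r) (hprog : ComputesHash prog k H h)
    (hh : IsExpander h (4 * k)) {x : F2 n → ℤ}
    (hb : 5 * D * 4 ^ (sketchNrm h x).natAbs.size * nrm x < 2 ^ W)
    (hs : (sketchNrm h x).natAbs.size ≤ W) :
    ∃ w, Ev (recoverC prog) (recoverC prog) (encInput k h x) (encList (w.map encEntry))
        (13000 * (D * (D * 2 ^ r * W ^ 3))) ∧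
      (w.map Prod.fst).Nodup ∧ w.length ≤ k ∧ weight w < 2 ^ W ∧
      ∀ S : Finset (F2 n), S.card ≤ k →
        nrm (x - entryVec w) ≤ 30 * nrm (x - restrict S x) := by
  obtain ⟨w, hw, hprop⟩ := ev_iterate hn hr hH hW hD hD' hk hprog hh hb hs
  refine ⟨w, ?_, hprop⟩
  refine Ev.mono (.call (.cons (.simple rfl) (.cons (.simple rfl) (.cons
    (.call (.simple rfl) (ev_unary k)) (.cons (.simple rfl)
    (.call (.simple rfl) (ev_zipList _ _ (List.finRange D))))))) hw) ?_
  rw [List.length_finRange]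
  have h1 : D * (2 ^ r * 80) ≤ D * (D * (2 ^ r * 80)) := Nat.le_mul_of_pos_left _ hD
  have h2 : 2 ^ r ≤ D * (D * 2 ^ r) := by
    rw [← mul_assoc]; exact Nat.le_mul_of_pos_left _ (by positivity)
  have h3 : D * (D * 2 ^ r) ≤ D * (D * 2 ^ r) * W ^ 3 := Nat.le_mul_of_pos_right _ (by positivity)
  have h4 : D * (D * 2 ^ r * W ^ 3) = D * (D * 2 ^ r) * W ^ 3 := by ring
  have h5 := Nat.one_le_two_pow (n := r)
  rw [h4]
  simp only [Code.cost]
  linarith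

end Recovery

/-! ### Sizes and magnitudes -/

section Final

variable {n D r k W : ℕ} {h : F2 n → Fin D → F2 r}

/-- A number that can be read in time `T` is below `2 ^ T`. -/
theorem lt_two_pow_size_encNat (m : ℕ) : m < 2 ^ (encNat m).size := by
  induction m using Nat.strong_induction_on with
  | _ m ih =>
    by_cases h : m = 0
    · subst h; positivity
    · rw [encNat_of_ne_zero h, SExp.size]
      have h1 := ih (m / 2) (by omega)
      have h2 : (2 : ℕ) ^ ((encNat (m / 2)).size + 1) ≤
          2 ^ ((encBit (decide (m % 2 = 1))).size + (encNat (m / 2)).size + 1) :=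
        Nat.pow_le_pow_right (by norm_num) (by omega)
      rw [pow_succ] at h2
      omega

theorem size_encInput_le (hn : n ≤ W) (hr : r ≤ W) (hW : 0 < W) (hD : 0 < D)
    (hk : k ≤ 2 * 2 ^ r) {x : F2 n → ℤ} (hx : nrm x < 2 ^ W) :
    (encInput k h x).size ≤ 100 * (D * 2 ^ r * W ^ 2) := by
  have hsum : ∀ t b, (encInt (∑ a, bucket h t b x a)).size ≤ W * 4 + 5 := fun t b =>
    size_encInt_le (natAbs_lt_two_pow ((abs_sum_le_nrm _).trans_lt
      ((nrm_bucket_le h t b x).trans_lt hx)))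
  have hbit : ∀ t b, (encInts (List.ofFn fun j => ∑ a, if a j = 1 then bucket h t b x a
      else 0)).size ≤ n * (W * 4 + 6) + 1 := fun t b => by
    refine (size_encList_le (B := W * 4 + 5) fun s hs => ?_).trans (by simp)
    obtain ⟨z, hz, rfl⟩ := List.mem_map.1 hs
    obtain ⟨j, rfl⟩ := (List.mem_ofFn' _ _).1 hz
    exact size_encInt_le (natAbs_lt_two_pow ((abs_bit_le_nrm _ j).trans_lt
      ((nrm_bucket_le h t b x).trans_lt hx)))
  have h1 : (encList ((List.finRange D).map fun t => encArray r fun b =>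
      encInt (∑ a, bucket h t b x a))).size ≤ D * (2 ^ r * (W * 4 + 6) + 1) + 1 := by
    refine (size_encList_le (B := 2 ^ r * (W * 4 + 6)) fun s hs => ?_).trans (by simp)
    obtain ⟨t, -, rfl⟩ := List.mem_map.1 hs
    have := size_encArray_le (hsum t)
    linarith
  have h2 : (encList ((List.finRange D).map fun t => encArray r fun b => encInts (List.ofFn fun j =>
      ∑ a, if a j = 1 then bucket h t b x a else 0))).size ≤
      D * (2 ^ r * (n * (W * 4 + 6) + 2) + 1) + 1 := by
    refine (size_encList_le (B := 2 ^ r * (n * (W * 4 + 6) + 2)) fun s hs => ?_).trans (by simp)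
    obtain ⟨t, -, rfl⟩ := List.mem_map.1 hs
    have := size_encArray_le (hbit t)
    linarith
  have h3 : k < 2 ^ (W + 2) := by
    have := Nat.pow_le_pow_right (n := 2) (by norm_num) hr
    have := Nat.one_le_two_pow (n := W)
    rw [pow_add]
    omega
  have h4 := size_encNat_le h3
  have hQ := Nat.one_le_two_pow (n := r)
  have hW2 : W ≤ W ^ 2 := Nat.le_self_pow (by norm_num) W
  have h5 : n * (W * 4 + 6) ≤ W * (10 * W) := Nat.mul_le_mul hn (by omega)
  have h6 : 2 ^ r * (n * (W * 4 + 6) + 2) + 1 ≤ 2 ^ r * (13 * W ^ 2) := by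
    have : 2 ^ r * (n * (W * 4 + 6) + 3) ≤ 2 ^ r * (13 * W ^ 2) :=
      Nat.mul_le_mul_left _ (by linarith)
    linarith
  have h7 : 2 ^ r * (W * 4 + 6) + 1 ≤ 2 ^ r * (11 * W ^ 2) := by
    have : 2 ^ r * (W * 4 + 7) ≤ 2 ^ r * (11 * W ^ 2) :=
      Nat.mul_le_mul_left _ (by linarith)
    linarith
  have h8 := Nat.mul_le_mul_left D h6
  have h9 := Nat.mul_le_mul_left D h7
  have h10 : W ^ 2 ≤ D * 2 ^ r * W ^ 2 := Nat.le_mul_of_pos_left _ (Nat.mul_pos hD hQ)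
  simp only [encInput, SExp.size, size_encUnary]
  linarith

theorem size_output_le (hn : n ≤ W) (hW : 0 < W) {w : List (F2 n × ℤ)}
    (hl : w.length ≤ 2 * 2 ^ r) (hw : weight w < 2 ^ W) :
    (encList (w.map encEntry)).size ≤ 40 * (2 ^ r * W) := by
  have hQ := Nat.one_le_two_pow (n := r)
  have h1 : (encList (w.map encEntry)).size ≤ (w.map encEntry).length * (8 * W + 8) + 1 := by
    refine size_encList_le fun s hs => ?_
    obtain ⟨q, hq, rfl⟩ := List.mem_map.1 hs
    have h2 : |q.2| ≤ weight w := by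
      refine List.single_le_sum (l := w.map fun q => |q.2|) (fun y hy => ?_) _
        (List.mem_map.2 ⟨q, hq, rfl⟩)
      obtain ⟨p, -, rfl⟩ := List.mem_map.1 hy
      exact abs_nonneg _
    have h3 := size_encInt_le (natAbs_lt_two_pow (h2.trans_lt hw))
    have h4 := size_encF2_le q.1
    simp only [encEntry, SExp.size]
    omega
  rw [List.length_map] at h1
  have h2 : w.length * (8 * W + 8) ≤ 2 * 2 ^ r * (16 * W) := Nat.mul_le_mul hl (by omega)
  have h3 : 1 ≤ 2 ^ r * W := Nat.mul_pos hQ hW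
  linarith

/-! ### Fixed-point numbers -/

theorem encFix_div (p : ℕ) (z : ℤ) : encFix p ((z : ℝ) / 2 ^ p) = encInt z := by
  rw [encFix, mul_div_cancel₀ _ (by positivity), Int.floor_intCast]

/-- Scaling by `2 ^ p` makes all measurements integers. -/
theorem sketchInput_eq (p : ℕ) {x : F2 n → ℝ} {m : F2 n → ℤ} (hx : ∀ i, x i = m i / 2 ^ p) :
    sketchInput p k ((adjMatrix h).mulVec x) ((rowTensor (adjMatrix h) (bitSelection n)).mulVec x) =
      encInput k h m := by
  have h1 : ∀ t b, (adjMatrix h).mulVec x (t, b) =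
      ((∑ a, bucket h t b m a : ℤ) : ℝ) / 2 ^ p := fun t b => by
    rw [Matrix.mulVec, dotProduct, Int.cast_sum, Finset.sum_div]
    refine Finset.sum_congr rfl fun a _ => ?_
    by_cases ha : h a t = b <;> simp [adjMatrix, bucket, ha, hx]
  have h2 : ∀ t b j, (rowTensor (adjMatrix h) (bitSelection n)).mulVec x ((t, b), j) =
      ((∑ a, (if a j = 1 then bucket h t b m a else 0) : ℤ) : ℝ) / 2 ^ p := fun t b j => by
    rw [Matrix.mulVec, dotProduct, Int.cast_sum, Finset.sum_div]
    refine Finset.sum_congr rfl fun a _ => ?_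
    by_cases ha : h a t = b <;> by_cases hj : a j = 1 <;>
      simp [adjMatrix, rowTensor, bitSelection, bucket, ha, hj, hx]
  simp only [sketchInput, encInput, h1, h2, encFix_div, ← List.ofFn_eq_map, encInts,
    List.map_ofFn, Function.comp_def]

theorem l1norm_div (p : ℕ) (m : F2 n → ℤ) :
    l1norm (fun i => (m i : ℝ) / 2 ^ p) = (nrm m : ℝ) / 2 ^ p := by
  rw [l1norm, nrm, Int.cast_sum, Finset.sum_div]
  exact Finset.sum_congr rfl fun a _ => by
    rw [abs_div, abs_of_pos (show (0 : ℝ) < 2 ^ p by positivity), Int.cast_abs]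

/-- The head of a vector is its restriction to some set of `k` positions. -/
theorem IsHead.exists_restrict {p : ℕ} {x w : F2 n → ℝ} {m : F2 n → ℤ}
    (hx : ∀ i, x i = m i / 2 ^ p) (hw : IsHead k x w) : ∃ S : Finset (F2 n), S.card = k ∧
      l1norm (x - w) = (nrm (m - restrict S m) : ℝ) / 2 ^ p := by
  obtain ⟨S, hS, -, h1, h2⟩ := hw
  refine ⟨S, hS, ?_⟩
  rw [← l1norm_div]
  congr 1
  funext i
  by_cases hi : i ∈ S
  · simp [h1 i hi, restrict, hi]
  · simp [h2 i hi, restrict, hi, hx]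

theorem entryVec_apply_of_mem {w : List (F2 n × ℤ)} (hw : (w.map Prod.fst).Nodup) :
    ∀ q ∈ w, entryVec w q.1 = q.2 := by
  induction w with
  | nil => simp
  | cons p w ih =>
    rw [List.map_cons, List.nodup_cons] at hw
    have h1 : entryVec (p :: w) = entryVec [p] + entryVec w := entryVec_append [p] w
    intro q hq
    rw [h1, entryVec_singleton, Pi.add_apply]
    rcases List.mem_cons.1 hq with rfl | hq
    · rw [Pi.single_eq_same, entryVec_apply_of_notMem hw.1, add_zero]
    · rw [ih hw.2 q hq, Pi.single_eq_of_ne, zero_add]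
      intro heq
      exact hw.1 (heq ▸ List.mem_map_of_mem hq)

/-! ### Assembling the bounds -/

/-- A bound for the bit lengths of all numbers in the iteration. -/
theorem magnitude_bound {U V : ℕ} (hD : D ≤ 2 ^ U) {x : F2 n → ℤ} (hx : nrm x ≤ 2 ^ V) :
    (sketchNrm h x).natAbs.size ≤ U + V + 1 ∧
      5 * D * 4 ^ (sketchNrm h x).natAbs.size * nrm x < 2 ^ (3 * (U + V) + 5) := by
  have h0 := nrm_nonneg x
  have hD' : (D : ℤ) ≤ 2 ^ U := by exact_mod_cast hD
  have h1 : D * nrm x ≤ 2 ^ (U + V) := by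
    rw [pow_add]; exact mul_le_mul hD' hx h0 (by positivity)
  have h2 : (sketchNrm h x).natAbs.size ≤ U + V + 1 := by
    rw [Nat.size_le]
    have h3 := (sketchNrm_le (h := h) x).trans h1
    have h4 : 0 ≤ sketchNrm h x :=
      Finset.sum_nonneg fun _ _ => Finset.sum_nonneg fun _ _ => abs_nonneg _
    have h5 : (2 : ℤ) ^ (U + V) < 2 ^ (U + V + 1) :=
      pow_lt_pow_right₀ (by norm_num) (by omega)
    zify
    rw [abs_of_nonneg h4]
    linarith
  refine ⟨h2, ?_⟩
  set s := (sketchNrm h x).natAbs.size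
  have h3 : (4 : ℤ) ^ s ≤ 4 ^ (U + V + 1) := pow_le_pow_right₀ (by norm_num) h2
  have h4 : (4 : ℤ) ^ s * (D * nrm x) ≤ 4 ^ (U + V + 1) * 2 ^ (U + V) :=
    mul_le_mul h3 h1 (by positivity) (by positivity)
  have h5 : (2 : ℤ) ^ (3 * (U + V) + 5) = 8 * (4 ^ (U + V + 1) * 2 ^ (U + V)) := by
    rw [show (4 : ℤ) = 2 ^ 2 by norm_num, ← pow_mul, ← pow_add,
      show (8 : ℤ) = 2 ^ 3 by norm_num, ← pow_add]
    congr 1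
    ring
  have h6 : (0 : ℤ) < 4 ^ (U + V + 1) * 2 ^ (U + V) := by positivity
  rw [h5]
  linarith

theorem nrm_le_two_pow {e L : ℕ} (hL : 0 < L) (hL' : Real.logb 2 L ≤ e * n ^ e) {m : F2 n → ℤ}
    (hm : ∀ i, |m i| ≤ L) : nrm m ≤ 2 ^ (n + e * n ^ e) := by
  have h1 : L ≤ 2 ^ (e * n ^ e) := by
    have h2 : (0 : ℝ) < L := by exact_mod_cast hL
    have h3 := (Real.logb_le_iff_le_rpow (by norm_num) h2).1 hL'
    have h4 : (L : ℝ) ≤ 2 ^ (e * n ^ e) := by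
      rw [← Real.rpow_natCast]
      push_cast
      exact h3
    exact_mod_cast h4
  have h2 : nrm m ≤ ∑ _a : F2 n, (L : ℤ) := Finset.sum_le_sum fun a _ => hm a
  rw [Finset.sum_const, Finset.card_univ, nsmul_eq_mul] at h2
  have h3 : Fintype.card (F2 n) = 2 ^ n := by simp [F2, ZMod.card]
  rw [h3] at h2
  push_cast at h2
  refine h2.trans ?_
  rw [pow_add]
  exact mul_le_mul_of_nonneg_left (by exact_mod_cast h1) (by positivity)

theorem width_le (hn : 0 < n) (C e : ℕ) :
    3 * (C * n ^ C + (n + e * n ^ e)) + 5 ≤ (3 * (C + e + 1) + 5) * n ^ (C + e + 1) := by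
  have h1 : n ^ C ≤ n ^ (C + e + 1) := Nat.pow_le_pow_right hn (by omega)
  have h2 : n ^ e ≤ n ^ (C + e + 1) := Nat.pow_le_pow_right hn (by omega)
  have h3 : n ≤ n ^ (C + e + 1) := Nat.le_self_pow (by omega) n
  have h4 : 1 ≤ n ^ (C + e + 1) := Nat.one_le_pow _ _ hn
  have h5 := Nat.mul_le_mul_left C h1
  have h6 := Nat.mul_le_mul_left e h2
  linarith

theorem time_le (hn : 0 < n) {A a : ℕ} (hW : W ≤ A * n ^ a) :
    14000 * (D * (D * 2 ^ r * W ^ 3)) ≤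
      (14000 * A ^ 3 + 3 * a) * (2 ^ r * D ^ 2 * n ^ (14000 * A ^ 3 + 3 * a)) := by
  have h1 : W ^ 3 ≤ (A * n ^ a) ^ 3 := Nat.pow_le_pow_left hW 3
  have h2 : (A * n ^ a) ^ 3 = A ^ 3 * n ^ (3 * a) := by rw [mul_pow, ← pow_mul, mul_comm a]
  have h3 : n ^ (3 * a) ≤ n ^ (14000 * A ^ 3 + 3 * a) := Nat.pow_le_pow_right hn (by omega)
  calc 14000 * (D * (D * 2 ^ r * W ^ 3))
      = 14000 * (2 ^ r * D ^ 2 * W ^ 3) := by ring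
    _ ≤ 14000 * (2 ^ r * D ^ 2 * (A ^ 3 * n ^ (14000 * A ^ 3 + 3 * a))) := by
        gcongr
        rw [h2] at h1
        exact h1.trans (Nat.mul_le_mul_left _ h3)
    _ = 14000 * A ^ 3 * (2 ^ r * D ^ 2 * n ^ (14000 * A ^ 3 + 3 * a)) := by ring
    _ ≤ _ := Nat.mul_le_mul_right _ (by omega)

end Final

end SparseRecovery

open SparseRecovery
theorem mainTheorem3 :
    ∃ c ε : ℝ, 0 < c ∧ 0 < ε ∧
      ∀ (I : Set (ℕ × ℕ)) (D r : ℕ → ℕ → ℕ)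
        (h : ∀ n k : ℕ, F2 n → Fin (D n k) → F2 (r n k)),
        (∀ n k : ℕ, (n, k) ∈ I → 0 < n ∧ 0 < k ∧ k ≤ 2 ^ n ∧ r n k ≤ n) →
        IsExplicit I h →
        (∀ n k : ℕ, (n, k) ∈ I → IsLosslessCondenser (Real.logb 2 (4 * k)) ε (h n k)) →
        ∀ e : ℕ, ∃ (prog : Code) (C : ℕ), ∀ n k : ℕ, (n, k) ∈ I →
          ∀ L : ℕ, 0 < L → Real.logb 2 L ≤ e * n ^ e →
          ∀ (p : ℕ) (x : F2 n → ℝ), (∀ i, ∃ m : ℤ, |m| ≤ L ∧ x i = m / 2 ^ p) →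
          ∃ (xt : F2 n → ℝ) (out : SExp),
            ComputesIn prog
              (sketchInput p k ((adjMatrix (h n k)).mulVec x)
                ((rowTensor (adjMatrix (h n k)) (bitSelection n)).mulVec x))
              out (C * (2 ^ r n k * D n k ^ 2 * n ^ C)) ∧
            IsSparseList p xt out ∧
            IsSparse k xt ∧
            ∀ w : F2 n → ℝ, IsHead k x w → l1norm (xt - x) ≤ c * l1norm (x - w) := by
  refine ⟨30, 1 / 64, by norm_num, by norm_num, ?_⟩
  rintro I D r h hI ⟨prog, C, hprog⟩ hcond e
  refine ⟨recoverC prog, 14000 * (3 * (C + e + 1) + 5) ^ 3 + 3 * (C + e + 1), ?_⟩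
  intro n k hnk L hL hL' p x hx
  obtain ⟨hn, hk, hkn, hrn⟩ := hI n k hnk
  obtain ⟨hD, hh⟩ := (hcond n k hnk).isExpander hk
  choose m hmL hm using hx
  -- The time bound of the condenser also bounds the bit lengths of the seeds.
  have hD' : D n k ≤ 2 ^ (C * n ^ C) := by
    obtain ⟨s, -, hs⟩ := hprog n k hnk 0 ⟨D n k - 1, by omega⟩
    have h1 := lt_two_pow_size_encNat (D n k - 1)
    simp only [SExp.size] at hs
    have h2 : 2 ^ (encNat (D n k - 1)).size ≤ 2 ^ (C * n ^ C) :=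
      Nat.pow_le_pow_right (by norm_num) (by omega)
    omega
  have hhash : ComputesHash prog k (C * n ^ C) (h n k) := fun a t => by
    obtain ⟨s, hs, hT⟩ := hprog n k hnk a t
    exact ⟨s, by omega, hs⟩
  have hx := nrm_le_two_pow hL hL' hmL
  obtain ⟨hs, hb⟩ := magnitude_bound (h := h n k) hD' hx
  obtain ⟨W, hWdef⟩ : ∃ W, W = 3 * (C * n ^ C + (n + e * n ^ e)) + 5 := ⟨_, rfl⟩
  rw [← hWdef] at hb
  have hkr := hh.le_two_pow hD hkn
  have hW : 0 < W := by omega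
  have hnW : n ≤ W := by omega
  have hrW : r n k ≤ W := by omega
  obtain ⟨w, ⟨s, hsT, hrun⟩, hnd, hl, hwt, herr⟩ := ev_recover hnW hrW
    (by omega) hW hD (hD'.trans (Nat.pow_le_pow_right (by norm_num) (by omega))) hkr hhash hh hb
    (by omega)
  refine ⟨fun i => (entryVec w i : ℝ) / 2 ^ p, encList (w.map encEntry), ⟨s, ?_, ?_⟩,
    ⟨w, hnd, fun q hq => ?_, fun i hi => ?_, rfl⟩, ?_, fun v hv => ?_⟩
  · rwa [sketchInput_eq p hm]
  · rw [sketchInput_eq p hm]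
    refine le_trans ?_ (time_le hn (hWdef.trans_le (width_le hn C e)))
    have h1 := size_encInput_le (h := h n k) hnW hrW hW hD hkr (x := m) (hx.trans_lt
      (pow_lt_pow_right₀ (by norm_num) (by omega)))
    have h2 := size_output_le hnW hW (hl.trans hkr) hwt
    have h3 : D n k * 2 ^ r n k * W ^ 2 ≤ D n k * (D n k * 2 ^ r n k * W ^ 3) :=
      (Nat.mul_le_mul_left _ (Nat.pow_le_pow_right hW (by norm_num))).trans
        (Nat.le_mul_of_pos_left _ hD)
    have h4 : 2 ^ r n k * W ≤ D n k * (D n k * 2 ^ r n k * W ^ 3) := by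
      refine le_trans ?_ (Nat.le_mul_of_pos_left _ hD)
      rw [mul_assoc]
      exact (Nat.mul_le_mul_left _ (Nat.le_self_pow (by norm_num) W)).trans
        (Nat.le_mul_of_pos_left _ hD)
    omega
  · simp only [entryVec_apply_of_mem hnd q hq]
  · simp [entryVec_apply_of_notMem hi]
  · refine le_trans (Set.encard_le_encard (t := ((w.map Prod.fst).toFinset : Set (F2 n)))
      fun i hi => ?_) ?_
    · by_contra hc
      refine hi ?_
      have : i ∉ w.map Prod.fst := by simpa using hc
      simp [entryVec_apply_of_notMem this]
    · rw [Set.encard_coe_eq_coe_finsetCard]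
      exact_mod_cast (List.toFinset_card_le _).trans (by rwa [List.length_map])
  · obtain ⟨S, hS, hnorm⟩ := hv.exists_restrict hm
    have h1 : (fun i => (entryVec w i : ℝ) / 2 ^ p) - x =
        fun i => (((entryVec w - m) i : ℤ) : ℝ) / 2 ^ p := by
      funext i
      simp only [Pi.sub_apply, hm i]
      push_cast
      ring
    rw [hnorm, h1, l1norm_div, nrm_sub_comm, ← mul_div_assoc]
    have h2 : (nrm (m - entryVec w) : ℝ) ≤ 30 * nrm (m - restrict S m) := by
      exact_mod_cast herr S hS.le
    gcongr
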